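/- Let $\widehat{\mathbb C}=\mathbb C\cup\{\infty\}$ carry the vector field $\partial/\partial w$ (flat structure, singular at $\infty$). Let $q,n\ge 2$ and let $\mathcal P\subset\widehat{\mathbb C}$ be a Euclidean polygon with distinct vertices $w_1,\dots,w_q\in\widehat{\mathbb C}$ (indexed cyclically): $\partial\mathcal P$ is a simple closed path whose edges are Euclidean segments from $w_j$ to $w_{j+1}$ (bounded segments, half-lines with an end at $\infty$, or segments of a line passing through $\infty$), with the open region $\mathcal P$ on the left of the oriented edges, and $\mathcal P$ and $\overline{\mathcal P}^{\,c}$ are open Jordan domains. Take $n$ copies $\overline{T_1},\dots,\overline{T_n}$ of $\overline{\mathcal P}$ and $n$ copies $\overline{T'_1},\dots,\overline{T'_n}$ of the closure of $\overline{\mathcal P}^{\,c}$. For each $j$ choose a permutation $\sigma_j$ of $\{1,\dots,n\}$ and glue edge $j$ of $\overline{T_\alpha}$ to the same edge $j$ of $\overline{T'_{\sigma_j(\alpha)}}$ by the orientation-respecting Euclidean isometry, i.e. by the identity of that edge. Assume that the resulting space $M$ is connected. Then $M$ is compact and Hausdorff and carries a complex structure, making it a compact Riemann surface, that is compatible with the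 flat tiles (each open tile, and each pair of open tiles joined along the interior of a common glued edge, is holomorphically embedded). For every such complex structure there is a unique map $R\colon M\to\widehat{\mathbb C}$ with the following properties: (i) $R$ is a rational function of degree $n$ and restricts to the identity $\overline{T_\alpha}\to\overline{\mathcal P}$, $\overline{T'_\alpha}\to\overline{\overline{\mathcal P}^{\,c}}$ on each closed tile; its critical values are among $w_1,\dots,w_q$; with $\gamma=\partial\mathcal P$, its tessellation $\mathscr T_\gamma(R)=M\setminus R^{-1}(\gamma)$ is the glued one: the tiles $T_1,\dots,T_n$ (blue) are the connected components lying over $\mathcal P$, the tiles $T'_1,\dots,T'_n$ (gray) are those lying over $\overline{\mathcal P}^{\,c}$, and these $2n$ sets form a tessellation of $M$ with alternating colors (pairwise disjoint open Jordan domains whose closures cover $M$; the closures of two different tiles meet in finitely many simple paths and points, and in finitely many points if the tiles have the same color). At each vertex $z$ of $M$ (a point arising from vertices of the closed tiles) the cone angle, i.e. the total angle of the tile corners glued at $z$ (measured in the coordinate $1/w$ for corners at $\infty$), equals $2\pi\nu$, where $\nu\in\mathbb N$, $\nu\ge1$, is the multiplicity of $R$ at $z$. (ii) The pullback $X=R^*\frac{\partial}{\partial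 w}$ (in local coordinates $\frac{1}{R'(z)}\frac{\partial}{\partial z}$) is a rational (meromorphic) vector field on $M$, with $R_*X=\frac{\partial}{\partial w}$ at every point where $R$ is unramified. -/

import Mathlib

open Set Filter Topology Manifold
open scoped ContDiff

noncomputable section

/-! ## The Riemann sphere and the vector field `∂/∂w` -/

namespace RiemannSphere

/-- The inversion `w ↦ 1/w` of the Riemann sphere `ℂ ∪ {∞}`. -/
def invMap (x : OnePoint ℂ) : OnePoint ℂ :=
  x.elim ((0 : ℂ) : OnePoint ℂ) (fun w => if w = 0 then OnePoint.infty else ((w⁻¹ : ℂ) : OnePoint ℂ))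

theorem invMap_infty : invMap OnePoint.infty = ((0 : ℂ) : OnePoint ℂ) := rfl

theorem invMap_zero : invMap ((0 : ℂ) : OnePoint ℂ) = OnePoint.infty := by
  change (if (0 : ℂ) = 0 then _ else _) = _
  simp

theorem invMap_coe {w : ℂ} (hw : w ≠ 0) :
    invMap (w : OnePoint ℂ) = ((w⁻¹ : ℂ) : OnePoint ℂ) := by
  change (if w = 0 then _ else _) = _
  simp [hw]

theorem invMap_invMap (x : OnePoint ℂ) : invMap (invMap x) = x := by
  induction x using OnePoint.rec with
  | infty => rw [invMap_infty, invMap_zero]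
  | coe w =>
    by_cases hw : w = 0
    · subst hw; rw [invMap_zero, invMap_infty]
    · rw [invMap_coe hw, invMap_coe (inv_ne_zero hw), inv_inv]

theorem continuous_invMap : Continuous invMap := by
  rw [continuous_iff_continuousAt]
  intro x
  induction x using OnePoint.rec with
  | infty =>
    rw [OnePoint.continuousAt_infty', invMap_infty]
    have h1 : Tendsto (fun w : ℂ => ((w⁻¹ : ℂ) : OnePoint ℂ)) (coclosedCompact ℂ)
        (𝓝 ((0 : ℂ) : OnePoint ℂ)) := by
      rw [coclosedCompact_eq_cocompact, ← Metric.cobounded_eq_cocompact]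
      exact (OnePoint.continuous_coe.tendsto (0 : ℂ)).comp tendsto_inv₀_cobounded
    refine h1.congr' ?_
    have h2 : ({0}ᶜ : Set ℂ) ∈ coclosedCompact ℂ := by
      rw [coclosedCompact_eq_cocompact]
      exact isCompact_singleton.compl_mem_cocompact
    filter_upwards [h2] with w hw
    exact (invMap_coe hw).symm
  | coe w =>
    rw [OnePoint.continuousAt_coe]
    by_cases hw : w = 0
    · subst hw
      rw [ContinuousAt, Function.comp_apply, invMap_zero, ← pure_sup_nhdsNE (0 : ℂ),
        tendsto_sup]
      constructor
      · rw [tendsto_pure_left]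
        intro s hs
        rw [Function.comp_apply, invMap_zero]
        exact mem_of_mem_nhds hs
      · have h1 : Tendsto (fun v : ℂ => ((v⁻¹ : ℂ) : OnePoint ℂ)) (𝓝[{0}ᶜ] (0 : ℂ)) (𝓝 OnePoint.infty) := by
          refine OnePoint.tendsto_coe_infty.comp ?_
          rw [coclosedCompact_eq_cocompact, ← Metric.cobounded_eq_cocompact]
          exact tendsto_inv₀_nhdsNE_zero
        refine h1.congr' ?_
        filter_upwards [self_mem_nhdsWithin] with v hv
        exact (invMap_coe hv).symm
    · have h1 : ContinuousAt (fun v : ℂ => ((v⁻¹ : ℂ) : OnePoint ℂ)) w :=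
        OnePoint.continuous_coe.continuousAt.comp (continuousAt_inv₀ hw)
      refine h1.congr ?_
      filter_upwards [isOpen_compl_singleton.mem_nhds hw] with v hv
      exact (invMap_coe hv).symm

/-- The inversion `w ↦ 1/w` as a homeomorphism. -/
def inversion : OnePoint ℂ ≃ₜ OnePoint ℂ where
  toFun := invMap
  invFun := invMap
  left_inv := invMap_invMap
  right_inv := invMap_invMap
  continuous_toFun := continuous_invMap
  continuous_invFun := continuous_invMap

/-- The affine chart `w` on `ℂ = (ℂ ∪ {∞}) \ {∞}`. -/
def finChart : OpenPartialHomeomorph (OnePoint ℂ) ℂ :=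
  (OnePoint.isOpenEmbedding_coe.toOpenPartialHomeomorph ((↑) : ℂ → OnePoint ℂ)).symm

/-- The chart `1/w` on `(ℂ ∪ {∞}) \ {0}`. -/
def infChart : OpenPartialHomeomorph (OnePoint ℂ) ℂ :=
  inversion.toOpenPartialHomeomorph.trans finChart

theorem finChart_source : finChart.source = range ((↑) : ℂ → OnePoint ℂ) := by
  simp [finChart]

theorem finChart_target : finChart.target = univ := by
  simp [finChart]

theorem finChart_symm_apply (w : ℂ) : finChart.symm w = (w : OnePoint ℂ) := rfl

theorem finChart_coe (w : ℂ) : finChart (w : OnePoint ℂ) = w := by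
  have h := finChart.right_inv (x := w) (by simp [finChart_target])
  rwa [finChart_symm_apply] at h

theorem infChart_symm_apply (w : ℂ) : infChart.symm w = invMap (w : OnePoint ℂ) := rfl

theorem infChart_apply (x : OnePoint ℂ) : infChart x = finChart (invMap x) := rfl

theorem mem_infChart_source (x : OnePoint ℂ) : x ∈ infChart.source ↔ invMap x ≠ OnePoint.infty := by
  have h : infChart.source = invMap ⁻¹' finChart.source := by
    simp [infChart, inversion]
  rw [h, mem_preimage, finChart_source, OnePoint.ne_infty_iff_exists]
  rfl

/-- The Riemann sphere: `chartAt w = w` at the finite points and `chartAt ∞ = 1/w`. -/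
instance : ChartedSpace ℂ (OnePoint ℂ) where
  atlas := {finChart, infChart}
  chartAt x := x.elim infChart (fun _ => finChart)
  mem_chart_source x := by
    induction x using OnePoint.rec with
    | infty =>
      change (OnePoint.infty : OnePoint ℂ) ∈ infChart.source
      rw [mem_infChart_source, invMap_infty]
      exact OnePoint.coe_ne_infty _
    | coe w =>
      change (w : OnePoint ℂ) ∈ finChart.source
      rw [finChart_source]
      exact mem_range_self w
  chart_mem_atlas x := by
    induction x using OnePoint.rec with
    | infty => exact Or.inr rfl
    | coe w => exact Or.inl rfl

/-- The Riemann sphere is a complex manifold. -/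
instance : IsManifold 𝓘(ℂ) ω (OnePoint ℂ) := by
  refine isManifold_of_contDiffOn 𝓘(ℂ) ω (OnePoint ℂ) ?_
  have key : ∀ f : ℂ → ℂ, ∀ s : Set ℂ, (∀ w ∈ s, w ≠ 0 ∧ f w = w⁻¹) → ContDiffOn ℂ ω f s := by
    intro f s h
    have h1 : ContDiffOn ℂ ω (fun w : ℂ => w⁻¹) s := fun w hw =>
      (contDiffAt_inv ℂ (h w hw).1).contDiffWithinAt
    exact h1.congr fun w hw => (h w hw).2
  have keyid : ∀ f : ℂ → ℂ, ∀ s : Set ℂ, (∀ w ∈ s, f w = w) → ContDiffOn ℂ ω f s :=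
    fun f s h => contDiffOn_id.congr fun w hw => h w hw
  intro e e' he he'
  rcases he with rfl | he <;> rcases he' with rfl | he'
  · refine keyid _ _ fun w _ => ?_
    exact finChart_coe w
  · rw [mem_singleton_iff] at he'
    subst he'
    refine key _ _ fun w hw => ?_
    have h1 : (w : OnePoint ℂ) ∈ infChart.source := by
      have := hw.1
      simp only [mem_preimage, OpenPartialHomeomorph.trans_source] at this
      exact this.2
    have h0 : w ≠ 0 := by
      rintro rfl
      rw [mem_infChart_source, invMap_zero] at h1
      exact h1 rfl
    refine ⟨h0, ?_⟩
    change finChart (invMap (w : OnePoint ℂ)) = w⁻¹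
    rw [invMap_coe h0, finChart_coe]
  · rw [mem_singleton_iff] at he
    subst he
    refine key _ _ fun w hw => ?_
    have h1 : invMap (w : OnePoint ℂ) ∈ finChart.source := by
      have := hw.1
      simp only [mem_preimage, OpenPartialHomeomorph.trans_source] at this
      exact this.2
    have h0 : w ≠ 0 := by
      rintro rfl
      rw [invMap_zero, finChart_source] at h1
      obtain ⟨y, hy⟩ := h1
      exact OnePoint.coe_ne_infty y hy
    refine ⟨h0, ?_⟩
    change finChart (invMap (w : OnePoint ℂ)) = w⁻¹
    rw [invMap_coe h0, finChart_coe]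
  · rw [mem_singleton_iff] at he he'
    subst he he'
    refine keyid _ _ fun w _ => ?_
    change finChart (invMap (invMap (w : OnePoint ℂ))) = w
    rw [invMap_invMap, finChart_coe]

/-- The holomorphic vector field `∂/∂w` on the Riemann sphere; it vanishes (to order two)
at `∞`. -/
def ddw (x : OnePoint ℂ) : TangentSpace 𝓘(ℂ) x :=
  OnePoint.rec (C := fun x => TangentSpace 𝓘(ℂ) x) (0 : ℂ)
    (fun w => mfderiv 𝓘(ℂ) 𝓘(ℂ) ((↑) : ℂ → OnePoint ℂ) w (1 : ℂ)) x

/-- The point at angle `φ` on the circle of radius `r` about `p`: for finite `p` this is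
`p + r e^{iφ}`; about `∞` the coordinate `1/w` is used. -/
def circlePoint (p : OnePoint ℂ) (r φ : ℝ) : OnePoint ℂ :=
  p.elim (invMap ((r * Complex.exp (φ * Complex.I) : ℂ) : OnePoint ℂ))
    (fun w => ((w + r * Complex.exp (φ * Complex.I) : ℂ) : OnePoint ℂ))

/-- The angular size of the part of the circle of radius `r` about `p` that lies in `U`, that is,
its length divided by `r`. -/
def angularSize (U : Set (OnePoint ℂ)) (p : OnePoint ℂ) (r : ℝ) : ℝ :=
  MeasureTheory.volume.real {φ : ℝ | φ ∈ Ioc (-Real.pi) Real.pi ∧ circlePoint p r φ ∈ U}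

end RiemannSphere

open RiemannSphere

/-! ## Jordan domains, arcs, tessellations -/

/-- An open Jordan domain: an open set whose closure is a closed disc, the set itself
corresponding to the open disc. -/
def IsJordanDomain {X : Type*} [TopologicalSpace X] (U : Set X) : Prop :=
  IsOpen U ∧ ∃ e : ℂ → X, ContinuousOn e (Metric.closedBall 0 1) ∧
    InjOn e (Metric.closedBall 0 1) ∧ e '' Metric.ball 0 1 = U

/-- A simple path (with its extreme points). -/
def IsSimplePath {X : Type*} [TopologicalSpace X] (A : Set X) : Prop :=
  ∃ f : unitInterval → X, Continuous f ∧ Function.Injective f ∧ range f = A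

/-- A tessellation by `n` blue and `n` gray tiles with alternating colors: the tiles are pairwise
disjoint open Jordan domains whose closures cover the surface; the closures of two different tiles
meet in finitely many simple paths (edges) and points (vertices); two tiles of the same color meet
at vertices only. -/
structure IsTessellation {X : Type*} [TopologicalSpace X] {n : ℕ} (tile : Fin n ⊕ Fin n → Set X) :
    Prop where
  jordan : ∀ τ, IsJordanDomain (tile τ)
  disjoint : ∀ τ τ', τ ≠ τ' → Disjoint (tile τ) (tile τ')
  cover : ⋃ τ, closure (tile τ) = univ
  meet : ∀ τ τ', τ ≠ τ' → ∃ (edges : Set (Set X)) (vertices : Set X),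
    edges.Finite ∧ vertices.Finite ∧ (∀ A ∈ edges, IsSimplePath A) ∧
    closure (tile τ) ∩ closure (tile τ') = ⋃₀ edges ∪ vertices
  alternating : ∀ τ τ', τ ≠ τ' → τ.isLeft = τ'.isLeft →
    (closure (tile τ) ∩ closure (tile τ')).Finite

/-! ## Rational functions on Riemann surfaces -/

section RiemannSurface

variable {M : Type*} [TopologicalSpace M] [ChartedSpace ℂ M]

/-- The multiplicity (ramification index) of a holomorphic map `R : M → ℂ ∪ {∞}` at `z`: the order
of vanishing of `R - R z` in local coordinates. -/
def multiplicityAt (R : M → OnePoint ℂ) (z : M) : ℕ∞ :=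
  analyticOrderAt
    (fun ζ : ℂ => chartAt ℂ (R z) (R ((chartAt ℂ z).symm ζ)) - chartAt ℂ (R z) (R z))
    (chartAt ℂ z z)

/-- The critical values of `R`. -/
def criticalValues (R : M → OnePoint ℂ) : Set (OnePoint ℂ) :=
  R '' {z | 1 < multiplicityAt R z}

/-- `R` is a rational function of degree `n`: a holomorphic map to the Riemann sphere each of whose
values is attained exactly `n` times, counted with multiplicity. -/
def IsRationalOfDegree (n : ℕ) (R : M → OnePoint ℂ) : Prop :=
  MDifferentiable 𝓘(ℂ) 𝓘(ℂ) R ∧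
    ∀ w, (R ⁻¹' {w}).Finite ∧ ∑ᶠ z ∈ R ⁻¹' {w}, multiplicityAt R z = n

/-- The vector field `X` is rational, i.e. meromorphic in every local coordinate. -/
def IsRationalVectorField (X : (z : M) → TangentSpace 𝓘(ℂ) z) : Prop :=
  ∀ z₀ : M, MeromorphicAt
    (fun ζ : ℂ => (mfderiv 𝓘(ℂ) 𝓘(ℂ) (chartAt ℂ z₀) ((chartAt ℂ z₀).symm ζ)
      (X ((chartAt ℂ z₀).symm ζ)) : ℂ))
    (chartAt ℂ z₀ z₀)

/-- The tiles over `U` of the tessellation determined by `R` and a Jordan path `γ`, where `U` is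
one of the two sides of `γ`: the connected components of `M \ R⁻¹(γ)` that `R` maps into `U`. -/
def tilesOver (R : M → OnePoint ℂ) (γ U : Set (OnePoint ℂ)) : Set (Set M) :=
  {C | ∃ z, R z ∈ U ∧ C = connectedComponentIn (R ⁻¹' γ)ᶜ z}

end RiemannSurface

/-! ## Euclidean polygons in the sphere -/

/-- `E` is a Euclidean segment in `ℂ ∪ {∞}`, oriented from `a` to `b`, with direction `u ≠ 0`.
It is a bounded segment, the segment through `∞` on the line through two finite points, or a
half-line ending or starting at `∞`. -/
def IsEuclideanSegment (a b : OnePoint ℂ) (u : ℂ) (E : Set (OnePoint ℂ)) : Prop :=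
  (∃ x y : ℂ, x ≠ y ∧ a = x ∧ b = y ∧ u = y - x ∧
    E = ((↑) : ℂ → OnePoint ℂ) '' segment ℝ x y) ∨
  (∃ x y : ℂ, x ≠ y ∧ a = x ∧ b = y ∧ u = x - y ∧
    E = insert OnePoint.infty (((↑) : ℂ → OnePoint ℂ) ''
      {w | ∃ t : ℝ, (t ≤ 0 ∨ 1 ≤ t) ∧ w = x + t * (y - x)})) ∨
  (∃ x : ℂ, a = x ∧ b = OnePoint.infty ∧ u ≠ 0 ∧
    E = insert OnePoint.infty (((↑) : ℂ → OnePoint ℂ) '' {w | ∃ t : ℝ, 0 ≤ t ∧ w = x + t * u})) ∨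
  (∃ y : ℂ, a = OnePoint.infty ∧ b = y ∧ u ≠ 0 ∧
    E = insert OnePoint.infty (((↑) : ℂ → OnePoint ℂ) '' {w | ∃ t : ℝ, 0 ≤ t ∧ w = y - t * u}))

/-- A Euclidean polygon in the flat sphere `(ℂ ∪ {∞}, ∂/∂w)` with `q` vertices in cyclic order. Its
boundary is a simple closed polygonal path whose edge `j` is a Euclidean segment oriented from
vertex `j` to vertex `j + 1`; the (open) region is on the left of the edges, and not on their
right; the region and the complement of its closure are open Jordan domains. -/
structure EuclideanPolygon (q : ℕ) where
  vertex : ZMod q → OnePoint ℂ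
  edge : ZMod q → Set (OnePoint ℂ)
  direction : ZMod q → ℂ
  region : Set (OnePoint ℂ)
  vertex_injective : Function.Injective vertex
  edge_segment : ∀ j, IsEuclideanSegment (vertex j) (vertex (j + 1)) (direction j) (edge j)
  edge_inter : ∀ j k, j ≠ k → edge j ∩ edge k ⊆ range vertex
  vertex_mem_edge : ∀ j k, vertex k ∈ edge j → k = j ∨ k = j + 1
  frontier_region : frontier region = ⋃ j, edge j
  left_side : ∀ (j : ZMod q) (w : ℂ), (w : OnePoint ℂ) ∈ edge j → (w : OnePoint ℂ) ≠ vertex j →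
    (w : OnePoint ℂ) ≠ vertex (j + 1) → ∀ᶠ ε : ℝ in 𝓝[>] 0,
      ((w + ε * (Complex.I * direction j) : ℂ) : OnePoint ℂ) ∈ region ∧
      ((w - ε * (Complex.I * direction j) : ℂ) : OnePoint ℂ) ∉ closure region
  jordan_region : IsJordanDomain region
  jordan_compl : IsJordanDomain (closure region)ᶜ

namespace EuclideanPolygon

variable {q n : ℕ}

/-- The `2n` open tiles: `n` blue copies of the polygon and `n` gray copies of the complement of
the closed polygon. -/
def openTile (P : EuclideanPolygon q) : Fin n ⊕ Fin n → Set (OnePoint ℂ) :=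
  Sum.elim (fun _ => P.region) (fun _ => (closure P.region)ᶜ)

/-- The disjoint union of the `2n` closed tiles. -/
abbrev TileUnion (P : EuclideanPolygon q) (n : ℕ) : Type :=
  {x : (Fin n ⊕ Fin n) × OnePoint ℂ // x.2 ∈ closure (P.openTile x.1)}

/-- The gluing along edges: edge `j` of the blue tile `α` is glued to the same edge of the gray
tile `σ j α`. The gluing map is the unique Euclidean isometry between the two edges that respects
their orientation; both being copies of `P.edge j`, it is the identity of `P.edge j`. -/
def GlueRel (P : EuclideanPolygon q) (σ : ZMod q → Equiv.Perm (Fin n)) (x y : P.TileUnion n) :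
    Prop :=
  ∃ (α : Fin n) (j : ZMod q), x.1.1 = Sum.inl α ∧ y.1.1 = Sum.inr (σ j α) ∧
    x.1.2 = y.1.2 ∧ x.1.2 ∈ P.edge j

/-- The surface `M` obtained by gluing the `2n` closed tiles, with the quotient topology. -/
def GluedSurface (P : EuclideanPolygon q) (σ : ZMod q → Equiv.Perm (Fin n)) : Type :=
  Quot (P.GlueRel σ)

instance (P : EuclideanPolygon q) (σ : ZMod q → Equiv.Perm (Fin n)) :
    TopologicalSpace (P.GluedSurface σ) :=
  inferInstanceAs (TopologicalSpace (Quot (P.GlueRel σ)))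

/-- The point of `M` given by the point `w` of the closed tile `τ`. -/
def point (P : EuclideanPolygon q) (σ : ZMod q → Equiv.Perm (Fin n)) (τ : Fin n ⊕ Fin n)
    (w : OnePoint ℂ) (hw : w ∈ closure (P.openTile τ)) : P.GluedSurface σ :=
  Quot.mk _ ⟨(τ, w), hw⟩

/-- The open tile `τ`, as a subset of `M`. -/
def tile (P : EuclideanPolygon q) (σ : ZMod q → Equiv.Perm (Fin n)) (τ : Fin n ⊕ Fin n) :
    Set (P.GluedSurface σ) :=
  {z | ∃ (w : OnePoint ℂ) (hw : w ∈ P.openTile τ), P.point σ τ w (subset_closure hw) = z}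

theorem mem_closure_compl {P : EuclideanPolygon q} {w : OnePoint ℂ} (hw : w ∉ closure P.region)
    (β : Fin n) : w ∈ closure (P.openTile (Sum.inr β)) :=
  subset_closure hw

open Classical in
/-- The closed blue tile `α` together with the open gray tile `σ j α`, as a map from the sphere to
`M`. It is injective, and continuous at the interior points of edge `j`. -/
def sheet (P : EuclideanPolygon q) (σ : ZMod q → Equiv.Perm (Fin n)) (α : Fin n) (j : ZMod q)
    (w : OnePoint ℂ) : P.GluedSurface σ :=
  if h : w ∈ closure P.region then P.point σ (Sum.inl α) w h
  else P.point σ (Sum.inr (σ j α)) w (mem_closure_compl h _)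

/-- The union of the two open tiles and the interior of edge `j`. -/
def sheetDomain (P : EuclideanPolygon q) (j : ZMod q) : Set (OnePoint ℂ) :=
  (frontier P.region)ᶜ ∪ (P.edge j \ {P.vertex j, P.vertex (j + 1)})

/-- The complex structure on `M` is the one induced by the flat tiles: each open tile, and each
pair of tiles glued along the interior of an edge, is holomorphically embedded in `M`. -/
def IsFlatStructure (P : EuclideanPolygon q) (σ : ZMod q → Equiv.Perm (Fin n))
    [ChartedSpace ℂ (P.GluedSurface σ)] : Prop :=
  ∀ α j, MDifferentiableOn 𝓘(ℂ) 𝓘(ℂ) (P.sheet σ α j) (P.sheetDomain j)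

/-- Vertex `j` of the closed tile `τ` is glued to the point `z` of `M`. -/
def IsCorner (P : EuclideanPolygon q) (σ : ZMod q → Equiv.Perm (Fin n)) (z : P.GluedSurface σ)
    (τ : Fin n ⊕ Fin n) (j : ZMod q) : Prop :=
  ∃ h : P.vertex j ∈ closure (P.openTile τ), P.point σ τ (P.vertex j) h = z

/-- The vertices of `M`. -/
def vertexSet (P : EuclideanPolygon q) (σ : ZMod q → Equiv.Perm (Fin n)) :
    Set (P.GluedSurface σ) :=
  {z | ∃ τ j, P.IsCorner σ z τ j}

open Classical in
/-- `M` has cone angle `θ` at the vertex `z`: the total angle of the corners of tiles that are glued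
together at `z` is `θ`. Angles are measured by the angular size of small circles. -/
def HasConeAngle [NeZero q] (P : EuclideanPolygon q) (σ : ZMod q → Equiv.Perm (Fin n))
    (z : P.GluedSurface σ) (θ : ℝ) : Prop :=
  Tendsto (fun r : ℝ => ∑ τ : Fin n ⊕ Fin n, ∑ j : ZMod q,
      if P.IsCorner σ z τ j then angularSize (P.openTile τ) (P.vertex j) r else 0)
    (𝓝[>] 0) (𝓝 θ)

end EuclideanPolygon

end

noncomputable section

open RiemannSphere

namespace RiemannSphere

/-! ## Centred coordinates on the sphere -/

/-! The map `develop` sends a point of a closed tile to the same point of the sphere. Since edges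
are glued by the identity, it is well defined on M, and it is the only map that is the identity on
all closed tiles. So R is `develop`, uniqueness is immediate, and the work is to make M a Riemann
surface on which `develop` is holomorphic with the right multiplicities.

Topology. Away from the vertices, a point of an edge lies in exactly two glued closed tiles, one of
each color. Over the complement of the vertices and of all edges but edge j, `develop` is therefore
a trivial covering with n sheets (`sheetHomeomorph`), and so it is a covering off the vertices
(`isCoveringMapOn_develop`). M is a closed quotient of a compact Hausdorff space
(`isClosedMap_glue`).

Complex structure. Let z lie over a boundary point p. The tiles at z are connected near p because
they are Jordan domains, and they are linked to each other by the chain of gluings that produced z;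
hence a small punctured neighbourhood of z is connected (`eventually_star_subset_of_clopen`). It is
thus a connected finite covering of a punctured disc. Lifting the exponential map to it shows that
`develop` is ζ ↦ ζ ^ m in a suitable chart (`exists_isRootChart`). A continuous injective function
with a holomorphic m-th power is holomorphic (`differentiableOn_of_pow`), so these charts form a
complex atlas and the sheets are holomorphic for it.

For an arbitrary flat structure, `develop` is a local inverse of a holomorphic sheet off the
vertices, and the finitely many points over vertices are removable singularities. At a boundary
point, counting the preimages of a nearby point of the region in two ways shows that the
multiplicity is the number of blue tiles there (`IsFlatStructure.multiplicityAt_eq_ncard`). This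
gives the degree n. It also gives the cone angle: each blue tile at a vertex is paired with a gray
one across an edge, and their angles add up to 2π because circles meet the boundary in finitely many
points. The statements about the vector field follow from a local formula for the pullback. -/

theorem infChart_target : infChart.target = univ := by
  simp [infChart, finChart_target]

theorem chartAt_coe (w : ℂ) : chartAt ℂ (w : OnePoint ℂ) = finChart := rfl

theorem chartAt_infty : chartAt ℂ (OnePoint.infty : OnePoint ℂ) = infChart := rfl

theorem chartAt_target (p : OnePoint ℂ) : (chartAt ℂ p).target = univ := by
  induction p using OnePoint.rec with
  | infty => exact infChart_target
  | coe w => exact finChart_target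

/-- The inverse of the preferred chart at `p`, centred at `p`. -/
def localParam (p : OnePoint ℂ) (ζ : ℂ) : OnePoint ℂ := (chartAt ℂ p).symm (chartAt ℂ p p + ζ)

/-- The preferred chart at `p`, centred at `p`. -/
def localCoord (p x : OnePoint ℂ) : ℂ := chartAt ℂ p x - chartAt ℂ p p

theorem localParam_coe (w ζ : ℂ) : localParam w ζ = ((w + ζ : ℂ) : OnePoint ℂ) := by
  rw [localParam, chartAt_coe, finChart_coe, finChart_symm_apply]

theorem localParam_infty (ζ : ℂ) : localParam OnePoint.infty ζ = invMap ζ := by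
  rw [localParam, chartAt_infty, infChart_apply, invMap_infty, finChart_coe, zero_add,
    infChart_symm_apply]

theorem localParam_zero (p : OnePoint ℂ) : localParam p 0 = p := by
  rw [localParam, add_zero, OpenPartialHomeomorph.left_inv _ (mem_chart_source ℂ p)]

theorem circlePoint_eq (p : OnePoint ℂ) (r φ : ℝ) :
    circlePoint p r φ = localParam p (r * Complex.exp (φ * Complex.I)) := by
  induction p using OnePoint.rec with
  | infty => rw [localParam_infty]; rfl
  | coe w => rw [localParam_coe]; rfl

theorem localCoord_localParam (p : OnePoint ℂ) (ζ : ℂ) : localCoord p (localParam p ζ) = ζ := by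
  rw [localCoord, localParam, OpenPartialHomeomorph.right_inv _ (by simp [chartAt_target])]
  ring

theorem localCoord_self (p : OnePoint ℂ) : localCoord p p = 0 := sub_self _

theorem localParam_localCoord {p x : OnePoint ℂ} (hx : x ∈ (chartAt ℂ p).source) :
    localParam p (localCoord p x) = x := by
  rw [localCoord, localParam, add_sub_cancel, OpenPartialHomeomorph.left_inv _ hx]

theorem localParam_mem_source (p : OnePoint ℂ) (ζ : ℂ) : localParam p ζ ∈ (chartAt ℂ p).source :=
  OpenPartialHomeomorph.map_target _ (by simp [chartAt_target])

theorem localParam_injective (p : OnePoint ℂ) : Function.Injective (localParam p) :=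
  Function.LeftInverse.injective (localCoord_localParam p)

theorem mdifferentiable_localParam (p : OnePoint ℂ) :
    MDifferentiable 𝓘(ℂ) 𝓘(ℂ) (localParam p) := by
  intro ζ
  have h1 : MDifferentiableAt 𝓘(ℂ) 𝓘(ℂ) (fun ζ : ℂ => chartAt ℂ p p + ζ) ζ :=
    (differentiableAt_id.const_add _).mdifferentiableAt
  exact (mdifferentiableAt_atlas_symm (chart_mem_atlas ℂ p)
    (by simp [chartAt_target])).comp ζ h1

theorem continuous_localParam (p : OnePoint ℂ) : Continuous (localParam p) :=
  (mdifferentiable_localParam p).continuous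

theorem mdifferentiableAt_localCoord {p x : OnePoint ℂ} (hx : x ∈ (chartAt ℂ p).source) :
    MDifferentiableAt 𝓘(ℂ) 𝓘(ℂ) (localCoord p) x := by
  have h1 : MDifferentiableAt 𝓘(ℂ) 𝓘(ℂ) (fun ζ : ℂ => ζ - chartAt ℂ p p) (chartAt ℂ p x) :=
    (differentiableAt_id.sub_const _).mdifferentiableAt
  exact h1.comp x (mdifferentiableAt_atlas (chart_mem_atlas ℂ p) hx)

theorem isOpenEmbedding_localParam (p : OnePoint ℂ) : IsOpenEmbedding (localParam p) := by
  refine .of_continuous_injective_isOpenMap (continuous_localParam p) (localParam_injective p) ?_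
  intro s hs
  have h : localParam p '' s = (chartAt ℂ p).source ∩ localCoord p ⁻¹' s := by
    ext x
    constructor
    · rintro ⟨ζ, hζ, rfl⟩
      exact ⟨localParam_mem_source p ζ, by rwa [mem_preimage, localCoord_localParam]⟩
    · rintro ⟨hx, hx'⟩
      exact ⟨_, hx', localParam_localCoord hx⟩
  rw [h]
  refine ContinuousOn.isOpen_inter_preimage ?_ (chartAt ℂ p).open_source hs
  exact fun x hx => (mdifferentiableAt_localCoord hx).continuousAt.continuousWithinAt

end RiemannSphere

/-! ## Complex analysis in one variable -/

/-- A continuous injective root of a holomorphic function is holomorphic. -/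
theorem differentiableOn_of_pow {Ω : Set ℂ} (hΩ : IsOpen Ω) {τ : ℂ → ℂ} (hc : ContinuousOn τ Ω)
    (hi : InjOn τ Ω) {m : ℕ} (hm : m ≠ 0) (hd : DifferentiableOn ℂ (fun ζ => τ ζ ^ m) Ω) :
    DifferentiableOn ℂ τ Ω := by
  -- Off the zeros of τ the power map is locally invertible, and continuity keeps τ on the branch of
  -- the root chosen at ζ.
  have key : ∀ ζ ∈ Ω, τ ζ ≠ 0 → DifferentiableAt ℂ τ ζ := by
    intro ζ hζ h0
    have h1 : HasStrictDerivAt (fun x : ℂ => x ^ m) (m * τ ζ ^ (m - 1)) (τ ζ) :=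
      hasStrictDerivAt_pow m (τ ζ)
    have h2 : (m * τ ζ ^ (m - 1) : ℂ) ≠ 0 :=
      mul_ne_zero (Nat.cast_ne_zero.2 hm) (pow_ne_zero _ h0)
    have hct : ContinuousAt τ ζ := hc.continuousAt (hΩ.mem_nhds hζ)
    have h3 := (h1.hasStrictFDerivAt_equiv h2).eventually_left_inverse
    have h4 := hct.eventually h3
    have h5 := (h1.to_localInverse h2).hasDerivAt.differentiableAt
    have h6 : DifferentiableAt ℂ (fun x => h1.localInverse _ _ _ h2 (τ x ^ m)) ζ :=
      h5.comp ζ (hd.differentiableAt (hΩ.mem_nhds hζ))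
    refine h6.congr_of_eventuallyEq ?_
    filter_upwards [h4] with x hx
    exact hx.symm
  intro ζ hζ
  by_cases h0 : τ ζ = 0
  -- By injectivity ζ is the only zero of τ in Ω, so it is a removable singularity.
  · refine ((Complex.differentiableOn_compl_singleton_and_continuousAt_iff (hΩ.mem_nhds hζ)).1
      ⟨?_, hc.continuousAt (hΩ.mem_nhds hζ)⟩) ζ hζ
    intro x hx
    refine (key x hx.1 fun hx0 => hx.2 ?_).differentiableWithinAt
    exact hi hx.1 hζ (hx0.trans h0.symm)
  · exact (key ζ hζ h0).differentiableWithinAt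

/-- A continuous right inverse of a holomorphic function is holomorphic. -/
theorem differentiableAt_of_rightInverse {f g : ℂ → ℂ} {w₀ : ℂ} (hf : AnalyticAt ℂ f (g w₀))
    (hg : ∀ᶠ w in 𝓝 w₀, ContinuousAt g w) (hfg : ∀ᶠ w in 𝓝 w₀, f (g w) = w) :
    DifferentiableAt ℂ g w₀ := by
  have hg0 : Tendsto g (𝓝 w₀) (𝓝 (g w₀)) := hg.self_of_nhds
  have hinj : ∀ᶠ w in 𝓝[≠] w₀, g w ≠ g w₀ := by
    filter_upwards [self_mem_nhdsWithin, nhdsWithin_le_nhds hfg] with w hw h1 h2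
    rw [h2, hfg.self_of_nhds] at h1
    exact hw h1.symm
  have hgp : Tendsto g (𝓝[≠] w₀) (𝓝[≠] (g w₀)) :=
    tendsto_nhdsWithin_iff.2 ⟨hg0.mono_left nhdsWithin_le_nhds, hinj⟩
  refine (Complex.analyticAt_of_differentiable_on_punctured_nhds_of_continuousAt ?_
    hg.self_of_nhds).differentiableAt
  -- If f' vanished near g w₀, then f would be locally constant, against f (g w) = w. Otherwise the
  -- zeros of f' are isolated; g is injective near w₀, so it avoids them on a punctured
  -- neighbourhood, is differentiable there, and extends by continuity.
  rcases hf.deriv.eventually_eq_zero_or_eventually_ne_zero with h | h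
  · exfalso
    have h1 : ∀ᶠ z in 𝓝 (g w₀), f z = f (g w₀) := by
      obtain ⟨ε, hε, hball⟩ := Metric.eventually_nhds_iff_ball.1
        (h.and hf.eventually_analyticAt)
      filter_upwards [Metric.ball_mem_nhds _ hε] with z hz
      refine (convex_ball (g w₀) ε).is_const_of_fderivWithin_eq_zero (𝕜 := ℂ)
        (fun x hx => (hball x hx).2.differentiableAt.differentiableWithinAt) (fun x hx => ?_) hz
        (Metric.mem_ball_self hε)
      rw [fderivWithin_of_isOpen Metric.isOpen_ball hx]
      ext
      simpa using (hball x hx).1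
    have h2 : ∀ᶠ w in 𝓝 w₀, w = w₀ := by
      filter_upwards [hg0.eventually h1, hfg] with w h3 h4
      rw [← h4, h3, hfg.self_of_nhds]
    have h3 : ∀ᶠ w in 𝓝[≠] w₀, False := by
      filter_upwards [nhdsWithin_le_nhds h2, self_mem_nhdsWithin] with w h4 h5 using h5 h4
    exact (h3.exists).elim fun _ => id
  · filter_upwards [hgp.eventually h, nhdsWithin_le_nhds hg,
      nhdsWithin_le_nhds (hfg.eventually_nhds),
      nhdsWithin_le_nhds (hg0.eventually hf.eventually_analyticAt)] with w h1 h2 h3 h4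
    exact (HasDerivAt.of_local_left_inverse h2 h4.differentiableAt.hasDerivAt h1
      h3).differentiableAt

/-- A holomorphic function with a zero of order `m` takes each small nonzero value exactly `m`
times near the zero. -/
theorem AnalyticAt.exists_ncard_fiber_eq {f : ℂ → ℂ} {z₀ : ℂ} (hf : AnalyticAt ℂ f z₀) {m : ℕ}
    (hm : m ≠ 0) (ho : analyticOrderAt f z₀ = m) {O : Set ℂ} (hO : O ∈ 𝓝 z₀) :
    ∃ O' ∈ 𝓝 z₀, O' ⊆ O ∧ ∀ᶠ η in 𝓝[≠] (0 : ℂ), {ζ ∈ O' | f ζ = η}.ncard = m := by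
  obtain ⟨g, hg, hg0, hfg⟩ := (hf.analyticOrderAt_eq_natCast).1 ho
  obtain ⟨c, hc⟩ : ∃ c : ℂ, c ^ m = g z₀ := IsAlgClosed.exists_pow_nat_eq _ (Nat.pos_of_ne_zero hm)
  have hc0 : c ≠ 0 := by
    rintro rfl
    rw [zero_pow hm] at hc
    exact hg0 hc.symm
  -- A local m-th root of f = (z - z₀) ^ m * g. Dividing by g z₀ moves the base point to 1, where
  -- the principal root is analytic; the constant c puts the factor back.
  let φ : ℂ → ℂ := fun z => (z - z₀) * (c * (g z / g z₀) ^ (1 / m : ℂ))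
  have hk : AnalyticAt ℂ (fun z => c * (g z / g z₀) ^ (1 / m : ℂ)) z₀ := by
    refine analyticAt_const.mul (AnalyticAt.cpow (hg.div analyticAt_const hg0) analyticAt_const ?_)
    rw [div_self hg0]
    exact Complex.one_mem_slitPlane
  have hφ : AnalyticAt ℂ φ z₀ := (analyticAt_id.sub analyticAt_const).mul hk
  have hφ0 : φ z₀ = 0 := by simp [φ]
  have hφd : HasDerivAt φ c z₀ := by
    have h1 := ((hasDerivAt_id z₀).sub_const z₀).mul hk.differentiableAt.hasDerivAt
    simp only [id, sub_self, zero_mul, add_zero, one_mul, div_self hg0, Complex.one_cpow,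
      mul_one] at h1
    exact h1
  have hφs : HasStrictDerivAt φ c z₀ := by
    have := hφ.hasStrictDerivAt
    rwa [hφd.deriv] at this
  have hpow : ∀ᶠ z in 𝓝 z₀, f z = φ z ^ m := by
    filter_upwards [hfg] with z hz
    rw [hz, smul_eq_mul, mul_pow, mul_pow, hc, one_div, Complex.cpow_nat_inv_pow _ hm,
      mul_div_cancel₀ _ hg0]
  let E := (hφs.hasStrictFDerivAt_equiv hc0).toOpenPartialHomeomorph φ
  have hE : (E : ℂ → ℂ) = φ := rfl
  have hzE : z₀ ∈ E.source := (hφs.hasStrictFDerivAt_equiv hc0).mem_toOpenPartialHomeomorph_source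
  have hsub : E.source ∩ (O ∩ {z | f z = φ z ^ m}) ∈ 𝓝 z₀ :=
    inter_mem (E.open_source.mem_nhds hzE) (inter_mem hO hpow)
  have h0t : (0 : ℂ) ∈ E.target := by
    have := E.map_source hzE
    rwa [hE, hφ0] at this
  have hs0 : E.symm 0 = z₀ := by
    have := E.left_inv hzE
    rwa [hE, hφ0] at this
  have hct : ContinuousAt E.symm 0 := E.continuousAt_symm h0t
  have h1 : ∀ᶠ y in 𝓝 (0 : ℂ), y ∈ E.target ∧ E.symm y ∈ E.source ∩ (O ∩ {z | f z = φ z ^ m}) := by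
    refine Filter.Eventually.and (E.open_target.mem_nhds h0t) (hct.eventually ?_)
    rw [hs0]
    exact hsub
  obtain ⟨ε, hε, hball⟩ := Metric.eventually_nhds_iff_ball.1 h1
  refine ⟨E.source ∩ φ ⁻¹' Metric.ball 0 ε, ?_, ?_, ?_⟩
  · refine inter_mem (E.open_source.mem_nhds hzE) (hφ.continuousAt ?_)
    rw [hφ0]
    exact Metric.ball_mem_nhds _ hε
  · rintro z ⟨hz, hz'⟩
    have := (hball _ hz').2.2.1
    rwa [← hE, E.left_inv hz] at this
  · have h2 : ∀ᶠ η in 𝓝[≠] (0 : ℂ), ‖η‖ < ε ^ m := by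
      refine nhdsWithin_le_nhds ?_
      filter_upwards [Metric.ball_mem_nhds (0 : ℂ) (pow_pos hε m)] with η hη
      simpa using hη
    filter_upwards [h2, self_mem_nhdsWithin] with η hη hη0
    have hη0 : η ≠ 0 := hη0
    have h3 : {ζ ∈ E.source ∩ φ ⁻¹' Metric.ball 0 ε | f ζ = η} =
        E.symm '' (Polynomial.nthRootsFinset m η : Set ℂ) := by
      ext ζ
      simp only [mem_ofPred_eq, mem_image, Finset.mem_coe,
        Polynomial.mem_nthRootsFinset (Nat.pos_of_ne_zero hm)]
      constructor
      · rintro ⟨⟨hζ, hζ'⟩, rfl⟩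
        refine ⟨φ ζ, ?_, E.left_inv hζ⟩
        have := (hball _ hζ').2.2.2
        rw [← hE, E.left_inv hζ] at this
        exact this.symm
      · rintro ⟨y, hy, rfl⟩
        have hyb : y ∈ Metric.ball (0 : ℂ) ε := by
          rw [mem_ball_zero_iff]
          refine lt_of_pow_lt_pow_left₀ m hε.le ?_
          rw [← norm_pow, hy]
          exact hη
        have h4 := hball y hyb
        have h5 : φ (E.symm y) = y := E.right_inv h4.1
        refine ⟨⟨h4.2.1, ?_⟩, ?_⟩
        · rw [mem_preimage, h5]; exact hyb
        · have h6 : f (E.symm y) = φ (E.symm y) ^ m := h4.2.2.2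
          rw [h6, h5, hy]
    have hprim := Complex.isPrimitiveRoot_exp m hm
    have hnd := hprim.nthRoots_nodup hη0
    rw [h3, InjOn.ncard_image, ncard_coe_finset, Polynomial.nthRootsFinset,
      Multiset.toFinset_card_of_nodup hnd, hprim.card_nthRoots,
      if_pos (IsAlgClosed.exists_pow_nat_eq η (Nat.pos_of_ne_zero hm))]
    intro y hy y' hy' hyy
    have hmem : ∀ y ∈ (Polynomial.nthRootsFinset m η : Set ℂ), y ∈ E.target := by
      intro y hy
      rw [Finset.mem_coe, Polynomial.mem_nthRootsFinset (Nat.pos_of_ne_zero hm)] at hy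
      refine (hball y ?_).1
      rw [mem_ball_zero_iff]
      refine lt_of_pow_lt_pow_left₀ m hε.le ?_
      rwa [← norm_pow, hy]
    exact E.symm.injOn (hmem y hy) (hmem y' hy') hyy

/-! ## Euclidean segments -/

namespace RiemannSphere

/-- The affine map `w ↦ c + d w` of the sphere. -/
def affineMap (c : ℂ) {d : ℂ} (hd : d ≠ 0) : OnePoint ℂ ≃ₜ OnePoint ℂ :=
  ((Homeomorph.mulLeft₀ d hd).trans (Homeomorph.addLeft c)).onePointCongr

theorem affineMap_infty (c : ℂ) {d : ℂ} (hd : d ≠ 0) :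
    affineMap c hd OnePoint.infty = OnePoint.infty := rfl

theorem affineMap_coe (c : ℂ) {d : ℂ} (hd : d ≠ 0) (w : ℂ) :
    affineMap c hd (w : OnePoint ℂ) = ((c + d * w : ℂ) : OnePoint ℂ) := rfl

/-- The path `s ↦ c + d / (α + β s)` in the sphere. -/
theorem exists_path_inv (c : ℂ) {d : ℂ} (hd : d ≠ 0) (α : ℝ) {β : ℝ} (hβ : β ≠ 0) :
    ∃ f : unitInterval → OnePoint ℂ, Continuous f ∧ Function.Injective f ∧
      (∀ s : unitInterval, α + β * s = 0 → f s = OnePoint.infty) ∧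
      (∀ s : unitInterval, α + β * s ≠ 0 →
        f s = ((c + d * ((α + β * s : ℝ) : ℂ)⁻¹ : ℂ) : OnePoint ℂ)) := by
  refine ⟨fun s => affineMap c hd (invMap (((α + β * s : ℝ) : ℂ) : OnePoint ℂ)), ?_, ?_, ?_, ?_⟩
  · refine (affineMap c hd).continuous.comp (continuous_invMap.comp
      (OnePoint.continuous_coe.comp ?_))
    fun_prop
  · intro s s' h
    have h1 := OnePoint.coe_injective (Function.LeftInverse.injective invMap_invMap
      ((affineMap c hd).injective h))
    have h2 : α + β * s = α + β * s' := by exact_mod_cast h1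
    exact Subtype.ext (mul_left_cancel₀ hβ (add_left_cancel h2))
  · intro s hs
    simp only [hs, Complex.ofReal_zero, invMap_zero, affineMap_infty]
  · intro s hs
    have : ((α + β * s : ℝ) : ℂ) ≠ 0 := Complex.ofReal_ne_zero.2 hs
    simp only [invMap_coe this, affineMap_coe]

end RiemannSphere

/-- Bounded segments are parametrized affinely; an edge containing ∞ is the image of the unit
interval under a Möbius map s ↦ c + d / (α + β s), which is continuous into the sphere even at its
pole. -/
theorem IsEuclideanSegment.exists_path {a b : OnePoint ℂ} {u : ℂ} {E : Set (OnePoint ℂ)}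
    (h : IsEuclideanSegment a b u E) : ∃ f : unitInterval → OnePoint ℂ, Continuous f ∧
      Function.Injective f ∧ range f = E ∧ f 0 = a ∧ f 1 = b := by
  rcases h with ⟨x, y, hxy, rfl, rfl, -, rfl⟩ | ⟨x, y, hxy, rfl, rfl, -, rfl⟩ |
    ⟨x, rfl, rfl, hu, rfl⟩ | ⟨y, rfl, rfl, hu, rfl⟩
  · refine ⟨fun s => ((x + (s : ℝ) • (y - x) : ℂ) : OnePoint ℂ), ?_, ?_, ?_, ?_, ?_⟩
    · refine OnePoint.continuous_coe.comp ?_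
      fun_prop
    · intro s s' h
      have h1 := OnePoint.coe_injective h
      exact Subtype.ext (smul_left_injective ℝ (sub_ne_zero.2 hxy.symm) (add_left_cancel h1))
    · rw [segment_eq_image']
      ext p
      simp only [mem_range, mem_image, exists_exists_and_eq_and]
      constructor
      · rintro ⟨s, rfl⟩
        exact ⟨s, s.2, rfl⟩
      · rintro ⟨s, hs, rfl⟩
        exact ⟨⟨s, hs⟩, rfl⟩
    · simp
    · simp
  · have hd : y - x ≠ 0 := sub_ne_zero.2 hxy.symm
    -- The pole is put at s = 1/2, and 1 / (4 s - 2) equals -1/2 at s = 0 and 1/2 at s = 1, which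
    -- from the midpoint gives x and y.
    obtain ⟨f, hf, hfi, h0, h1⟩ := exists_path_inv ((x + y) / 2) hd (-2) (β := 4) (by norm_num)
    refine ⟨f, hf, hfi, ?_, ?_, ?_⟩
    · ext p
      simp only [mem_range, mem_insert_iff, mem_image, mem_ofPred_eq]
      constructor
      · rintro ⟨s, rfl⟩
        by_cases hs : (-2 : ℝ) + 4 * s = 0
        · exact Or.inl (h0 s hs)
        · refine Or.inr ⟨_, ⟨1 / 2 + (-2 + 4 * (s : ℝ))⁻¹, ?_, ?_⟩, (h1 s hs).symm⟩
          · rcases lt_or_gt_of_ne hs with hs' | hs'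
            · left
              have : (-2 + 4 * (s : ℝ))⁻¹ ≤ -(1 / 2) := by
                rw [inv_le_of_neg hs' (by norm_num)]
                have := s.2.1
                norm_num
                linarith
              linarith
            · right
              have : 1 / 2 ≤ (-2 + 4 * (s : ℝ))⁻¹ := by
                rw [le_inv_comm₀ (by norm_num) hs']
                have := s.2.2
                norm_num
                linarith
              linarith
          · push_cast
            ring
      · rintro (rfl | ⟨w, ⟨t, ht, rfl⟩, rfl⟩)
        · exact ⟨⟨1 / 2, by norm_num, by norm_num⟩, h0 _ (by norm_num)⟩
        · have ht' : t - 1 / 2 ≠ 0 := by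
            intro h
            rcases ht with ht | ht <;> linarith
          refine ⟨⟨1 / 2 + (t - 1 / 2)⁻¹ / 4, ?_⟩, ?_⟩
          · rcases ht with ht | ht
            · have h2 : t - 1 / 2 < 0 := by linarith
              have h3 : -2 ≤ (t - 1 / 2)⁻¹ := by
                rw [le_inv_of_neg (by norm_num) h2]
                norm_num
                linarith
              have h4 := inv_neg''.2 h2
              constructor <;> linarith
            · have h2 : 0 < t - 1 / 2 := by linarith
              have h3 : (t - 1 / 2)⁻¹ ≤ 2 := by
                rw [inv_le_comm₀ h2 (by norm_num)]
                norm_num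
                linarith
              have h4 := inv_pos.2 h2
              constructor <;> linarith
          · have h2 : (-2 : ℝ) + 4 * (1 / 2 + (t - 1 / 2)⁻¹ / 4) = (t - 1 / 2)⁻¹ := by ring
            rw [h1 _ (by simp only [h2]; exact inv_ne_zero ht')]
            simp only [h2]
            push_cast
            rw [inv_inv]
            congr 1
            ring
    · rw [h1 _ (by norm_num)]
      push_cast
      congr 1
      norm_num
      ring
    · rw [h1 _ (by norm_num)]
      push_cast
      congr 1
      norm_num
      ring
  -- The path is x - u + u / (1 - s): it starts at x and has its pole at s = 1. The half-line ending
  -- at y uses the reversed form y + u - u / s.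
  · obtain ⟨f, hf, hfi, h0, h1⟩ := exists_path_inv (x - u) hu 1 (β := -1) (by norm_num)
    refine ⟨f, hf, hfi, ?_, ?_, h0 _ (by norm_num)⟩
    · ext p
      simp only [mem_range, mem_insert_iff, mem_image, mem_ofPred_eq]
      constructor
      · rintro ⟨s, rfl⟩
        by_cases hs : (1 : ℝ) + -1 * s = 0
        · exact Or.inl (h0 s hs)
        · refine Or.inr ⟨_, ⟨(1 + -1 * (s : ℝ))⁻¹ - 1, ?_, ?_⟩, (h1 s hs).symm⟩
          · have h2 : 0 < 1 + -1 * (s : ℝ) := lt_of_le_of_ne (by linarith [s.2.2]) (Ne.symm hs)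
            have := (one_le_inv₀ h2).2 (by linarith [s.2.1])
            linarith
          · push_cast
            ring
      · rintro (rfl | ⟨w, ⟨t, ht, rfl⟩, rfl⟩)
        · exact ⟨1, h0 _ (by norm_num)⟩
        · have h2 : 0 < t + 1 := by linarith
          have h3 := inv_pos.2 h2
          have h4 : (t + 1)⁻¹ ≤ 1 := inv_le_one_of_one_le₀ (by linarith)
          have h5 : (1 : ℝ) + -1 * (1 - (t + 1)⁻¹) = (t + 1)⁻¹ := by ring
          refine ⟨⟨1 - (t + 1)⁻¹, by linarith, by linarith⟩, ?_⟩
          rw [h1 _ (by simp only [h5]; exact h3.ne')]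
          simp only [h5]
          push_cast
          rw [inv_inv]
          congr 1
          ring
    · rw [h1 _ (by norm_num)]
      push_cast
      congr 1
      norm_num
  · obtain ⟨f, hf, hfi, h0, h1⟩ := exists_path_inv (y + u) (neg_ne_zero.2 hu) 0 (β := 1)
      (by norm_num)
    refine ⟨f, hf, hfi, ?_, h0 _ (by norm_num), ?_⟩
    · ext p
      simp only [mem_range, mem_insert_iff, mem_image, mem_ofPred_eq]
      constructor
      · rintro ⟨s, rfl⟩
        by_cases hs : (0 : ℝ) + 1 * s = 0
        · exact Or.inl (h0 s hs)
        · refine Or.inr ⟨_, ⟨(0 + 1 * (s : ℝ))⁻¹ - 1, ?_, ?_⟩, (h1 s hs).symm⟩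
          · have h2 : 0 < 0 + 1 * (s : ℝ) := lt_of_le_of_ne (by linarith [s.2.1]) (Ne.symm hs)
            have := (one_le_inv₀ h2).2 (by linarith [s.2.2])
            linarith
          · push_cast
            ring
      · rintro (rfl | ⟨w, ⟨t, ht, rfl⟩, rfl⟩)
        · exact ⟨0, h0 _ (by norm_num)⟩
        · have h2 : 0 < t + 1 := by linarith
          have h3 := inv_pos.2 h2
          have h4 : (t + 1)⁻¹ ≤ 1 := inv_le_one_of_one_le₀ (by linarith)
          have h5 : (0 : ℝ) + 1 * (t + 1)⁻¹ = (t + 1)⁻¹ := by ring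
          refine ⟨⟨(t + 1)⁻¹, by linarith, by linarith⟩, ?_⟩
          rw [h1 _ (by simp only [h5]; exact h3.ne')]
          simp only [h5]
          push_cast
          rw [inv_inv]
          congr 1
          ring
    · rw [h1 _ (by norm_num)]
      push_cast
      congr 1
      norm_num

/-- All that finiteness of intersections with circles needs: the finite points of an edge are
collinear. -/
theorem IsEuclideanSegment.subset_line {a b : OnePoint ℂ} {u : ℂ} {E : Set (OnePoint ℂ)}
    (h : IsEuclideanSegment a b u E) : ∃ x d : ℂ, d ≠ 0 ∧
      ∀ w : ℂ, (w : OnePoint ℂ) ∈ E → ∃ t : ℝ, w = x + t * d := by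
  rcases h with ⟨x, y, hxy, -, -, -, rfl⟩ | ⟨x, y, hxy, -, -, -, rfl⟩ |
    ⟨x, -, -, hu, rfl⟩ | ⟨y, -, -, hu, rfl⟩
  · refine ⟨x, y - x, sub_ne_zero.2 hxy.symm, fun w hw => ?_⟩
    rw [segment_eq_image'] at hw
    obtain ⟨_, ⟨t, -, rfl⟩, h⟩ := hw
    exact ⟨t, (OnePoint.coe_injective h).symm⟩
  · refine ⟨x, y - x, sub_ne_zero.2 hxy.symm, fun w hw => ?_⟩
    rcases hw with h | ⟨_, ⟨t, -, rfl⟩, h⟩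
    · exact absurd h (OnePoint.coe_ne_infty w)
    · exact ⟨t, (OnePoint.coe_injective h).symm⟩
  · refine ⟨x, u, hu, fun w hw => ?_⟩
    rcases hw with h | ⟨_, ⟨t, -, rfl⟩, h⟩
    · exact absurd h (OnePoint.coe_ne_infty w)
    · exact ⟨t, (OnePoint.coe_injective h).symm⟩
  · refine ⟨y, -u, neg_ne_zero.2 hu, fun w hw => ?_⟩
    rcases hw with h | ⟨_, ⟨t, -, rfl⟩, h⟩
    · exact absurd h (OnePoint.coe_ne_infty w)
    · exact ⟨t, by rw [← OnePoint.coe_injective h]; ring⟩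

/-- A line meets a circle in finitely many points. -/
theorem finite_line_inter_circle (x : ℂ) {d : ℂ} (hd : d ≠ 0) (c : ℂ) (ρ : ℝ) :
    {w : ℂ | (∃ t : ℝ, w = x + t * d) ∧ ‖w - c‖ = ρ}.Finite := by
  have key : ∀ t : ℝ, ‖x + t * d - c‖ ^ 2 =
      ‖d‖ ^ 2 * t ^ 2 + 2 * ((x - c).re * d.re + (x - c).im * d.im) * t + ‖x - c‖ ^ 2 := by
    intro t
    simp only [← Complex.normSq_eq_norm_sq, Complex.normSq_apply, Complex.add_re, Complex.sub_re,
      Complex.mul_re, Complex.ofReal_re, Complex.ofReal_im, Complex.add_im, Complex.sub_im,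
      Complex.mul_im]
    ring
  have hd2 : ‖d‖ ^ 2 ≠ 0 := pow_ne_zero _ (norm_ne_zero_iff.2 hd)
  set B := 2 * ((x - c).re * d.re + (x - c).im * d.im) with hB
  have hfin : {t : ℝ | ‖x + t * d - c‖ = ρ}.Finite := by
    rcases eq_empty_or_nonempty {t : ℝ | ‖x + t * d - c‖ = ρ} with h | ⟨t₀, ht₀⟩
    · rw [h]; exact finite_empty
    -- The quadratic in `key` has leading coefficient ‖d‖ ^ 2 ≠ 0 and linear coefficient B; by Vieta
    -- the root other than t₀ is -B / ‖d‖ ^ 2 - t₀.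
    · refine (Set.toFinite {t₀, -B / ‖d‖ ^ 2 - t₀}).subset fun t ht => ?_
      have h1 := key t
      have h2 := key t₀
      rw [mem_ofPred_eq] at ht ht₀
      rw [ht] at h1
      rw [ht₀] at h2
      have h3 : (t - t₀) * (‖d‖ ^ 2 * (t + t₀) + B) = 0 := by linarith
      rcases mul_eq_zero.1 h3 with h | h
      · exact Or.inl (sub_eq_zero.1 h)
      · refine Or.inr ?_
        rw [mem_singleton_iff]
        field_simp
        linarith
  refine (hfin.image fun t : ℝ => x + t * d).subset ?_
  rintro _ ⟨⟨t, rfl⟩, ht⟩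
  exact ⟨t, ht, rfl⟩

/-! ### Circles and angular sizes. -/

namespace RiemannSphere

/-- A circle of radius r in the coordinate 1/w about ∞ is the Euclidean circle of radius 1/r about
0, so vertices at ∞ need no separate treatment. -/
theorem exists_circlePoint_eq_coe (p : OnePoint ℂ) {r : ℝ} (hr : 0 < r) : ∃ (c : ℂ) (ρ : ℝ),
    ∀ φ : ℝ, ∃ w : ℂ, circlePoint p r φ = w ∧ ‖w - c‖ = ρ := by
  induction p using OnePoint.rec with
  | infty =>
    refine ⟨0, r⁻¹, fun φ => ⟨(r * Complex.exp (φ * Complex.I))⁻¹, ?_, ?_⟩⟩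
    · exact invMap_coe (mul_ne_zero (Complex.ofReal_ne_zero.2 hr.ne') (Complex.exp_ne_zero _))
    · simp [Complex.norm_exp_ofReal_mul_I, abs_of_pos hr]
  | coe w =>
    refine ⟨w, r, fun φ => ⟨w + r * Complex.exp (φ * Complex.I), rfl, ?_⟩⟩
    simp [Complex.norm_exp_ofReal_mul_I, abs_of_pos hr]

theorem injOn_circlePoint (p : OnePoint ℂ) {r : ℝ} (hr : 0 < r) :
    InjOn (circlePoint p r) (Ioc (-Real.pi) Real.pi) := by
  intro φ hφ ψ hψ h
  rw [circlePoint_eq, circlePoint_eq] at h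
  have h1 := mul_left_cancel₀ (Complex.ofReal_ne_zero.2 hr.ne') (localParam_injective p h)
  have h2 := Complex.exp_inj_of_neg_pi_lt_of_le_pi (x := φ * Complex.I) (y := ψ * Complex.I)
    (by simpa using hφ.1) (by simpa using hφ.2) (by simpa using hψ.1) (by simpa using hψ.2) h1
  exact_mod_cast mul_right_cancel₀ Complex.I_ne_zero h2

theorem continuous_circlePoint (p : OnePoint ℂ) (r : ℝ) : Continuous (circlePoint p r) := by
  have : circlePoint p r = fun φ : ℝ => localParam p (r * Complex.exp (φ * Complex.I)) :=
    funext fun φ => circlePoint_eq p r φ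
  rw [this]
  exact (continuous_localParam p).comp (by fun_prop)

end RiemannSphere

theorem IsEuclideanSegment.finite_circlePoint {a b : OnePoint ℂ} {u : ℂ} {E : Set (OnePoint ℂ)}
    (h : IsEuclideanSegment a b u E) (p : OnePoint ℂ) {r : ℝ} (hr : 0 < r) :
    {φ : ℝ | φ ∈ Ioc (-Real.pi) Real.pi ∧ circlePoint p r φ ∈ E}.Finite := by
  obtain ⟨x, d, hd, hE⟩ := h.subset_line
  obtain ⟨c, ρ, hc⟩ := exists_circlePoint_eq_coe p hr
  refine Set.Finite.of_finite_image (f := circlePoint p r) ?_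
    ((injOn_circlePoint p hr).mono fun φ hφ => hφ.1)
  refine ((finite_line_inter_circle x hd c ρ).image ((↑) : ℂ → OnePoint ℂ)).subset ?_
  rintro _ ⟨φ, hφ, rfl⟩
  obtain ⟨w, hw, hw'⟩ := hc φ
  have h2 := hφ.2
  rw [hw] at h2 ⊢
  exact ⟨w, ⟨hE w h2, hw'⟩, rfl⟩

/-- If the circles about `p` meet the common boundary of two complementary regions in finitely many
points, then the angular sizes of the regions add up to `2π`. -/
theorem angularSize_add {U : Set (OnePoint ℂ)} (hU : IsOpen U) (p : OnePoint ℂ) {r : ℝ}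
    (hfin : {φ : ℝ | φ ∈ Ioc (-Real.pi) Real.pi ∧ circlePoint p r φ ∈ frontier U}.Finite) :
    angularSize U p r + angularSize (closure U)ᶜ p r = 2 * Real.pi := by
  have hc := continuous_circlePoint p r
  have hm : ∀ {V : Set (OnePoint ℂ)}, IsOpen V →
      MeasurableSet {φ : ℝ | φ ∈ Ioc (-Real.pi) Real.pi ∧ circlePoint p r φ ∈ V} := fun hV =>
    measurableSet_Ioc.inter (hV.preimage hc).measurableSet
  have hle : ∀ V : Set (OnePoint ℂ), MeasureTheory.volume
      {φ : ℝ | φ ∈ Ioc (-Real.pi) Real.pi ∧ circlePoint p r φ ∈ V} ≠ ⊤ := fun V =>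
    ((MeasureTheory.measure_mono fun φ hφ => hφ.1).trans_lt
      (measure_Ioc_lt_top (a := -Real.pi) (b := Real.pi))).ne
  rw [angularSize, angularSize, ← MeasureTheory.measureReal_union _ (hm isClosed_closure.isOpen_compl)
    (hle _) (hle _)]
  · have h1 : ({φ : ℝ | φ ∈ Ioc (-Real.pi) Real.pi ∧ circlePoint p r φ ∈ U} ∪
        {φ : ℝ | φ ∈ Ioc (-Real.pi) Real.pi ∧ circlePoint p r φ ∈ (closure U)ᶜ}) =
        Ioc (-Real.pi) Real.pi \
        {φ : ℝ | φ ∈ Ioc (-Real.pi) Real.pi ∧ circlePoint p r φ ∈ frontier U} := by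
      ext φ
      rw [hU.frontier_eq]
      simp only [mem_union, mem_ofPred_eq, Set.mem_sdiff, mem_compl_iff]
      have := @subset_closure _ _ U (circlePoint p r φ)
      tauto
    rw [h1, MeasureTheory.measureReal_def, MeasureTheory.measure_sdiff_null (hfin.measure_zero _),
      Real.volume_Ioc, ENNReal.toReal_ofReal (by linarith [Real.pi_pos])]
    ring
  · rw [Set.disjoint_left]
    rintro φ ⟨-, h1⟩ ⟨-, h2⟩
    exact h2 (subset_closure h1)

/-! ## Jordan domains -/

theorem IsJordanDomain.isPreconnected {X : Type*} [TopologicalSpace X] {U : Set X}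
    (h : IsJordanDomain U) : IsPreconnected U := by
  obtain ⟨-, e, he, -, rfl⟩ := h
  exact ((convex_ball (0 : ℂ) 1).isPreconnected).image e (he.mono Metric.ball_subset_closedBall)

theorem IsJordanDomain.closure_eq {X : Type*} [TopologicalSpace X] [T2Space X] {U : Set X} {e : ℂ → X}
    (he : ContinuousOn e (Metric.closedBall 0 1)) (hU : e '' Metric.ball 0 1 = U) :
    closure U = e '' Metric.closedBall 0 1 := by
  apply subset_antisymm
  · refine closure_minimal ?_ ((isCompact_closedBall 0 1).image_of_continuousOn he).isClosed
    rw [← hU]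
    exact image_mono Metric.ball_subset_closedBall
  · rw [← hU, ← closure_ball (0 : ℂ) one_ne_zero] at *
    exact he.image_closure

/-- A Jordan domain is connected near each point of its boundary. -/
theorem IsJordanDomain.exists_isPreconnected {X : Type*} [TopologicalSpace X] [T2Space X] {U : Set X}
    (h : IsJordanDomain U) {v : X} (hv : v ∈ closure U) {D : Set X} (hD : D ∈ 𝓝 v) :
    ∃ K ⊆ U ∩ D, IsPreconnected K ∧ ∃ D' ∈ 𝓝 v, U ∩ D' ⊆ K := by
  obtain ⟨-, e, he, hei, hU⟩ := h
  rw [IsJordanDomain.closure_eq he hU] at hv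
  obtain ⟨p, hp, rfl⟩ := hv
  obtain ⟨δ, hδ, hball⟩ := Metric.mem_nhdsWithin_iff.1 ((he p hp) hD)
  -- An intersection of two discs is convex, so its image is connected. The rest of the closed disc
  -- has compact image, which misses e p by injectivity, so the complement of that image is a
  -- neighbourhood.
  refine ⟨e '' (Metric.ball p δ ∩ Metric.ball 0 1), ?_, ?_,
    (e '' (Metric.closedBall 0 1 \ Metric.ball p δ))ᶜ, ?_, ?_⟩
  · rintro _ ⟨z, hz, rfl⟩
    exact ⟨hU ▸ mem_image_of_mem e hz.2, hball ⟨hz.1, Metric.ball_subset_closedBall hz.2⟩⟩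
  · refine (((convex_ball p δ).inter (convex_ball (0 : ℂ) 1)).isPreconnected).image e (he.mono ?_)
    exact inter_subset_right.trans Metric.ball_subset_closedBall
  · refine IsOpen.mem_nhds (IsCompact.isClosed ?_).isOpen_compl ?_
    · exact ((isCompact_closedBall 0 1).diff Metric.isOpen_ball).image_of_continuousOn
        (he.mono sdiff_subset)
    · rintro ⟨z, hz, hzp⟩
      exact hz.2 (hei hz.1 hp hzp ▸ Metric.mem_ball_self hδ)
  · rintro x ⟨hx, hx'⟩
    rw [← hU] at hx
    obtain ⟨z, hz, rfl⟩ := hx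
    refine ⟨z, ⟨?_, hz⟩, rfl⟩
    by_contra hzp
    exact hx' ⟨z, ⟨Metric.ball_subset_closedBall hz, hzp⟩, rfl⟩

/-! ## Euclidean polygons -/

namespace EuclideanPolygon

variable {q n : ℕ}

theorem isOpen_region (P : EuclideanPolygon q) : IsOpen P.region := P.jordan_region.1

theorem isOpen_openTile (P : EuclideanPolygon q) (τ : Fin n ⊕ Fin n) : IsOpen (P.openTile τ) := by
  cases τ with
  | inl => exact P.isOpen_region
  | inr => exact isClosed_closure.isOpen_compl

theorem isJordanDomain_openTile (P : EuclideanPolygon q) (τ : Fin n ⊕ Fin n) :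
    IsJordanDomain (P.openTile τ) := by
  cases τ with
  | inl => exact P.jordan_region
  | inr => exact P.jordan_compl

theorem isClosed_edge (P : EuclideanPolygon q) (j : ZMod q) : IsClosed (P.edge j) := by
  obtain ⟨f, hf, -, hr, -⟩ := (P.edge_segment j).exists_path
  rw [← hr]
  exact (isCompact_range hf).isClosed

theorem vertex_mem_edge_left (P : EuclideanPolygon q) (j : ZMod q) : P.vertex j ∈ P.edge j := by
  obtain ⟨f, -, -, hr, h0, -⟩ := (P.edge_segment j).exists_path
  rw [← hr, ← h0]
  exact mem_range_self _

theorem edge_subset_frontier (P : EuclideanPolygon q) (j : ZMod q) :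
    P.edge j ⊆ frontier P.region := by
  rw [P.frontier_region]
  exact subset_iUnion P.edge j

theorem vertex_mem_frontier (P : EuclideanPolygon q) (j : ZMod q) :
    P.vertex j ∈ frontier P.region :=
  P.edge_subset_frontier j (P.vertex_mem_edge_left j)

theorem eq_vertex_of_mem_edge (P : EuclideanPolygon q) {j : ZMod q} {w : OnePoint ℂ}
    (hw : w ∈ P.edge j) (hv : w ∈ range P.vertex) : w ∈ ({P.vertex j, P.vertex (j + 1)} : Set _) := by
  obtain ⟨k, rfl⟩ := hv
  rcases P.vertex_mem_edge j k hw with rfl | rfl <;> simp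

theorem edge_unique (P : EuclideanPolygon q) {j k : ZMod q} {w : OnePoint ℂ}
    (hj : w ∈ P.edge j) (hk : w ∈ P.edge k) (hv : w ∉ range P.vertex) : j = k := by
  by_contra h
  exact hv (P.edge_inter j k h ⟨hj, hk⟩)

/-- Each edge is the closure of any cofinite subset. -/
theorem edge_subset_closure_diff (P : EuclideanPolygon q) (j : ZMod q) {F : Set (OnePoint ℂ)}
    (hF : F.Finite) : P.edge j ⊆ closure (P.edge j \ F) := by
  obtain ⟨f, hf, hfi, hr, -⟩ := (P.edge_segment j).exists_path
  have h1 : Dense (univ \ f ⁻¹' F) := dense_univ.sdiff_finite (hF.preimage hfi.injOn)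
  have h2 : f '' (univ \ f ⁻¹' F) ⊆ P.edge j \ F := by
    rintro _ ⟨s, hs, rfl⟩
    exact ⟨hr ▸ mem_range_self s, hs.2⟩
  have h3 := (image_closure_subset_closure_image hf).trans (closure_mono h2)
  rwa [h1.closure_eq, image_univ, hr] at h3

/-- Points to the right of an edge lie outside the closed region and converge to the edge. The
condition `left_side` covers only finite points other than the two ends, but these are dense in the
edge. In consequence blue and gray closed tiles have the same boundary. -/
theorem frontier_subset_closure_compl (P : EuclideanPolygon q) :
    frontier P.region ⊆ closure (closure P.region)ᶜ := by
  rw [P.frontier_region]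
  refine iUnion_subset fun j => ?_
  refine (P.edge_subset_closure_diff j
    (F := {P.vertex j, P.vertex (j + 1), OnePoint.infty}) (Set.toFinite _)).trans ?_
  refine closure_minimal ?_ isClosed_closure
  rintro x ⟨hx, hx'⟩
  simp only [mem_insert_iff, mem_singleton_iff, not_or] at hx'
  obtain ⟨w, rfl⟩ := OnePoint.ne_infty_iff_exists.1 hx'.2.2
  have h1 := P.left_side j w hx hx'.1 hx'.2.1
  have h2 : Tendsto (fun ε : ℝ => ((w - ε * (Complex.I * P.direction j) : ℂ) : OnePoint ℂ))
      (𝓝[>] 0) (𝓝 (w : OnePoint ℂ)) := by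
    have h3 : Continuous fun ε : ℝ => ((w - ε * (Complex.I * P.direction j) : ℂ) : OnePoint ℂ) :=
      OnePoint.continuous_coe.comp (by fun_prop)
    have h4 := h3.tendsto 0
    simp only [Complex.ofReal_zero, zero_mul, sub_zero] at h4
    exact h4.mono_left nhdsWithin_le_nhds
  exact mem_closure_of_tendsto h2 (h1.mono fun ε hε => hε.2)

theorem closure_compl_closure (P : EuclideanPolygon q) :
    closure (closure P.region)ᶜ = P.regionᶜ := by
  apply subset_antisymm
  · exact closure_minimal (compl_subset_compl.2 subset_closure) P.isOpen_region.isClosed_compl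
  · intro x hx
    by_cases h : x ∈ closure P.region
    · refine P.frontier_subset_closure_compl ?_
      rw [P.isOpen_region.frontier_eq]
      exact ⟨h, hx⟩
    · exact subset_closure h

theorem mem_closure_of_mem_frontier (P : EuclideanPolygon q) {w : OnePoint ℂ}
    (hw : w ∈ frontier P.region) (τ : Fin n ⊕ Fin n) : w ∈ closure (P.openTile τ) := by
  cases τ with
  | inl => exact frontier_subset_closure hw
  | inr => exact P.frontier_subset_closure_compl hw

theorem closure_openTile (P : EuclideanPolygon q) (τ : Fin n ⊕ Fin n) :
    closure (P.openTile τ) = P.openTile τ ∪ frontier P.region := by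
  have h := P.isOpen_region.frontier_eq
  cases τ with
  | inl =>
    change closure P.region = P.region ∪ _
    rw [h, union_sdiff_cancel subset_closure]
  | inr =>
    change closure (closure P.region)ᶜ = (closure P.region)ᶜ ∪ _
    rw [P.closure_compl_closure, h]
    ext x
    have := @subset_closure _ _ P.region x
    simp only [mem_union, mem_compl_iff, Set.mem_sdiff]
    tauto

theorem openTile_disjoint_frontier (P : EuclideanPolygon q) (τ : Fin n ⊕ Fin n) {w : OnePoint ℂ}
    (hw : w ∈ P.openTile τ) : w ∉ frontier P.region := by
  rw [P.isOpen_region.frontier_eq]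
  cases τ with
  | inl => exact fun h => h.2 hw
  | inr => exact fun h => hw h.1

theorem disjoint_sheetDomain (P : EuclideanPolygon q) (j : ZMod q) {w : OnePoint ℂ}
    (hw : w ∈ P.sheetDomain j) : w ∉ range P.vertex := by
  rintro ⟨k, rfl⟩
  rcases hw with h | ⟨h, h'⟩
  · exact h (P.vertex_mem_frontier k)
  · exact h' (P.eq_vertex_of_mem_edge h (mem_range_self k))

theorem mem_edge_of_mem_sheetDomain (P : EuclideanPolygon q) {j : ZMod q} {w : OnePoint ℂ}
    (hw : w ∈ P.sheetDomain j) (hf : w ∈ frontier P.region) : w ∈ P.edge j := by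
  rcases hw with h | h
  · exact absurd hf h
  · exact h.1

theorem exists_mem_sheetDomain (P : EuclideanPolygon q) {w : OnePoint ℂ}
    (hw : w ∉ range P.vertex) : ∃ j, w ∈ P.sheetDomain j := by
  by_cases h : w ∈ frontier P.region
  · rw [P.frontier_region, mem_iUnion] at h
    obtain ⟨j, hj⟩ := h
    refine ⟨j, Or.inr ⟨hj, ?_⟩⟩
    rintro (rfl | rfl) <;> exact hw (mem_range_self _)
  · exact ⟨0, Or.inl h⟩

/-- A sheet domain is the complement of the other edges and of the vertices, which together form a
finite union of closed sets. -/
theorem isOpen_sheetDomain [NeZero q] (P : EuclideanPolygon q) (j : ZMod q) :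
    IsOpen (P.sheetDomain j) := by
  have h : P.sheetDomain j = ((⋃ k ∈ {k | k ≠ j}, P.edge k) ∪ range P.vertex)ᶜ := by
    ext w
    constructor
    · rintro hw (h | h)
      · simp only [mem_iUnion, mem_ofPred_eq] at h
        obtain ⟨k, hk, hwk⟩ := h
        have h1 := P.mem_edge_of_mem_sheetDomain hw (P.edge_subset_frontier k hwk)
        exact P.disjoint_sheetDomain j hw (P.edge_inter k j hk ⟨hwk, h1⟩)
      · exact P.disjoint_sheetDomain j hw h
    · intro hw
      by_cases hf : w ∈ frontier P.region
      · rw [P.frontier_region, mem_iUnion] at hf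
        obtain ⟨k, hk⟩ := hf
        by_cases hkj : k = j
        · subst hkj
          refine Or.inr ⟨hk, ?_⟩
          rintro (rfl | rfl) <;> exact hw (Or.inr (mem_range_self _))
        · exact absurd (Or.inl (mem_biUnion (show k ∈ {k | k ≠ j} from hkj) hk)) hw
      · exact Or.inl hf
  rw [h]
  refine IsClosed.isOpen_compl (self := ?_)
  exact ((Set.toFinite _).isClosed_biUnion fun k _ => P.isClosed_edge k).union
    (finite_range _).isClosed

theorem finite_circlePoint_frontier [NeZero q] (P : EuclideanPolygon q) (p : OnePoint ℂ) {r : ℝ}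
    (hr : 0 < r) :
    {φ : ℝ | φ ∈ Ioc (-Real.pi) Real.pi ∧ circlePoint p r φ ∈ frontier P.region}.Finite := by
  have h := finite_iUnion fun j => (P.edge_segment j).finite_circlePoint p hr
  refine h.subset ?_
  rintro φ ⟨h1, h2⟩
  rw [P.frontier_region, mem_iUnion] at h2
  obtain ⟨j, hj⟩ := h2
  exact mem_iUnion.2 ⟨j, h1, hj⟩

end EuclideanPolygon

/-! ## The glued surface and its developing map -/

namespace EuclideanPolygon

variable {q n : ℕ} (P : EuclideanPolygon q) (σ : ZMod q → Equiv.Perm (Fin n))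

/-- The map from the glued surface to the sphere that is the identity on each tile. -/
def develop : P.GluedSurface σ → OnePoint ℂ :=
  Quot.lift (fun x => x.1.2) (by rintro x y ⟨α, j, -, -, h, -⟩; exact h)

/-- The quotient map from the disjoint union of the closed tiles. -/
def glue : P.TileUnion n → P.GluedSurface σ := Quot.mk _

theorem isQuotientMap_glue : IsQuotientMap (P.glue σ) := isQuotientMap_quot_mk

theorem continuous_develop : Continuous (P.develop σ) :=
  (P.isQuotientMap_glue σ).continuous_iff.2 (continuous_snd.comp continuous_subtype_val)

theorem exists_point (z : P.GluedSurface σ) : ∃ τ w hw, P.point σ τ w hw = z := by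
  obtain ⟨⟨⟨τ, w⟩, hw⟩, rfl⟩ := (P.isQuotientMap_glue σ).surjective z
  exact ⟨τ, w, hw, rfl⟩

theorem exists_point_develop (z : P.GluedSurface σ) :
    ∃ τ hw, P.point σ τ (P.develop σ z) hw = z := by
  obtain ⟨τ, w, hw, rfl⟩ := P.exists_point σ z
  exact ⟨τ, hw, rfl⟩

theorem continuous_point (τ : Fin n ⊕ Fin n) :
    Continuous fun w : closure (P.openTile τ) => P.point σ τ w w.2 :=
  (P.isQuotientMap_glue σ).continuous.comp
    (Continuous.subtype_mk (continuous_const.prodMk continuous_subtype_val) _)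

theorem point_inl_eq_inr {α : Fin n} {j : ZMod q} {w : OnePoint ℂ} (hw : w ∈ P.edge j)
    (h : w ∈ closure (P.openTile (Sum.inl α : Fin n ⊕ Fin n)))
    (h' : w ∈ closure (P.openTile (Sum.inr (σ j α) : Fin n ⊕ Fin n))) :
    P.point σ (Sum.inl α) w h = P.point σ (Sum.inr (σ j α)) w h' :=
  Quot.sound ⟨α, j, rfl, rfl, rfl, hw⟩

/-- The tiles `τ` and `τ'` have opposite colors and are glued along the edge `j`. -/
def Adjacent (j : ZMod q) (τ τ' : Fin n ⊕ Fin n) : Prop :=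
  ∃ α, (τ = Sum.inl α ∧ τ' = Sum.inr (σ j α)) ∨ (τ' = Sum.inl α ∧ τ = Sum.inr (σ j α))

variable {σ} in
theorem Adjacent.symm {j : ZMod q} {τ τ' : Fin n ⊕ Fin n} (h : Adjacent σ j τ τ') :
    Adjacent σ j τ' τ := by
  obtain ⟨α, h⟩ := h
  exact ⟨α, h.symm⟩

variable {σ} in
theorem Adjacent.eq_of_adjacent {j : ZMod q} {τ τ' τ'' : Fin n ⊕ Fin n} (h : Adjacent σ j τ τ')
    (h' : Adjacent σ j τ' τ'') : τ = τ'' := by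
  obtain ⟨α, ⟨rfl, rfl⟩ | ⟨rfl, rfl⟩⟩ := h
  · obtain ⟨β, ⟨h1, -⟩ | ⟨rfl, h1⟩⟩ := h'
    · cases h1
    · rw [(σ j).injective (Sum.inr_injective h1)]
  · obtain ⟨β, ⟨h1, rfl⟩ | ⟨-, h1⟩⟩ := h'
    · rw [Sum.inl_injective h1]
    · cases h1

variable {P σ} in
theorem point_eq_of_adjacent {j : ZMod q} {τ τ' : Fin n ⊕ Fin n} (h : Adjacent σ j τ τ')
    {w : OnePoint ℂ} (hw : w ∈ P.edge j) (h₁ : w ∈ closure (P.openTile τ))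
    (h₂ : w ∈ closure (P.openTile τ')) : P.point σ τ w h₁ = P.point σ τ' w h₂ := by
  obtain ⟨α, ⟨rfl, rfl⟩ | ⟨rfl, rfl⟩⟩ := h
  · exact P.point_inl_eq_inr σ hw h₁ h₂
  · exact (P.point_inl_eq_inr σ hw h₂ h₁).symm

variable {P σ} in
-- A point that is not a vertex lies on at most one edge, and crossing the same edge twice leads
-- back to the first tile. So every chain of gluings through such a point collapses to at most one
-- step. At vertices this fails, since chains may turn around the vertex.
theorem eq_or_adjacent_of_point_eq {τ τ' : Fin n ⊕ Fin n} {w w' : OnePoint ℂ}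
    {h₁ : w ∈ closure (P.openTile τ)} {h₂ : w' ∈ closure (P.openTile τ')}
    (h : P.point σ τ w h₁ = P.point σ τ' w' h₂) (hv : w ∉ range P.vertex) :
    τ = τ' ∨ ∃ j, w ∈ P.edge j ∧ Adjacent σ j τ τ' := by
  have key : ∀ x y : P.TileUnion n, Relation.EqvGen (P.GlueRel σ) x y → x.1.2 = y.1.2 ∧
      (x.1.2 ∉ range P.vertex →
        x.1.1 = y.1.1 ∨ ∃ j, x.1.2 ∈ P.edge j ∧ Adjacent σ j x.1.1 y.1.1) := by
    intro x y h
    induction h with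
    | rel x y h =>
      obtain ⟨α, j, h1, h2, h3, h4⟩ := h
      exact ⟨h3, fun _ => Or.inr ⟨j, h4, α, Or.inl ⟨h1, h2⟩⟩⟩
    | refl x => exact ⟨rfl, fun _ => Or.inl rfl⟩
    | symm x y _ ih =>
      refine ⟨ih.1.symm, fun hv => ?_⟩
      rw [← ih.1] at hv ⊢
      rcases ih.2 hv with h | ⟨j, h, h'⟩
      · exact Or.inl h.symm
      · exact Or.inr ⟨j, h, h'.symm⟩
    | trans x y z _ _ ih ih' =>
      refine ⟨ih.1.trans ih'.1, fun hv => ?_⟩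
      have h1 := ih.2 hv
      have h2 := ih'.2 (ih.1 ▸ hv)
      rw [← ih.1] at h2
      rcases h1 with h1 | ⟨j, hj, h1⟩
      · rwa [h1]
      · rcases h2 with h2 | ⟨k, hk, h2⟩
        · exact Or.inr ⟨j, hj, h2 ▸ h1⟩
        · obtain rfl := P.edge_unique hj hk hv
          exact Or.inl (h1.eq_of_adjacent h2)
  exact (key _ _ (Quot.eqvGen_exact h)).2 hv

variable {P σ} in
theorem eq_of_point_eq {τ τ' : Fin n ⊕ Fin n} {w w' : OnePoint ℂ}
    {h₁ : w ∈ closure (P.openTile τ)} {h₂ : w' ∈ closure (P.openTile τ')}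
    (h : P.point σ τ w h₁ = P.point σ τ' w' h₂) (hv : w ∉ frontier P.region) : τ = τ' := by
  have h1 : w ∉ range P.vertex := by
    rintro ⟨k, rfl⟩
    exact hv (P.vertex_mem_frontier k)
  rcases eq_or_adjacent_of_point_eq h h1 with h | ⟨j, hj, -⟩
  · exact h
  · exact absurd (P.edge_subset_frontier j hj) hv

/-- The points of the sphere at which the closed tiles `τ` and `τ'` are glued. -/
def shared (τ τ' : Fin n ⊕ Fin n) : Set (OnePoint ℂ) :=
  {w | ∃ h₁ h₂, P.point σ τ w h₁ = P.point σ τ' w h₂}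

/-- Presents the shared set of two tiles as finitely many edges and finitely many vertices; its
closedness comes from here. -/
theorem shared_eq {τ τ' : Fin n ⊕ Fin n} (h : τ ≠ τ') :
    P.shared σ τ τ' = (⋃ j ∈ {j | Adjacent σ j τ τ'}, P.edge j) ∪
      (P.shared σ τ τ' ∩ range P.vertex) := by
  ext w
  constructor
  · rintro ⟨h₁, h₂, hw⟩
    by_cases hv : w ∈ range P.vertex
    · exact Or.inr ⟨⟨h₁, h₂, hw⟩, hv⟩
    · rcases eq_or_adjacent_of_point_eq hw hv with h' | ⟨j, hj, h'⟩
      · exact absurd h' h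
      · exact Or.inl (mem_biUnion (show j ∈ {j | Adjacent σ j τ τ'} from h') hj)
  · rintro (hw | hw)
    · simp only [mem_iUnion, mem_ofPred_eq] at hw
      obtain ⟨j, hj, hw⟩ := hw
      have hf := P.edge_subset_frontier j hw
      exact ⟨P.mem_closure_of_mem_frontier hf τ, P.mem_closure_of_mem_frontier hf τ',
        point_eq_of_adjacent hj hw _ _⟩
    · exact hw.1

theorem isClosed_shared [NeZero q] (τ τ' : Fin n ⊕ Fin n) : IsClosed (P.shared σ τ τ') := by
  by_cases h : τ = τ'
  · subst h
    have : P.shared σ τ τ = closure (P.openTile τ) := by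
      ext w
      exact ⟨fun h => h.1, fun h => ⟨h, h, rfl⟩⟩
    rw [this]
    exact isClosed_closure
  · rw [P.shared_eq σ h]
    exact ((Set.toFinite _).isClosed_biUnion fun j _ => P.isClosed_edge j).union
      (((finite_range P.vertex).subset inter_subset_right).isClosed)

/-! ### Compactness and the Hausdorff property of the glued surface. -/

instance : CompactSpace (P.TileUnion n) := by
  have h : {x : (Fin n ⊕ Fin n) × OnePoint ℂ | x.2 ∈ closure (P.openTile x.1)} =
      ⋃ τ : Fin n ⊕ Fin n, {τ} ×ˢ closure (P.openTile τ) := by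
    ext ⟨τ, w⟩
    simp
  have h1 : IsClosed {x : (Fin n ⊕ Fin n) × OnePoint ℂ | x.2 ∈ closure (P.openTile x.1)} := by
    rw [h]
    exact isClosed_iUnion_of_finite fun τ => (isClosed_discrete _).prod isClosed_closure
  exact isCompact_iff_compactSpace.1 h1.isCompact

instance : CompactSpace (P.GluedSurface σ) :=
  inferInstanceAs (CompactSpace (Quot (P.GlueRel σ)))

/-- The saturation of a closed set A is a finite union over pairs of tiles: in the tile τ' it
consists of the points of A in the tile τ that lie in the closed set shared by τ and τ'. -/
theorem isClosedMap_glue [NeZero q] : IsClosedMap (P.glue σ) := by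
  intro A hA
  rw [← (P.isQuotientMap_glue σ).isClosed_preimage]
  have h1 : ∀ τ : Fin n ⊕ Fin n, IsClosed {w | ∃ h : w ∈ closure (P.openTile τ),
      (⟨(τ, w), h⟩ : P.TileUnion n) ∈ A} := by
    intro τ
    have h2 : Continuous fun w : closure (P.openTile τ) => (⟨(τ, w), w.2⟩ : P.TileUnion n) :=
      Continuous.subtype_mk (continuous_const.prodMk continuous_subtype_val) _
    have h3 := isClosed_closure.isClosedMap_subtype_val _ (hA.preimage h2)
    convert h3 using 1
    ext w
    simp
  have h2 : P.glue σ ⁻¹' (P.glue σ '' A) = ⋃ τ' : Fin n ⊕ Fin n, ⋃ τ : Fin n ⊕ Fin n,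
      {y : P.TileUnion n | y.1.1 = τ'} ∩ {y : P.TileUnion n | y.1.2 ∈ P.shared σ τ τ' ∩
        {w | ∃ h : w ∈ closure (P.openTile τ), (⟨(τ, w), h⟩ : P.TileUnion n) ∈ A}} := by
    ext ⟨⟨τ', w⟩, hw⟩
    simp only [mem_preimage, mem_image, mem_iUnion]
    constructor
    · rintro ⟨⟨⟨τ, w'⟩, hw'⟩, hA', h⟩
      obtain rfl : w' = w := congrArg (P.develop σ) h
      exact ⟨τ', τ, rfl, ⟨hw', hw, h⟩, hw', hA'⟩
    · rintro ⟨_, τ, rfl, ⟨h₁, h₂, h⟩, h3, h4⟩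
      exact ⟨_, h4, h⟩
  rw [h2]
  refine isClosed_iUnion_of_finite fun τ' => isClosed_iUnion_of_finite fun τ => ?_
  refine IsClosed.inter ?_ ?_
  · exact (isClosed_discrete {τ'}).preimage (continuous_fst.comp continuous_subtype_val)
  · exact ((P.isClosed_shared σ τ τ').inter (h1 τ)).preimage
      (continuous_snd.comp continuous_subtype_val)

end EuclideanPolygon

/-- A closed quotient of a compact Hausdorff space is Hausdorff. -/
theorem IsClosedMap.t2Space {X Y : Type*} [TopologicalSpace X] [TopologicalSpace Y] [CompactSpace X]
    [T2Space X] {f : X → Y} (hf : IsClosedMap f) (hc : Continuous f)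
    (hs : Function.Surjective f) : T2Space Y := by
  have h1 : ∀ y : Y, IsClosed {y} := by
    intro y
    obtain ⟨x, rfl⟩ := hs y
    rw [← image_singleton]
    exact hf _ isClosed_singleton
  refine ⟨fun y y' hy => ?_⟩
  obtain ⟨U, V, hU, hV, hyU, hyV, hUV⟩ := normal_separation
    ((h1 y).preimage hc) ((h1 y').preimage hc) (Disjoint.preimage f (disjoint_singleton.2 hy))
  refine ⟨(f '' Uᶜ)ᶜ, (f '' Vᶜ)ᶜ, (hf _ hU.isClosed_compl).isOpen_compl,
    (hf _ hV.isClosed_compl).isOpen_compl, ?_, ?_, ?_⟩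
  · rintro ⟨x, hx, rfl⟩
    exact hx (hyU rfl)
  · rintro ⟨x, hx, rfl⟩
    exact hx (hyV rfl)
  · rw [Set.disjoint_left]
    intro z hz hz'
    obtain ⟨x, rfl⟩ := hs z
    have hxU : x ∈ U := by
      by_contra h
      exact hz ⟨x, h, rfl⟩
    have hxV : x ∈ V := by
      by_contra h
      exact hz' ⟨x, h, rfl⟩
    exact Set.disjoint_left.1 hUV hxU hxV

namespace EuclideanPolygon

variable {q n : ℕ} (P : EuclideanPolygon q) (σ : ZMod q → Equiv.Perm (Fin n))

instance [NeZero q] : T2Space (P.GluedSurface σ) :=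
  (P.isClosedMap_glue σ).t2Space (P.isQuotientMap_glue σ).continuous
    (P.isQuotientMap_glue σ).surjective

/-- The closed tile `τ`, as a subset of the glued surface. -/
def closedTile (τ : Fin n ⊕ Fin n) : Set (P.GluedSurface σ) :=
  range fun w : closure (P.openTile τ) => P.point σ τ w w.2

theorem isClosed_closedTile [NeZero q] (τ : Fin n ⊕ Fin n) : IsClosed (P.closedTile σ τ) := by
  have : CompactSpace (closure (P.openTile τ)) :=
    isCompact_iff_compactSpace.1 isClosed_closure.isCompact
  exact (isCompact_range (P.continuous_point σ τ)).isClosed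

/-! ## Sheets -/

theorem sheet_of_mem {α : Fin n} {j : ZMod q} {w : OnePoint ℂ} (h : w ∈ closure P.region) :
    P.sheet σ α j w = P.point σ (Sum.inl α) w h := by
  rw [sheet, dif_pos h]

theorem sheet_of_notMem {α : Fin n} {j : ZMod q} {w : OnePoint ℂ} (h : w ∉ closure P.region) :
    P.sheet σ α j w = P.point σ (Sum.inr (σ j α)) w (mem_closure_compl h _) := by
  rw [sheet, dif_neg h]

theorem develop_sheet (α : Fin n) (j : ZMod q) (w : OnePoint ℂ) :
    P.develop σ (P.sheet σ α j w) = w := by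
  by_cases h : w ∈ closure P.region
  · rw [P.sheet_of_mem σ h]; rfl
  · rw [P.sheet_of_notMem σ h]; rfl

/-- On the interior of edge j the blue and gray descriptions of the sheet agree, by the gluing;
continuity across the edge follows by pasting two closed pieces. -/
theorem sheet_of_notMem_region {α : Fin n} {j : ZMod q} {w : OnePoint ℂ}
    (hw : w ∈ P.sheetDomain j)
    (h : w ∈ closure (P.openTile (Sum.inr (σ j α) : Fin n ⊕ Fin n))) :
    P.sheet σ α j w = P.point σ (Sum.inr (σ j α)) w h := by
  by_cases h' : w ∈ closure P.region
  · have hf : w ∈ frontier P.region := by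
      rw [P.isOpen_region.frontier_eq]
      refine ⟨h', ?_⟩
      have h2 : w ∈ closure (closure P.region)ᶜ := h
      rwa [P.closure_compl_closure] at h2
    rw [P.sheet_of_mem σ h']
    exact P.point_inl_eq_inr σ (P.mem_edge_of_mem_sheetDomain hw hf) _ _
  · rw [P.sheet_of_notMem σ h']

theorem continuousOn_sheet (α : Fin n) (j : ZMod q) :
    ContinuousOn (P.sheet σ α j) (P.sheetDomain j) := by
  have key : ∀ (τ : Fin n ⊕ Fin n) (s : Set (OnePoint ℂ)) (hs : s ⊆ closure (P.openTile τ)),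
      (∀ w (hw : w ∈ s), P.sheet σ α j w = P.point σ τ w (hs hw)) →
      ContinuousOn (P.sheet σ α j) s := by
    intro τ s hs h
    rw [continuousOn_iff_continuous_domRestrict]
    exact ((P.continuous_point σ τ).comp (continuous_inclusion hs)).congr
      fun w => (h w w.2).symm
  have h1 : ContinuousOn (P.sheet σ α j) (closure P.region) :=
    key (Sum.inl α) _ subset_rfl fun w hw => P.sheet_of_mem σ hw
  have h2 : ContinuousOn (P.sheet σ α j) (P.regionᶜ ∩ P.sheetDomain j) := by
    refine key (Sum.inr (σ j α)) _ (fun w hw => ?_)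
      fun w hw => P.sheet_of_notMem_region σ hw.2 _
    change w ∈ closure (closure P.region)ᶜ
    rw [P.closure_compl_closure]
    exact hw.1
  intro w hw
  have h3 : ContinuousWithinAt (P.sheet σ α j) (closure P.region) w := by
    by_cases h : w ∈ closure P.region
    · exact h1 w h
    · exact continuousWithinAt_of_notMem_closure (by rwa [closure_closure])
  have h4 : ContinuousWithinAt (P.sheet σ α j) (P.regionᶜ ∩ P.sheetDomain j) w := by
    by_cases h : w ∈ P.region
    · refine continuousWithinAt_of_notMem_closure fun h' => ?_
      exact closure_minimal inter_subset_left P.isOpen_region.isClosed_compl h' h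
    · exact h2 w ⟨h, hw⟩
  refine (h3.union h4).mono fun x hx => ?_
  by_cases h : x ∈ P.region
  · exact Or.inl (subset_closure h)
  · exact Or.inr ⟨h, hx⟩

theorem sheet_image_eq (α : Fin n) (j : ZMod q) : P.sheet σ α j '' P.sheetDomain j =
    P.develop σ ⁻¹' P.sheetDomain j ∩
      (P.closedTile σ (Sum.inl α) ∪ P.closedTile σ (Sum.inr (σ j α))) := by
  ext z
  constructor
  · rintro ⟨w, hw, rfl⟩
    refine ⟨by rwa [mem_preimage, develop_sheet], ?_⟩
    by_cases h : w ∈ closure P.region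
    · rw [P.sheet_of_mem σ h]
      exact Or.inl ⟨⟨w, h⟩, rfl⟩
    · rw [P.sheet_of_notMem σ h]
      exact Or.inr ⟨⟨w, mem_closure_compl h _⟩, rfl⟩
  · rintro ⟨h, ⟨w, rfl⟩ | ⟨w, rfl⟩⟩
    · exact ⟨w, h, P.sheet_of_mem σ w.2⟩
    · exact ⟨w, h, P.sheet_of_notMem_region σ h w.2⟩

theorem sheet_injective {α β : Fin n} {j : ZMod q} {w : OnePoint ℂ} (hw : w ∈ P.sheetDomain j)
    (h : P.sheet σ α j w = P.sheet σ β j w) : α = β := by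
  by_cases h' : w ∈ closure P.region
  · rw [P.sheet_of_mem σ h', P.sheet_of_mem σ h'] at h
    rcases eq_or_adjacent_of_point_eq h (P.disjoint_sheetDomain j hw) with h | ⟨k, -, γ, h⟩
    · exact Sum.inl_injective h
    · rcases h with ⟨-, h⟩ | ⟨-, h⟩ <;> cases h
  · rw [P.sheet_of_notMem σ h', P.sheet_of_notMem σ h'] at h
    exact (σ j).injective (Sum.inr_injective (eq_of_point_eq h fun hf =>
      h' (frontier_subset_closure hf)))

theorem exists_sheet_eq {j : ZMod q} {z : P.GluedSurface σ} (hz : P.develop σ z ∈ P.sheetDomain j) :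
    ∃ α, P.sheet σ α j (P.develop σ z) = z := by
  obtain ⟨τ, hw, h⟩ := P.exists_point_develop σ z
  cases τ with
  | inl α => exact ⟨α, (P.sheet_of_mem σ hw).trans h⟩
  | inr β =>
    obtain ⟨α, rfl⟩ := (σ j).surjective β
    exact ⟨α, (P.sheet_of_notMem_region σ hz hw).trans h⟩

/-- Over the sheet domain the images of the n sheets are disjoint, relatively closed and cover
everything; being finitely many, they are also open. -/
theorem isOpen_sheet_image [NeZero q] (α : Fin n) (j : ZMod q) :
    IsOpen (P.sheet σ α j '' P.sheetDomain j) := by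
  have h : P.sheet σ α j '' P.sheetDomain j = P.develop σ ⁻¹' P.sheetDomain j ∩
      (⋃ β ∈ {β | β ≠ α},
        (P.closedTile σ (Sum.inl β) ∪ P.closedTile σ (Sum.inr (σ j β))))ᶜ := by
    ext z
    constructor
    · rintro ⟨w, hw, rfl⟩
      have hw' : P.develop σ (P.sheet σ α j w) ∈ P.sheetDomain j := by rwa [develop_sheet]
      refine ⟨hw', fun h => ?_⟩
      simp only [mem_iUnion] at h
      obtain ⟨β, hβ, h⟩ := h
      have h1 : P.sheet σ α j w ∈ P.sheet σ β j '' P.sheetDomain j := by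
        rw [sheet_image_eq]
        exact ⟨hw', h⟩
      obtain ⟨w', hw2, h2⟩ := h1
      have h3 := congrArg (P.develop σ) h2
      rw [develop_sheet, develop_sheet] at h3
      subst h3
      exact hβ (P.sheet_injective σ hw2 h2)
    · rintro ⟨hz, hz'⟩
      obtain ⟨β, h⟩ := P.exists_sheet_eq σ hz
      have h1 : z ∈ P.sheet σ β j '' P.sheetDomain j := ⟨_, hz, h⟩
      by_cases hβ : β = α
      · exact hβ ▸ h1
      · rw [sheet_image_eq] at h1
        exact absurd (mem_biUnion (show β ∈ {β | β ≠ α} from hβ) h1.2) hz'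
  rw [h]
  refine ((P.isOpen_sheetDomain j).preimage (P.continuous_develop σ)).inter ?_
  exact ((Set.toFinite _).isClosed_biUnion fun β _ =>
    (P.isClosed_closedTile σ _).union (P.isClosed_closedTile σ _)).isOpen_compl

/-- Over a sheet domain, the developing map is a trivial covering by `n` sheets. -/
def sheetHomeomorph [NeZero q] (j : ZMod q) :
    P.develop σ ⁻¹' P.sheetDomain j ≃ₜ P.sheetDomain j × Fin n where
  toFun z := (⟨P.develop σ z, z.2⟩, (P.exists_sheet_eq σ z.2).choose)
  invFun x := ⟨P.sheet σ x.2 j x.1, by rw [mem_preimage, develop_sheet]; exact x.1.2⟩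
  left_inv z := Subtype.ext (P.exists_sheet_eq σ z.2).choose_spec
  right_inv x := by
    refine Prod.ext (Subtype.ext (P.develop_sheet σ _ _ _)) ?_
    have h1 : P.develop σ (P.sheet σ x.2 j x.1) ∈ P.sheetDomain j := by
      rw [develop_sheet]
      exact x.1.2
    have h2 := (P.exists_sheet_eq σ h1).choose_spec
    exact P.sheet_injective σ x.1.2
      ((congrArg (P.sheet σ _ j) (P.develop_sheet σ x.2 j x.1)).symm.trans h2)
  continuous_toFun := by
    refine Continuous.prodMk (Continuous.subtype_mk
      ((P.continuous_develop σ).comp continuous_subtype_val) _) ?_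
    refine continuous_discrete_rng.2 fun α => ?_
    have h : (fun z : P.develop σ ⁻¹' P.sheetDomain j => (P.exists_sheet_eq σ z.2).choose) ⁻¹' {α} =
        Subtype.val ⁻¹' (P.sheet σ α j '' P.sheetDomain j) := by
      ext z
      have h1 := (P.exists_sheet_eq σ z.2).choose_spec
      constructor
      · intro h
        rw [mem_preimage, mem_singleton_iff] at h
        rw [h] at h1
        exact ⟨_, z.2, h1⟩
      · rintro ⟨w, hw, h⟩
        have h2 : P.develop σ z = w := by rw [← h, develop_sheet]
        rw [mem_preimage, mem_singleton_iff]
        refine P.sheet_injective σ hw ?_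
        rw [h, ← h2]
        exact h1
    rw [h]
    exact (P.isOpen_sheet_image σ α j).preimage continuous_subtype_val
  continuous_invFun := by
    refine Continuous.subtype_mk ?_ _
    refine continuous_prod_of_discrete_right.2 fun α => ?_
    exact continuousOn_iff_continuous_domRestrict.1 (P.continuousOn_sheet σ α j)

theorem isCoveringMapOn_develop [NeZero q] :
    IsCoveringMapOn (P.develop σ) (range P.vertex)ᶜ := by
  intro w hw
  obtain ⟨j, hj⟩ := P.exists_mem_sheetDomain hw
  refine IsEvenlyCovered.to_isEvenlyCovered_preimage (I := Fin n) ⟨inferInstance, P.sheetDomain j,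
    hj, P.isOpen_sheetDomain j, (P.isOpen_sheetDomain j).preimage (P.continuous_develop σ),
    P.sheetHomeomorph σ j, fun z => rfl⟩

theorem finite_fiber (w : OnePoint ℂ) : (P.develop σ ⁻¹' {w}).Finite := by
  classical
  by_cases hw : (P.develop σ ⁻¹' {w}).Nonempty
  · have h : P.develop σ ⁻¹' {w} ⊆ range fun τ : Fin n ⊕ Fin n =>
        -- Each closed tile contributes at most one point over w; `hw.some` only fills in the tiles
        -- that do not contain w.
        if h : w ∈ closure (P.openTile τ) then P.point σ τ w h else hw.some := by
      rintro z rfl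
      obtain ⟨τ, h, hz⟩ := P.exists_point_develop σ z
      exact ⟨τ, by simp only [dif_pos h, hz]⟩
    exact (finite_range _).subset h
  · rw [not_nonempty_iff_eq_empty.1 hw]
    exact finite_empty

theorem injOn_sheet (α : Fin n) (j : ZMod q) (s : Set (OnePoint ℂ)) : InjOn (P.sheet σ α j) s :=
  (Function.LeftInverse.injective (P.develop_sheet σ α j)).injOn

end EuclideanPolygon

/-! ## Stars of points of the glued surface -/

namespace EuclideanPolygon

variable {q n : ℕ} (P : EuclideanPolygon q) (σ : ZMod q → Equiv.Perm (Fin n))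

/-- The tiles whose closure contains the point `z`. -/
def tilesAt (z : P.GluedSurface σ) : Set (Fin n ⊕ Fin n) :=
  {τ | ∃ h, P.point σ τ (P.develop σ z) h = z}

/-- A neighbourhood of the image of `z` over which the closed tiles at `z` are separated from the
other ones. -/
def starBase (z : P.GluedSurface σ) : Set (OnePoint ℂ) :=
  (⋃ τ ∈ P.tilesAt σ z, ⋃ τ' ∈ (P.tilesAt σ z)ᶜ, P.shared σ τ τ')ᶜ

/-- The union of the closed tiles at `z`, restricted to `starBase`. -/
def star (z : P.GluedSurface σ) : Set (P.GluedSurface σ) :=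
  P.develop σ ⁻¹' P.starBase σ z ∩ ⋃ τ ∈ P.tilesAt σ z, P.closedTile σ τ

variable {σ} in
theorem nonempty_tilesAt (z : P.GluedSurface σ) : (P.tilesAt σ z).Nonempty := by
  obtain ⟨τ, h, hz⟩ := P.exists_point_develop σ z
  exact ⟨τ, h, hz⟩

theorem isOpen_starBase [NeZero q] (z : P.GluedSurface σ) : IsOpen (P.starBase σ z) :=
  ((Set.toFinite _).isClosed_biUnion fun _ _ => (Set.toFinite _).isClosed_biUnion fun _ _ =>
    P.isClosed_shared σ _ _).isOpen_compl

theorem develop_mem_starBase (z : P.GluedSurface σ) : P.develop σ z ∈ P.starBase σ z := by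
  intro h
  simp only [mem_iUnion] at h
  obtain ⟨τ, ⟨h0, hτ⟩, τ', hτ', h₁, h₂, h⟩ := h
  exact hτ' ⟨h₂, h.symm.trans hτ⟩

variable {P σ} in
theorem exists_point_of_mem_star {z y : P.GluedSurface σ} (hy : y ∈ P.star σ z) :
    ∃ τ ∈ P.tilesAt σ z, ∃ h, P.point σ τ (P.develop σ y) h = y := by
  have h := hy.2
  simp only [mem_iUnion] at h
  obtain ⟨τ, hτ, w, rfl⟩ := h
  exact ⟨τ, hτ, w.2, rfl⟩

variable {P σ} in
theorem point_mem_star {z : P.GluedSurface σ} {τ : Fin n ⊕ Fin n} (hτ : τ ∈ P.tilesAt σ z)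
    {w : OnePoint ℂ} (hw : w ∈ P.starBase σ z) (h : w ∈ closure (P.openTile τ)) :
    P.point σ τ w h ∈ P.star σ z :=
  ⟨hw, mem_biUnion hτ ⟨⟨w, h⟩, rfl⟩⟩

variable {P σ} in
-- Over the star base no tile at z is glued to a tile away from z, so all representatives of a point
-- of the star lie in tiles at z. This saturation makes the star open.
theorem tilesAt_of_point_mem_star {z : P.GluedSurface σ} {τ : Fin n ⊕ Fin n}
    {w : OnePoint ℂ} {h : w ∈ closure (P.openTile τ)} (hw : P.point σ τ w h ∈ P.star σ z) :
    τ ∈ P.tilesAt σ z := by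
  by_contra hτ
  obtain ⟨τ', hτ', h', h2⟩ := exists_point_of_mem_star hw
  refine hw.1 ?_
  simp only [mem_iUnion]
  exact ⟨τ', hτ', τ, hτ, h', h, h2⟩

theorem mem_star_self (z : P.GluedSurface σ) : z ∈ P.star σ z := by
  obtain ⟨τ, h, hz⟩ := P.nonempty_tilesAt z
  have := point_mem_star ⟨h, hz⟩ (P.develop_mem_starBase σ z) h
  rwa [hz] at this

variable {P σ} in
-- Each tile at z has one point over the image of z, and that point is z itself.
theorem eq_of_mem_star {z y : P.GluedSurface σ} (hy : y ∈ P.star σ z)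
    (h : P.develop σ y = P.develop σ z) : y = z := by
  obtain ⟨τ, ⟨h1, hτ⟩, h', h2⟩ := exists_point_of_mem_star hy
  rw [← hτ, ← h2]
  congr 1

theorem isOpen_star [NeZero q] (z : P.GluedSurface σ) : IsOpen (P.star σ z) := by
  have h : P.star σ z = P.develop σ ⁻¹' P.starBase σ z ∩
      (⋃ τ ∈ (P.tilesAt σ z)ᶜ, P.closedTile σ τ)ᶜ := by
    ext y
    constructor
    · intro hy
      refine ⟨hy.1, fun h => ?_⟩
      simp only [mem_iUnion] at h
      obtain ⟨τ, hτ, w, rfl⟩ := h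
      exact hτ (tilesAt_of_point_mem_star hy)
    · rintro ⟨hy, h⟩
      obtain ⟨τ, w, hw, rfl⟩ := P.exists_point σ y
      refine point_mem_star ?_ hy hw
      by_contra hτ
      exact h (mem_biUnion hτ ⟨⟨_, hw⟩, rfl⟩)
  rw [h]
  exact ((P.isOpen_starBase σ z).preimage (P.continuous_develop σ)).inter
    ((Set.toFinite _).isClosed_biUnion fun τ _ => P.isClosed_closedTile σ τ).isOpen_compl

/-- Together with `isOpen_star`, this makes the star clopen over its base, so that connected sets
over the base which meet the star stay in it. -/
theorem isOpen_preimage_diff_star [NeZero q] (z : P.GluedSurface σ) :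
    IsOpen (P.develop σ ⁻¹' P.starBase σ z \ P.star σ z) := by
  have h : P.develop σ ⁻¹' P.starBase σ z \ P.star σ z = P.develop σ ⁻¹' P.starBase σ z ∩
      (⋃ τ ∈ P.tilesAt σ z, P.closedTile σ τ)ᶜ := by
    rw [star, sdiff_self_inter]
    rfl
  rw [h]
  exact ((P.isOpen_starBase σ z).preimage (P.continuous_develop σ)).inter
    ((Set.toFinite _).isClosed_biUnion fun τ _ => P.isClosed_closedTile σ τ).isOpen_compl

/-- The stars of `z` form a neighbourhood basis of `z`. -/
theorem eventually_star_subset (z : P.GluedSurface σ) {O : Set (P.GluedSurface σ)} (hO : O ∈ 𝓝 z) :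
    ∀ᶠ w in 𝓝 (P.develop σ z), ∀ y ∈ P.star σ z, P.develop σ y = w → y ∈ O := by
  have h1 : ∀ τ ∈ P.tilesAt σ z, ∀ᶠ w in 𝓝 (P.develop σ z),
      ∀ h : w ∈ closure (P.openTile τ), P.point σ τ w h ∈ O := by
    rintro τ ⟨h, hz⟩
    have h2 := (P.continuous_point σ τ).continuousAt (x := ⟨_, h⟩)
    rw [ContinuousAt, hz] at h2
    have h3 := h2 hO
    rw [mem_map, mem_nhds_subtype_iff_nhdsWithin, mem_nhdsWithin_iff_eventually] at h3
    filter_upwards [h3] with w hw h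
    obtain ⟨x, hx, rfl⟩ := hw h
    exact hx
  filter_upwards [(Set.toFinite (P.tilesAt σ z)).eventually_all.2 h1] with w hw y hy hyw
  obtain ⟨τ, hτ, h, h2⟩ := exists_point_of_mem_star hy
  subst hyw
  rw [← h2]
  exact hw τ hτ h

theorem edge_frequently (j : ZMod q) {p : OnePoint ℂ} (hp : p ∈ P.edge j) :
    ∃ᶠ w in 𝓝[≠] p, w ∈ P.edge j := by
  have h := P.edge_subset_closure_diff j (finite_singleton p) hp
  rw [mem_closure_iff_frequently] at h
  rw [frequently_nhdsWithin_iff]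
  exact h.mono fun w hw => hw

/-- Near a boundary point `z`, the star of `z` with the point `z` removed is connected. -/
theorem eventually_star_subset_of_clopen [NeZero q] {z : P.GluedSurface σ}
    (hz : P.develop σ z ∈ frontier P.region) {C C' : Set (P.GluedSurface σ)} (hC : IsOpen C)
    (hC' : IsOpen C') (hCC : Disjoint C C')
    (hcov : ∀ᶠ w in 𝓝[≠] (P.develop σ z), ∀ y ∈ P.star σ z, P.develop σ y = w → y ∈ C ∪ C')
    (hex : ∃ᶠ w in 𝓝[≠] (P.develop σ z), ∃ y ∈ P.star σ z, P.develop σ y = w ∧ y ∈ C) :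
    ∀ᶠ w in 𝓝[≠] (P.develop σ z), ∀ y ∈ P.star σ z, P.develop σ y = w → y ∈ C := by
  set p := P.develop σ z with hp
  let good (C : Set (P.GluedSurface σ)) (τ : Fin n ⊕ Fin n) : Prop :=
    ∀ᶠ w in 𝓝[≠] p, ∀ h : w ∈ closure (P.openTile τ), P.point σ τ w h ∈ C
  have hcov' := eventually_nhdsWithin_iff.1 hcov
  obtain ⟨D, hD, hDo, hpD⟩ := eventually_nhds_iff.1
    (hcov'.and ((P.isOpen_starBase σ z).eventually_mem (P.develop_mem_starBase σ z)))
  -- Near p, each closed tile with p removed is connected, hence lies on one side of the separation.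
  have hdich : ∀ τ ∈ P.tilesAt σ z, good C τ ∨ good C' τ := by
    intro τ hτ
    obtain ⟨K, hKD, hK, D', hD', hUD⟩ := (P.isJordanDomain_openTile τ).exists_isPreconnected
      (P.mem_closure_of_mem_frontier hz τ) (hDo.mem_nhds hpD)
    have hpK : p ∉ K := fun h => P.openTile_disjoint_frontier τ (hKD h).1 hz
    -- A set between K and its closure is connected; deleting the boundary point p is harmless
    -- because K lies in the open tile.
    have hK' : IsPreconnected ((closure K ∩ D) \ {p}) := by
      refine hK.subset_closure (fun w hw => ⟨⟨subset_closure hw, (hKD hw).2⟩, ?_⟩)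
        (sdiff_subset.trans inter_subset_left)
      rintro rfl
      exact hpK hw
    have hsub : (closure K ∩ D) \ {p} ⊆ closure (P.openTile τ) := fun w hw =>
      closure_mono (hKD.trans inter_subset_left) hw.1.1
    have hev : ∀ᶠ w in 𝓝[≠] p, w ∈ closure (P.openTile τ) → w ∈ (closure K ∩ D) \ {p} := by
      rw [eventually_nhdsWithin_iff]
      filter_upwards [hDo.mem_nhds hpD, interior_mem_nhds.2 hD'] with w hwD hwD' hwp hw
      refine ⟨⟨?_, hwD⟩, hwp⟩
      refine closure_mono ((inter_subset_inter_right _ interior_subset).trans hUD) ?_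
      rw [inter_comm]
      exact isOpen_interior.inter_closure ⟨hwD', hw⟩
    have himg : IsPreconnected (range fun w : ((closure K ∩ D) \ {p} : Set (OnePoint ℂ)) =>
        P.point σ τ w (hsub w.2)) := by
      have := isPreconnected_iff_preconnectedSpace.1 hK'
      exact isPreconnected_range ((P.continuous_point σ τ).comp (continuous_inclusion hsub))
    have hrange : (range fun w : ((closure K ∩ D) \ {p} : Set (OnePoint ℂ)) =>
        P.point σ τ w (hsub w.2)) ⊆ C ∪ C' := by
      rintro _ ⟨w, rfl⟩
      have h1 := hD w w.2.1.2
      exact h1.1 w.2.2 _ (point_mem_star hτ h1.2 _) rfl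
    rcases himg.subset_or_subset hC hC' hCC hrange with h | h
    · refine Or.inl (hev.mono fun w hw hw' => h ⟨⟨w, hw hw'⟩, rfl⟩)
    · refine Or.inr (hev.mono fun w hw hw' => h ⟨⟨w, hw hw'⟩, rfl⟩)
  -- Tiles glued along an edge through p share points of that edge arbitrarily close to p, so they
  -- lie on the same side.
  have hadj : ∀ τ ∈ P.tilesAt σ z, ∀ τ' ∈ P.tilesAt σ z, ∀ j, p ∈ P.edge j → Adjacent σ j τ τ' →
      good C τ → good C τ' := by
    intro τ hτ τ' hτ' j hj h hg
    rcases hdich τ' hτ' with h' | h'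
    · exact h'
    · exfalso
      obtain ⟨w, hw, h1, h2⟩ := ((P.edge_frequently j hj).and_eventually (hg.and h')).exists
      have hf := P.edge_subset_frontier j hw
      have h3 := h1 (P.mem_closure_of_mem_frontier hf τ)
      have h4 := h2 (P.mem_closure_of_mem_frontier hf τ')
      rw [point_eq_of_adjacent h hw _ (P.mem_closure_of_mem_frontier hf τ')] at h3
      exact Set.disjoint_left.1 hCC h3 h4
  -- Every member of a gluing chain that starts at a representative of z represents z, so each link
  -- of the chain falls under `hadj`.
  have hchain : ∀ x y : P.TileUnion n, Relation.EqvGen (P.GlueRel σ) x y → P.glue σ x = z →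
      (good C x.1.1 ↔ good C y.1.1) := by
    have htile : ∀ x : P.TileUnion n, P.glue σ x = z → x.1.1 ∈ P.tilesAt σ z := by
      rintro ⟨⟨τ, w⟩, hw⟩ rfl
      exact ⟨hw, rfl⟩
    intro x y h
    induction h with
    | rel x y h =>
      intro hx
      have hy : P.glue σ y = z := by rw [← hx]; exact (Quot.sound h).symm
      obtain ⟨α, j, h1, h2, h3, h4⟩ := h
      have hpj : p ∈ P.edge j := by
        rw [hp, ← hx]
        exact h4
      have hA : Adjacent σ j x.1.1 y.1.1 := ⟨α, Or.inl ⟨h1, h2⟩⟩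
      exact ⟨hadj _ (htile x hx) _ (htile y hy) j hpj hA,
        hadj _ (htile y hy) _ (htile x hx) j hpj hA.symm⟩
    | refl x => exact fun _ => Iff.rfl
    | symm x y h ih =>
      intro hy
      exact (ih ((Quot.eqvGen_sound h).trans hy)).symm
    | trans x y w h h' ih ih' =>
      intro hx
      exact (ih hx).trans (ih' ((Quot.eqvGen_sound h).symm.trans hx))
  have hsome : ∃ τ ∈ P.tilesAt σ z, good C τ := by
    by_contra hno
    push Not at hno
    have h1 : ∀ τ ∈ P.tilesAt σ z, good C' τ := fun τ hτ =>
      (hdich τ hτ).resolve_left (hno τ hτ)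
    obtain ⟨w, ⟨y, hy, hyw, hyC⟩, h2⟩ := (hex.and_eventually
      ((Set.toFinite (P.tilesAt σ z)).eventually_all.2 h1)).exists
    obtain ⟨τ, hτ, h, hy2⟩ := exists_point_of_mem_star hy
    subst hyw
    have h3 := h2 τ hτ h
    rw [hy2] at h3
    exact Set.disjoint_left.1 hCC hyC h3
  obtain ⟨τ₀, ⟨h₀, hτ₀⟩, hg₀⟩ := hsome
  have hall : ∀ τ ∈ P.tilesAt σ z, good C τ := by
    rintro τ ⟨h, hτ⟩
    exact (hchain ⟨(τ₀, p), h₀⟩ ⟨(τ, p), h⟩ (Quot.eqvGen_exact (hτ₀.trans hτ.symm)) hτ₀).1 hg₀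
  filter_upwards [(Set.toFinite (P.tilesAt σ z)).eventually_all.2 hall] with w hw y hy hyw
  obtain ⟨τ, hτ, h, h2⟩ := exists_point_of_mem_star hy
  subst hyw
  rw [← h2]
  exact hw τ hτ h

end EuclideanPolygon

/-! ## Root charts -/

/-- A chart in which `R` becomes a power map onto a centred coordinate of the sphere. -/
def IsRootChart {M : Type*} [TopologicalSpace M] (R : M → OnePoint ℂ)
    (e : OpenPartialHomeomorph M ℂ) : Prop :=
  ∃ (p : OnePoint ℂ) (m : ℕ), m ≠ 0 ∧ ∀ ζ ∈ e.target, R (e.symm ζ) = localParam p (ζ ^ m)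

/-- A half-plane, the universal covering of a punctured disc by the exponential map. -/
abbrev LogDisc (r : ℝ) : Type := {h : ℂ | h.re < Real.log r}

namespace LogDisc

variable {r : ℝ}

instance : ContractibleSpace (LogDisc r) :=
  (convex_halfSpace_re_lt (Real.log r)).contractibleSpace
    ⟨((Real.log r - 1 : ℝ) : ℂ), by simp⟩

instance : LocallyPathConnectedSpace (LogDisc r) :=
  (isOpen_lt Complex.continuous_re continuous_const).locallyPathConnectedSpace

/-- The deck transformations of the exponential map. -/
def shift (k : ℤ) : C(LogDisc r, LogDisc r) where
  toFun h := ⟨h + k * (2 * Real.pi * Complex.I), by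
    have : ((h : ℂ) + k * (2 * Real.pi * Complex.I)).re = (h : ℂ).re := by simp
    rw [mem_ofPred_eq, this]
    exact h.2⟩
  continuous_toFun := by fun_prop

theorem coe_shift (k : ℤ) (h : LogDisc r) :
    (shift k h : ℂ) = h + k * (2 * Real.pi * Complex.I) := rfl

theorem exp_shift (k : ℤ) (h : LogDisc r) : Complex.exp (shift k h) = Complex.exp h := by
  rw [coe_shift, Complex.exp_add, Complex.exp_int_mul_two_pi_mul_I, mul_one]

theorem shift_shift (k l : ℤ) (h : LogDisc r) : shift k (shift l h) = shift (k + l) h := by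
  apply Subtype.ext
  simp only [coe_shift]
  push_cast
  ring

theorem shift_zero (h : LogDisc r) : shift 0 h = h := by
  apply Subtype.ext
  simp [coe_shift]

theorem exists_shift_eq {h h' : LogDisc r} (hh : Complex.exp h' = Complex.exp h) :
    ∃ k : ℤ, h' = shift k h := by
  obtain ⟨k, hk⟩ := Complex.exp_eq_exp_iff_exists_int.1 hh
  exact ⟨k, Subtype.ext hk⟩

theorem norm_exp_lt (hr : 0 < r) (h : LogDisc r) : ‖Complex.exp h‖ < r := by
  rw [Complex.norm_exp]
  exact (Real.lt_log_iff_exp_lt hr).1 h.2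

/-- The map `h ↦ exp h` in the centred coordinate at `p`. -/
def expParam (p : OnePoint ℂ) (r : ℝ) : C(LogDisc r, OnePoint ℂ) where
  toFun h := localParam p (Complex.exp h)
  continuous_toFun := (continuous_localParam p).comp
    (Complex.continuous_exp.comp continuous_subtype_val)

theorem isLocalHomeomorph_expParam (p : OnePoint ℂ) (r : ℝ) :
    IsLocalHomeomorph (expParam p r) := by
  have h1 : IsLocalHomeomorph (Complex.exp) := by
    rw [isLocalHomeomorph_iff_isLocalHomeomorphOn_univ]
    exact Complex.isCoveringMapOn_exp.isLocalHomeomorphOn.mono fun x _ => Complex.exp_ne_zero x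
  have h2 : IsOpen {h : ℂ | h.re < Real.log r} := isOpen_lt Complex.continuous_re continuous_const
  exact (isOpenEmbedding_localParam p).isLocalHomeomorph.comp
    (h1.comp h2.isOpenEmbedding_subtypeVal.isLocalHomeomorph)

end LogDisc

open LogDisc

/-! ### Lifts of the exponential map to a covering. -/

section Lift

variable {M : Type*} [TopologicalSpace M] {R : M → OnePoint ℂ} {V : Set (OnePoint ℂ)}
  {p : OnePoint ℂ} {r : ℝ}

/-- If the lifts meet, the two parameters have the same exponential, so they differ by a deck
transformation. Composing L₂ with it gives another lift that agrees with L₁ at one point, and lifts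
from the half-plane are determined by one value. -/
theorem exists_shift_of_lifts (hR : IsCoveringMapOn R V) (hV : ∀ h : LogDisc r, expParam p r h ∈ V)
    {L₁ L₂ : C(LogDisc r, M)} (h₁ : R ∘ L₁ = expParam p r) (h₂ : R ∘ L₂ = expParam p r)
    {x₁ x₂ : LogDisc r} (h : L₁ x₁ = L₂ x₂) : ∃ k : ℤ, x₂ = shift k x₁ ∧
      ∀ x, L₁ x = L₂ (shift k x) := by
  have h3 : localParam p (Complex.exp x₁) = localParam p (Complex.exp x₂) := by
    have e1 := congrFun h₁ x₁
    have e2 := congrFun h₂ x₂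
    rw [Function.comp_apply, h] at e1
    exact e1.symm.trans e2
  obtain ⟨k, hk⟩ := exists_shift_eq (localParam_injective p h3).symm
  refine ⟨k, hk, fun x => ?_⟩
  have h4 : R (L₁ x₁) = expParam p r x₁ := congrFun h₁ x₁
  have h5 := (hR.existsUnique_continuousMap_lifts (expParam p r) h4 hV).unique
    (y₁ := L₁) (y₂ := L₂.comp (shift k)) ⟨rfl, h₁⟩ ⟨?_, ?_⟩
  · exact congrArg (fun L : C(LogDisc r, M) => L x) h5
  · rw [h, hk]; rfl
  · funext y
    have e2 := congrFun h₂ (shift k y)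
    rw [Function.comp_apply] at e2
    change R (L₂ (shift k y)) = _
    rw [e2]
    change localParam p (Complex.exp (shift k y)) = localParam p (Complex.exp y)
    rw [exp_shift]

/-- Both the covering and its composite with the lift are local homeomorphisms, hence so is the
lift. -/
theorem isOpenMap_lift (hR : IsCoveringMapOn R V) (hV : ∀ h : LogDisc r, expParam p r h ∈ V)
    {L : C(LogDisc r, M)} (hL : R ∘ L = expParam p r) : IsOpenMap L := by
  have h1 : IsLocalHomeomorphOn L univ := by
    refine IsLocalHomeomorphOn.of_comp_left (g := R) ?_ (hR.isLocalHomeomorphOn.mono ?_)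
      fun x _ => L.continuous.continuousAt
    · rw [hL, ← isLocalHomeomorph_iff_isLocalHomeomorphOn_univ]
      exact isLocalHomeomorph_expParam p r
    · rintro _ ⟨x, -, rfl⟩
      have := congrFun hL x
      rw [Function.comp_apply] at this
      rw [mem_preimage, this]
      exact hV x
  exact (isLocalHomeomorph_iff_isLocalHomeomorphOn_univ.2 h1).isOpenMap

/-- The periods of a lift to a covering with finite fibers. -/
theorem exists_period (hR : IsCoveringMapOn R V) (hV : ∀ h : LogDisc r, expParam p r h ∈ V)
    (hfin : ∀ w, (R ⁻¹' {w}).Finite) {L : C(LogDisc r, M)} (hL : R ∘ L = expParam p r) :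
    ∃ m : ℕ, m ≠ 0 ∧ ∀ x y, L x = L y ↔ ∃ l : ℤ, y = shift (m * l) x := by
  -- The deck transformations that preserve L form a subgroup of ℤ; a generator gives the period.
  let H : AddSubgroup ℤ :=
    { carrier := {k | ∀ x, L (shift k x) = L x}
      zero_mem' := fun x => by rw [shift_zero]
      add_mem' := fun {a b} ha hb x => by rw [← shift_shift, ha, hb]
      neg_mem' := fun {a} ha x => by
        rw [← ha (shift (-a) x), shift_shift, add_neg_cancel, shift_zero] }
  obtain ⟨a, ha⟩ := Int.subgroup_cyclic H
  have hmem : ∀ k : ℤ, k ∈ H ↔ a ∣ k := by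
    intro k
    rw [ha, AddSubgroup.mem_closure_singleton]
    constructor
    · rintro ⟨l, rfl⟩
      exact ⟨l, by rw [smul_eq_mul, mul_comm]⟩
    · rintro ⟨l, rfl⟩
      exact ⟨l, by rw [smul_eq_mul, mul_comm]⟩
  have hshift : ∀ x k, L x = L (shift k x) → k ∈ H := by
    intro x k h y
    obtain ⟨l, hl, hl'⟩ := exists_shift_of_lifts hR hV hL hL h
    have : l = k := by
      have h1 := congrArg (Subtype.val) hl
      rw [coe_shift, coe_shift] at h1
      have h2 := mul_right_cancel₀ Complex.two_pi_I_ne_zero (add_left_cancel h1)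
      exact_mod_cast h2.symm
    subst this
    exact (hl' y).symm
  -- Without a nonzero period, the shifts of one parameter would give infinitely many points in a
  -- finite fiber.
  have ha0 : a ≠ 0 := by
    rintro rfl
    obtain ⟨x₀⟩ : Nonempty (LogDisc r) := inferInstance
    have hmaps : ∀ k : ℤ, L (shift k x₀) ∈ R ⁻¹' {expParam p r x₀} := by
      intro k
      have := congrFun hL (shift k x₀)
      rw [Function.comp_apply] at this
      rw [mem_preimage, this]
      change localParam p _ = localParam p _
      rw [exp_shift]
    have hinj : Function.Injective fun k : ℤ => L (shift k x₀) := by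
      intro k l hkl
      have h1 : L (shift k x₀) = L (shift (l - k) (shift k x₀)) := by
        rw [shift_shift, sub_add_cancel]
        exact hkl
      have h2 := zero_dvd_iff.1 ((hmem _).1 (hshift _ _ h1))
      omega
    exact Set.infinite_univ (α := ℤ) ((Set.Finite.preimage hinj.injOn (hfin _)).subset
      fun k _ => hmaps k)
  refine ⟨a.natAbs, Int.natAbs_ne_zero.2 ha0, fun x y => ⟨fun h => ?_, ?_⟩⟩
  · obtain ⟨k, rfl, -⟩ := exists_shift_of_lifts hR hV hL hL h
    obtain ⟨l, rfl⟩ := Int.natAbs_dvd.2 ((hmem k).1 (hshift x k h))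
    exact ⟨l, rfl⟩
  · rintro ⟨l, rfl⟩
    have h1 : (a.natAbs * l : ℤ) ∈ H := (hmem _).2 (Int.dvd_natAbs.2 dvd_rfl |>.mul_right l)
    exact (h1 x).symm

end Lift

namespace EuclideanPolygon

variable {q n : ℕ} (P : EuclideanPolygon q) (σ : ZMod q → Equiv.Perm (Fin n))

/-- Near a boundary point `z`, the star of `z` with the point `z` removed is covered by a half-plane
over the exponential map. -/
theorem exists_lift [NeZero q] {z : P.GluedSurface σ} (hz : P.develop σ z ∈ frontier P.region) :
    ∃ (r s : ℝ) (L : C(LogDisc r, P.GluedSurface σ)), 0 < r ∧ 0 < s ∧ s ≤ r ∧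
      P.develop σ ∘ L = expParam (P.develop σ z) r ∧
      (∀ h : LogDisc r, expParam (P.develop σ z) r h ∈ (range P.vertex)ᶜ) ∧
      (∀ h, L h ∈ P.star σ z) ∧
      ∀ y ∈ P.star σ z, ∀ ζ : ℂ, ‖ζ‖ < s → ζ ≠ 0 → P.develop σ y = localParam (P.develop σ z) ζ →
        y ∈ range L := by
  set p := P.develop σ z with hp
  have hcl := continuous_localParam p
  have hcl0 : Tendsto (localParam p) (𝓝 0) (𝓝 p) := by
    have := hcl.tendsto 0
    rwa [localParam_zero] at this
  -- The radius r is such that the disc about p stays in the star base and contains no vertex except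
  -- possibly p, so the punctured disc lies in the covered part.
  have h1 : ∀ᶠ w in 𝓝 p, w ∈ P.starBase σ z ∧ (w ∈ range P.vertex → w = p) := by
    refine ((P.isOpen_starBase σ z).eventually_mem (P.develop_mem_starBase σ z)).and ?_
    have h2 : IsOpen ((range P.vertex) \ {p})ᶜ :=
      (((finite_range P.vertex).subset sdiff_subset).isClosed).isOpen_compl
    filter_upwards [h2.mem_nhds (fun h => h.2 rfl)] with w hw hv
    by_contra hwp
    exact hw ⟨hv, hwp⟩
  obtain ⟨r, hr, hball⟩ := Metric.eventually_nhds_iff_ball.1 (hcl0.eventually h1)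
  have hball' : ∀ h : LogDisc r, expParam p r h ∈ P.starBase σ z ∧
      expParam p r h ∈ (range P.vertex)ᶜ := by
    intro h
    have h2 := hball _ (mem_ball_zero_iff.2 (norm_exp_lt hr h))
    refine ⟨h2.1, fun hv => Complex.exp_ne_zero h (localParam_injective p ?_)⟩
    rw [localParam_zero]
    exact h2.2 hv
  have hV : ∀ h : LogDisc r, expParam p r h ∈ (range P.vertex)ᶜ := fun h => (hball' h).2
  have hlog : ∀ ζ : ℂ, ζ ≠ 0 → ‖ζ‖ < r → ∃ h : LogDisc r, Complex.exp h = ζ := by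
    intro ζ h0 hζ
    refine ⟨⟨Complex.log ζ, ?_⟩, Complex.exp_log h0⟩
    rw [mem_ofPred_eq, Complex.log_re]
    exact Real.log_lt_log (norm_pos_iff.2 h0) hζ
  obtain ⟨x₀, y₀, hy₀, hxy⟩ : ∃ (x₀ : LogDisc r) (y₀ : P.GluedSurface σ), y₀ ∈ P.star σ z ∧
      P.develop σ y₀ = expParam p r x₀ := by
    obtain ⟨τ, hτ⟩ := P.nonempty_tilesAt z
    have h2 : localParam p '' Metric.ball 0 r ∈ 𝓝 p := by
      refine ((isOpenEmbedding_localParam p).isOpenMap _ Metric.isOpen_ball).mem_nhds ?_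
      exact ⟨0, Metric.mem_ball_self hr, localParam_zero p⟩
    obtain ⟨w, ⟨ζ, hζ, rfl⟩, hw⟩ := mem_closure_iff_nhds.1
      (P.mem_closure_of_mem_frontier hz τ) _ h2
    have hζ0 : ζ ≠ 0 := by
      rintro rfl
      rw [localParam_zero] at hw
      exact P.openTile_disjoint_frontier τ hw hz
    obtain ⟨x, rfl⟩ := hlog ζ hζ0 (mem_ball_zero_iff.1 hζ)
    exact ⟨x, P.point σ τ _ (subset_closure hw), point_mem_star hτ (hball' x).1 _, rfl⟩
  have hcov := P.isCoveringMapOn_develop σ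
  obtain ⟨L, ⟨hL0, hL⟩, -⟩ := hcov.existsUnique_continuousMap_lifts (expParam p r) hxy hV
  have hLR : ∀ h, P.develop σ (L h) = localParam p (Complex.exp h) := fun h => congrFun hL h
  -- The range is connected, lies over the star base and meets the star at y₀.
  have hLstar : range L ⊆ P.star σ z := by
    refine (isPreconnected_range L.continuous).subset_left_of_subset_union (P.isOpen_star σ z)
      (P.isOpen_preimage_diff_star σ z) disjoint_sdiff_right ?_ ⟨y₀, ⟨x₀, hL0⟩, hy₀⟩
    rintro _ ⟨h, rfl⟩
    by_cases hs : L h ∈ P.star σ z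
    · exact Or.inl hs
    · refine Or.inr ⟨?_, hs⟩
      rw [mem_preimage, hLR]
      exact (hball' h).1
  have hC : IsOpen (range L) := (isOpenMap_lift hcov hV hL).isOpen_range
  -- Through a point off the range of L passes another lift; its range is open and disjoint from
  -- that of L, since lifts that meet have the same range.
  have hC' : IsOpen ((P.develop σ ⁻¹' range (expParam p r)) \ range L) := by
    rw [isOpen_iff_mem_nhds]
    rintro y ⟨⟨x, hx⟩, hy⟩
    obtain ⟨L', ⟨hL'0, hL'⟩, -⟩ := hcov.existsUnique_continuousMap_lifts (expParam p r) hx.symm hV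
    refine mem_of_superset ((isOpenMap_lift hcov hV hL').isOpen_range.mem_nhds ⟨x, hL'0⟩) ?_
    rintro _ ⟨x', rfl⟩
    refine ⟨⟨x', (congrFun hL' x').symm⟩, ?_⟩
    rintro ⟨x'', hx''⟩
    obtain ⟨k, -, hk⟩ := exists_shift_of_lifts hcov hV hL' hL hx''.symm
    exact hy ⟨shift k x, by rw [← hk, hL'0]⟩
  have hparam : ∀ᶠ w in 𝓝[≠] p, ∃ x : LogDisc r, expParam p r x = w := by
    rw [eventually_nhdsWithin_iff]
    filter_upwards [((isOpenEmbedding_localParam p).isOpenMap _ Metric.isOpen_ball).mem_nhds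
      (⟨0, Metric.mem_ball_self hr, localParam_zero p⟩ : p ∈ localParam p '' Metric.ball 0 r)]
      with w hw hwp
    obtain ⟨ζ, hζ, rfl⟩ := hw
    have hζ0 : ζ ≠ 0 := by
      rintro rfl
      exact hwp (localParam_zero p)
    obtain ⟨x, rfl⟩ := hlog ζ hζ0 (mem_ball_zero_iff.1 hζ)
    exact ⟨x, rfl⟩
  -- The punctured star is connected near z, so the clopen range of L contains all of it over a
  -- smaller disc.
  have hfinal := P.eventually_star_subset_of_clopen σ hz hC hC' disjoint_sdiff_right
    (hparam.mono fun w hw y _ hyw => by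
      by_cases hyL : y ∈ range L
      · exact Or.inl hyL
      · refine Or.inr ⟨?_, hyL⟩
        rw [mem_preimage, hyw]
        exact hw)
    (hparam.mono fun w ⟨x, hx⟩ => ⟨L x, hLstar ⟨x, rfl⟩, (hLR x).trans hx, x, rfl⟩).frequently
  obtain ⟨s, hs, hsball⟩ := Metric.eventually_nhds_iff_ball.1
    (hcl0.eventually (eventually_nhdsWithin_iff.1 hfinal))
  refine ⟨r, min s r, L, hr, lt_min hs hr, min_le_right _ _, hL, hV, fun h => hLstar ⟨h, rfl⟩, ?_⟩
  intro y hy ζ hζ hζ0 hyζ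
  refine hsball ζ (mem_ball_zero_iff.2 (hζ.trans_le (min_le_left _ _))) ?_ y hy hyζ
  intro h
  exact hζ0 (localParam_injective p (h.trans (localParam_zero p).symm))

end EuclideanPolygon

open LogDisc

/-! ## The complex structure -/

/-- An injective map that is continuous and open on an open set is the inverse of a chart. -/
theorem exists_openPartialHomeomorph {X Y : Type*} [TopologicalSpace X] [TopologicalSpace Y]
    [Nonempty X] {f : X → Y} {s : Set X} (hs : IsOpen s) (hi : InjOn f s) (hc : ContinuousOn f s)
    (ho : ∀ x ∈ s, ∀ V ∈ 𝓝 x, f '' (V ∩ s) ∈ 𝓝 (f x)) :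
    ∃ e : OpenPartialHomeomorph Y X, e.source = f '' s ∧ e.target = s ∧ ∀ x, e.symm x = f x := by
  refine ⟨(OpenPartialHomeomorph.ofContinuousOpenRestrict (hi.toPartialEquiv f s) hc ?_ hs).symm,
    rfl, rfl, fun _ => rfl⟩
  intro V hV
  rw [isOpen_iff_mem_nhds]
  rintro _ ⟨x, hx, rfl⟩
  obtain ⟨W, hW, rfl⟩ := isOpen_induced_iff.1 hV
  refine mem_of_superset (ho x x.2 W (hW.mem_nhds hx)) ?_
  rintro _ ⟨y, hy, rfl⟩
  exact ⟨⟨y, hy.2⟩, hy.1, rfl⟩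

namespace EuclideanPolygon

variable {q n : ℕ} (P : EuclideanPolygon q) (σ : ZMod q → Equiv.Perm (Fin n))

/-- If the lift L has period m, it descends along h ↦ exp (h / m) to an injective map Φ ζ = L (m log
ζ) on a punctured disc. With Φ 0 = z, this is the inverse of a chart in which `develop` is ζ ↦ ζ ^
m. -/
theorem exists_isRootChart_of_mem_frontier [NeZero q] {z : P.GluedSurface σ}
    (hz : P.develop σ z ∈ frontier P.region) :
    ∃ e : OpenPartialHomeomorph (P.GluedSurface σ) ℂ, z ∈ e.source ∧
      IsRootChart (P.develop σ) e := by
  obtain ⟨r, s, L, hr, hs, hsr, hL, hV, hstar, hsurj⟩ := P.exists_lift σ hz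
  set p := P.develop σ z with hp
  have hcov := P.isCoveringMapOn_develop σ
  obtain ⟨m, hm, hper⟩ := exists_period hcov hV (P.finite_fiber σ) hL
  have hLR : ∀ h, P.develop σ (L h) = localParam p (Complex.exp h) := fun h => congrFun hL h
  have hm' : (m : ℂ) ≠ 0 := Nat.cast_ne_zero.2 hm
  have hmem : ∀ ζ : ℂ, ζ ≠ 0 → ‖ζ‖ ^ m < r → (m * Complex.log ζ : ℂ).re < Real.log r := by
    intro ζ h0 hζ
    have h1 : (m * Complex.log ζ : ℂ).re = m * Real.log ‖ζ‖ := by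
      rw [← Complex.log_re]
      simp
    rw [h1, ← Real.log_pow]
    exact Real.log_lt_log (pow_pos (norm_pos_iff.2 h0) m) hζ
  classical
  -- The default value z is the actual value at the puncture ζ = 0; the other default cases lie
  -- outside the disc used later.
  let Φ : ℂ → P.GluedSurface σ := fun ζ =>
    if h : (m * Complex.log ζ : ℂ).re < Real.log r ∧ ζ ≠ 0 then L ⟨m * Complex.log ζ, h.1⟩ else z
  have hΦ0 : Φ 0 = z := dif_neg fun h => h.2 rfl
  have hΦ : ∀ ζ : ℂ, ζ ≠ 0 → ‖ζ‖ ^ m < r →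
      ∃ x : LogDisc r, Φ ζ = L x ∧ (x : ℂ) = m * Complex.log ζ := fun ζ h0 hζ =>
    ⟨⟨_, hmem ζ h0 hζ⟩, dif_pos ⟨hmem ζ h0 hζ, h0⟩, rfl⟩
  have hexp : ∀ ζ : ℂ, ζ ≠ 0 → Complex.exp (m * Complex.log ζ) = ζ ^ m := by
    intro ζ h0
    rw [Complex.exp_nat_mul, Complex.exp_log h0]
  have hΦR : ∀ ζ : ℂ, ‖ζ‖ ^ m < r → P.develop σ (Φ ζ) = localParam p (ζ ^ m) := by
    intro ζ hζ
    by_cases h0 : ζ = 0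
    · rw [h0, hΦ0, zero_pow hm, localParam_zero]
    · obtain ⟨x, hx, hx'⟩ := hΦ ζ h0 hζ
      rw [hx, hLR, hx', hexp ζ h0]
  have hΦstar : ∀ ζ, Φ ζ ∈ P.star σ z := by
    intro ζ
    by_cases h : (m * Complex.log ζ : ℂ).re < Real.log r ∧ ζ ≠ 0
    · simp only [Φ, dif_pos h]
      exact hstar _
    · simp only [Φ, dif_neg h]
      exact P.mem_star_self σ z
  have hΦL : ∀ x : LogDisc r, Φ (Complex.exp (x / m)) = L x := by
    intro x
    have h1 : Complex.exp (x / m) ^ m = Complex.exp x := by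
      rw [← Complex.exp_nat_mul, mul_div_cancel₀ _ hm']
    have h2 : ‖Complex.exp (x / m)‖ ^ m < r := by
      rw [← norm_pow, h1]
      exact norm_exp_lt hr x
    obtain ⟨y, hy, hy'⟩ := hΦ _ (Complex.exp_ne_zero _) h2
    rw [hy, eq_comm, hper]
    -- The principal logarithm of exp (x / m) differs from x / m by 2πik; after multiplication by m
    -- this is a period of L, so the choice of branch does not matter.
    obtain ⟨k, hk⟩ := Complex.exp_eq_exp_iff_exists_int.1
      (Complex.exp_log (Complex.exp_ne_zero ((x : ℂ) / m)))
    refine ⟨k, Subtype.ext ?_⟩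
    rw [hy', hk, coe_shift]
    push_cast
    field_simp
  -- The bound 1 gives ‖ζ‖ ^ m ≤ ‖ζ‖, so that ‖ζ‖ < s suffices for ‖ζ‖ ^ m < s.
  set ρ := min s 1 with hρ
  have hρ0 : 0 < ρ := lt_min hs one_pos
  have hpow : ∀ ζ ∈ Metric.ball (0 : ℂ) ρ, ‖ζ‖ ^ m < s := by
    intro ζ hζ
    rw [mem_ball_zero_iff] at hζ
    calc ‖ζ‖ ^ m ≤ ‖ζ‖ := pow_le_of_le_one (norm_nonneg _) (hζ.le.trans (min_le_right _ _)) hm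
      _ < s := hζ.trans_le (min_le_left _ _)
  have hpowr : ∀ ζ ∈ Metric.ball (0 : ℂ) ρ, ‖ζ‖ ^ m < r := fun ζ hζ => (hpow ζ hζ).trans_le hsr
  have hinj : InjOn Φ (Metric.ball 0 ρ) := by
    intro ζ hζ ζ' hζ' h
    have h1 := congrArg (P.develop σ) h
    rw [hΦR _ (hpowr _ hζ), hΦR _ (hpowr _ hζ')] at h1
    have h2 := localParam_injective p h1
    by_cases h0 : ζ = 0
    · rw [h0, zero_pow hm] at h2
      rw [h0, pow_eq_zero_iff hm |>.1 h2.symm]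
    · have h0' : ζ' ≠ 0 := by
        rintro rfl
        rw [zero_pow hm] at h2
        exact h0 (pow_eq_zero_iff hm |>.1 h2)
      obtain ⟨x, hx, hx'⟩ := hΦ ζ h0 (hpowr _ hζ)
      obtain ⟨y, hy, hy'⟩ := hΦ ζ' h0' (hpowr _ hζ')
      rw [hx, hy, hper] at h
      obtain ⟨l, hl⟩ := h
      have h3 := congrArg Subtype.val hl
      rw [coe_shift, hx', hy'] at h3
      rw [← Complex.exp_log h0, ← Complex.exp_log h0', eq_comm, Complex.exp_eq_exp_iff_exists_int]
      refine ⟨l, mul_left_cancel₀ hm' ?_⟩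
      rw [h3]
      push_cast
      ring
  have hcont : ContinuousOn Φ (Metric.ball 0 ρ) := by
    intro ζ hζ
    refine ContinuousAt.continuousWithinAt ?_
    by_cases h0 : ζ = 0
    · subst h0
      rw [ContinuousAt, hΦ0]
      intro O hO
      have h1 : Tendsto (fun ζ : ℂ => localParam p (ζ ^ m)) (𝓝 0) (𝓝 p) := by
        have h2 := ((continuous_localParam p).comp (continuous_pow m)).tendsto (0 : ℂ)
        simpa only [Function.comp_def, zero_pow hm, localParam_zero] using h2
      rw [mem_map]
      filter_upwards [h1.eventually (P.eventually_star_subset σ z hO),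
        Metric.ball_mem_nhds (0 : ℂ) hρ0] with ζ h2 hζ
      exact h2 _ (hΦstar ζ) (hΦR ζ (hpowr ζ hζ))
    -- A branch of m log continuous at ζ even on the cut of the principal logarithm; by `hΦL` it
    -- computes the same Φ.
    · let ℓ : ℂ → ℂ := fun x => m * (Complex.log (x / ζ) + Complex.log ζ)
      have hℓc : ContinuousAt ℓ ζ := by
        refine continuousAt_const.mul (ContinuousAt.add ?_ continuousAt_const)
        refine ContinuousAt.clog (continuousAt_id.div_const ζ) ?_
        rw [div_self h0]
        exact Complex.one_mem_slitPlane
      have hℓ0 : ℓ ζ = m * Complex.log ζ := by simp [ℓ, div_self h0]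
      have hev : ∀ᶠ x in 𝓝 ζ, (ℓ x).re < Real.log r ∧ x ≠ 0 := by
        refine Filter.Eventually.and ?_ (isOpen_ne.eventually_mem h0)
        have h1 : ContinuousAt (fun x => (ℓ x).re) ζ := Complex.continuous_re.continuousAt.comp hℓc
        refine h1.eventually_lt continuousAt_const ?_
        rw [hℓ0]
        exact hmem ζ h0 (hpowr ζ hζ)
      let ℓ' : {x : ℂ // (ℓ x).re < Real.log r} → LogDisc r := fun x => ⟨ℓ x, x.2⟩
      have hΦℓ : ∀ x : ℂ, ∀ h : (ℓ x).re < Real.log r, x ≠ 0 → Φ x = L ⟨ℓ x, h⟩ := by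
        intro x h hx
        rw [← hΦL]
        congr 1
        simp only [ℓ]
        rw [mul_div_cancel_left₀ _ hm', Complex.exp_add, Complex.exp_log (div_ne_zero hx h0),
          Complex.exp_log h0, div_mul_cancel₀ _ h0]
      intro O hO
      rw [hΦℓ ζ hev.self_of_nhds.1 h0] at hO
      have h2 := L.continuous.continuousAt.preimage_mem_nhds hO
      rw [mem_nhds_subtype_iff_nhdsWithin, mem_nhdsWithin_iff_eventually] at h2
      rw [mem_map]
      filter_upwards [hℓc.eventually h2, hev] with x hx hx'
      obtain ⟨y, hy, hyx⟩ := hx hx'.1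
      rw [mem_preimage, hΦℓ x hx'.1 hx'.2]
      have : y = ⟨ℓ x, hx'.1⟩ := Subtype.ext hyx
      rwa [this] at hy
  have hopen : ∀ ζ ∈ Metric.ball (0 : ℂ) ρ, ∀ V ∈ 𝓝 ζ,
      Φ '' (V ∩ Metric.ball 0 ρ) ∈ 𝓝 (Φ ζ) := by
    intro ζ hζ W hW
    by_cases h0 : ζ = 0
    · subst h0
      obtain ⟨δ, hδ, hδW⟩ := Metric.mem_nhds_iff.1 (inter_mem hW (Metric.ball_mem_nhds _ hρ0))
      rw [hΦ0]
      have h1 : localParam p '' Metric.ball 0 (min s (δ ^ m)) ∈ 𝓝 p := by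
        refine ((isOpenEmbedding_localParam p).isOpenMap _ Metric.isOpen_ball).mem_nhds ?_
        exact ⟨0, Metric.mem_ball_self (lt_min hs (pow_pos hδ m)), localParam_zero p⟩
      filter_upwards [(P.isOpen_star σ z).mem_nhds (P.mem_star_self σ z),
        (P.continuous_develop σ).continuousAt.preimage_mem_nhds h1] with y hy hy'
      obtain ⟨η, hη, hyη⟩ := hy'
      rw [mem_ball_zero_iff] at hη
      by_cases hη0 : η = 0
      · rw [hη0, localParam_zero] at hyη
        exact ⟨0, hδW (Metric.mem_ball_self hδ), hΦ0.trans (eq_of_mem_star hy hyη.symm).symm⟩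
      -- A point of the star over a small η ≠ 0 lies on the lift, so it is the value of Φ at exp (x
      -- / m), whose m-th power is η.
      · obtain ⟨x, rfl⟩ := hsurj y hy η (hη.trans_le (min_le_left _ _)) hη0 hyη.symm
        rw [hLR] at hyη
        have h2 := localParam_injective p hyη
        refine ⟨Complex.exp (x / m), hδW ?_, hΦL x⟩
        rw [mem_ball_zero_iff]
        refine lt_of_pow_lt_pow_left₀ m hδ.le ?_
        rw [← norm_pow, ← Complex.exp_nat_mul, mul_div_cancel₀ _ hm', ← h2]
        exact hη.trans_le (min_le_right _ _)
    · obtain ⟨x, hx, hx'⟩ := hΦ ζ h0 (hpowr _ hζ)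
      have h1 : Continuous fun y : LogDisc r => Complex.exp (y / m) := by fun_prop
      have h2 : Complex.exp (x / m) = ζ := by
        rw [hx', mul_div_cancel_left₀ _ hm', Complex.exp_log h0]
      have h3 : (fun y : LogDisc r => Complex.exp (y / m)) ⁻¹' (W ∩ Metric.ball 0 ρ) ∈ 𝓝 x := by
        refine h1.continuousAt.preimage_mem_nhds ?_
        rw [h2]
        exact inter_mem hW (Metric.isOpen_ball.mem_nhds hζ)
      rw [hx]
      refine mem_of_superset ((isOpenMap_lift hcov hV hL).image_mem_nhds h3) ?_
      rintro _ ⟨y, hy, rfl⟩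
      exact ⟨_, hy, hΦL y⟩
  obtain ⟨e, he, het, hes⟩ := exists_openPartialHomeomorph Metric.isOpen_ball hinj hcont hopen
  refine ⟨e, ?_, p, m, hm, fun ζ hζ => ?_⟩
  · rw [he]
    exact ⟨0, Metric.mem_ball_self hρ0, hΦ0⟩
  · rw [hes]
    rw [het] at hζ
    exact hΦR ζ (hpowr ζ hζ)

/-- Sheets are open maps. -/
theorem sheet_image_mem_nhds [NeZero q] (α : Fin n) {j : ZMod q} {w : OnePoint ℂ}
    (hw : w ∈ P.sheetDomain j) {V : Set (OnePoint ℂ)} (hV : V ∈ 𝓝 w) :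
    P.sheet σ α j '' (V ∩ P.sheetDomain j) ∈ 𝓝 (P.sheet σ α j w) := by
  have h1 : P.develop σ ⁻¹' V ∈ 𝓝 (P.sheet σ α j w) := by
    refine (P.continuous_develop σ).continuousAt.preimage_mem_nhds ?_
    rwa [develop_sheet]
  filter_upwards [h1, (P.isOpen_sheet_image σ α j).mem_nhds ⟨w, hw, rfl⟩] with y hy hy'
  obtain ⟨w', hw', rfl⟩ := hy'
  rw [mem_preimage, develop_sheet] at hy
  exact ⟨w', ⟨hy, hw'⟩, rfl⟩

theorem exists_isRootChart [NeZero q] (z : P.GluedSurface σ) :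
    ∃ e : OpenPartialHomeomorph (P.GluedSurface σ) ℂ, z ∈ e.source ∧
      IsRootChart (P.develop σ) e := by
  by_cases hz : P.develop σ z ∈ frontier P.region
  · exact P.exists_isRootChart_of_mem_frontier σ hz
  -- Off the boundary every sheet domain contains the point, so index 0 is as good as any; the sheet
  -- gives a chart with m = 1.
  have hd : P.develop σ z ∈ P.sheetDomain 0 := Or.inl hz
  obtain ⟨α, hα⟩ := P.exists_sheet_eq σ hd
  set p := P.develop σ z
  have hemb := isOpenEmbedding_localParam p
  have hO := (P.isOpen_sheetDomain 0).preimage hemb.continuous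
  obtain ⟨e, he, het, hes⟩ := exists_openPartialHomeomorph
    (f := fun ζ => P.sheet σ α 0 (localParam p ζ)) hO
    ((Function.LeftInverse.injective (P.develop_sheet σ α 0)).comp (localParam_injective p)).injOn
    ((P.continuousOn_sheet σ α 0).comp hemb.continuous.continuousOn fun ζ hζ => hζ) (by
      intro ζ hζ V hV
      refine mem_of_superset (P.sheet_image_mem_nhds σ α hζ (hemb.isOpenMap.image_mem_nhds hV)) ?_
      rintro _ ⟨_, ⟨⟨x, hx, rfl⟩, hx'⟩, rfl⟩
      exact ⟨x, ⟨hx, hx'⟩, rfl⟩)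
  refine ⟨e, ?_, p, 1, one_ne_zero, fun ζ hζ => ?_⟩
  · rw [he]
    refine ⟨0, ?_, ?_⟩
    · rwa [mem_preimage, localParam_zero]
    · simp only [localParam_zero]
      exact hα
  · rw [hes, develop_sheet, pow_one]

end EuclideanPolygon

/-! ### Transition maps between root charts. -/

section RootCharts

variable {M : Type*} [TopologicalSpace M] {R : M → OnePoint ℂ}

/-- A continuous injective map into `M` over a holomorphic map to the sphere is holomorphic in every
root chart. -/
theorem IsRootChart.differentiableOn {e : OpenPartialHomeomorph M ℂ} (he : IsRootChart R e)
    {Ω : Set ℂ} (hΩ : IsOpen Ω) {f : ℂ → M} (hf : ContinuousOn f Ω) (hi : InjOn f Ω)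
    (hm : MapsTo f Ω e.source) (hR : MDifferentiableOn 𝓘(ℂ) 𝓘(ℂ) (R ∘ f) Ω) :
    DifferentiableOn ℂ (e ∘ f) Ω := by
  obtain ⟨p, m, hm0, h⟩ := he
  have h1 : ∀ ζ ∈ Ω, R (f ζ) = localParam p ((e ∘ f) ζ ^ m) := by
    intro ζ hζ
    have h2 := h _ (e.map_source (hm hζ))
    rw [e.left_inv (hm hζ)] at h2
    exact h2
  refine differentiableOn_of_pow hΩ (e.continuousOn.comp hf hm)
    (e.injOn.comp hi hm) hm0 ?_
  intro ζ hζ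
  have h3 : R (f ζ) ∈ (chartAt ℂ p).source := by
    rw [h1 ζ hζ]
    exact localParam_mem_source p _
  have h4 : MDifferentiableAt 𝓘(ℂ) 𝓘(ℂ) (fun ζ => localCoord p ((R ∘ f) ζ)) ζ :=
    (mdifferentiableAt_localCoord h3).comp ζ (hR.mdifferentiableAt (hΩ.mem_nhds hζ))
  refine (mdifferentiableAt_iff_differentiableAt.1 h4).differentiableWithinAt.congr ?_ ?_
  · intro x hx
    rw [Function.comp_apply (f := R), h1 x hx, localCoord_localParam]
  · rw [Function.comp_apply (f := R), h1 ζ hζ, localCoord_localParam]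

/-- The inverse of a root chart is continuous, injective and lies over a power map, so the previous
theorem makes it holomorphic in any other root chart. -/
theorem IsRootChart.contDiffOn {e e' : OpenPartialHomeomorph M ℂ} (he : IsRootChart R e)
    (he' : IsRootChart R e') : ContDiffOn ℂ ω (e.symm.trans e') (e.symm.trans e').source := by
  refine DifferentiableOn.contDiffOn ?_ (e.symm.trans e').open_source
  have hsub : (e.symm.trans e').source ⊆ e.target := fun x hx => by
    rw [OpenPartialHomeomorph.trans_source] at hx
    exact hx.1
  refine he'.differentiableOn (e.symm.trans e').open_source (e.symm.continuousOn.mono hsub)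
    (e.symm.injOn.mono hsub) (fun x hx => ?_) ?_
  · rw [OpenPartialHomeomorph.trans_source] at hx
    exact hx.2
  · obtain ⟨p, m, -, h⟩ := he
    have h1 : MDifferentiable 𝓘(ℂ) 𝓘(ℂ) (fun ζ : ℂ => localParam p (ζ ^ m)) :=
      (mdifferentiable_localParam p).comp (differentiable_pow m).mdifferentiable
    exact h1.mdifferentiableOn.congr fun ζ hζ => h ζ (hsub hζ)

end RootCharts

/-! ### The atlas of root charts. -/

namespace EuclideanPolygon

variable {q n : ℕ} (P : EuclideanPolygon q) (σ : ZMod q → Equiv.Perm (Fin n))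

/-- The complex atlas on the glued surface consisting of all root charts. -/
abbrev rootChartedSpace [NeZero q] : ChartedSpace ℂ (P.GluedSurface σ) where
  atlas := {e | IsRootChart (P.develop σ) e}
  chartAt z := (P.exists_isRootChart σ z).choose
  mem_chart_source z := (P.exists_isRootChart σ z).choose_spec.1
  chart_mem_atlas z := (P.exists_isRootChart σ z).choose_spec.2

/-- A sheet is a continuous injective section of `develop`, and its composite with `develop` is the
identity, which is holomorphic; so `IsRootChart.differentiableOn` applies to it. -/
theorem exists_isFlatStructure [NeZero q] : ∃ _ : ChartedSpace ℂ (P.GluedSurface σ),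
    IsManifold 𝓘(ℂ) ω (P.GluedSurface σ) ∧ P.IsFlatStructure σ := by
  let _ := P.rootChartedSpace σ
  have hM : IsManifold 𝓘(ℂ) ω (P.GluedSurface σ) := by
    refine isManifold_of_contDiffOn 𝓘(ℂ) ω _ fun e e' he he' => ?_
    refine (IsRootChart.contDiffOn (R := P.develop σ) he he').congr_mono (fun x _ => rfl) ?_
    simp
  refine ⟨P.rootChartedSpace σ, hM, fun α j => ?_⟩
  intro w hw
  refine MDifferentiableAt.mdifferentiableWithinAt ?_
  set z := P.sheet σ α j w with hz
  have hcs := P.continuousOn_sheet σ α j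
  have hO := P.isOpen_sheetDomain j
  have hΩ : IsOpen (localParam w ⁻¹' (P.sheetDomain j ∩ P.sheet σ α j ⁻¹' (chartAt ℂ z).source)) :=
    (hcs.isOpen_inter_preimage hO (chartAt ℂ z).open_source).preimage (continuous_localParam w)
  have h0 : (0 : ℂ) ∈
      localParam w ⁻¹' (P.sheetDomain j ∩ P.sheet σ α j ⁻¹' (chartAt ℂ z).source) := by
    rw [mem_preimage, localParam_zero]
    exact ⟨hw, mem_chart_source ℂ z⟩
  have h1 := IsRootChart.differentiableOn (R := P.develop σ) (e := chartAt ℂ z)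
    (P.exists_isRootChart σ z).choose_spec.2 hΩ (f := fun ζ => P.sheet σ α j (localParam w ζ))
    (hcs.comp (continuous_localParam w).continuousOn fun ζ hζ => hζ.1)
    ((P.injOn_sheet σ α j univ).comp (localParam_injective w).injOn (mapsTo_univ _ _))
    (fun ζ hζ => hζ.2) (by
      have h2 : P.develop σ ∘ (fun ζ => P.sheet σ α j (localParam w ζ)) = localParam w :=
        funext fun ζ => P.develop_sheet σ α j _
      rw [h2]
      exact (mdifferentiable_localParam w).mdifferentiableOn)
  have h2 : DifferentiableAt ℂ (chartAt ℂ z ∘ fun ζ => P.sheet σ α j (localParam w ζ))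
      (localCoord w w) := by
    rw [localCoord_self]
    exact h1.differentiableAt (hΩ.mem_nhds h0)
  have h3 : MDifferentiableAt 𝓘(ℂ) 𝓘(ℂ)
      (fun x => (chartAt ℂ z).symm ((chartAt ℂ z ∘ fun ζ => P.sheet σ α j (localParam w ζ))
        (localCoord w x))) w := by
    refine MDifferentiableAt.comp w (I' := 𝓘(ℂ)) (g := (chartAt ℂ z).symm) ?_
      (h2.mdifferentiableAt.comp w (mdifferentiableAt_localCoord (mem_chart_source ℂ w)))
    refine mdifferentiableAt_atlas_symm (chart_mem_atlas ℂ z) ?_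
    simp only [Function.comp_apply, localParam_localCoord (mem_chart_source ℂ w)]
    exact (chartAt ℂ z).map_source (mem_chart_source ℂ z)
  refine h3.congr_of_eventuallyEq ?_
  filter_upwards [(chartAt ℂ w).open_source.mem_nhds (mem_chart_source ℂ w),
    (hcs.isOpen_inter_preimage hO (chartAt ℂ z).open_source).mem_nhds
      ⟨hw, mem_chart_source ℂ z⟩] with x hx hx'
  simp only [Function.comp_apply, localParam_localCoord hx]
  exact ((chartAt ℂ z).left_inv hx'.2).symm

end EuclideanPolygon

/-! ## Local expressions of maps to the sphere -/

section LocalExpr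

variable {M : Type*} [TopologicalSpace M] [ChartedSpace ℂ M]

/-- The expression of `R` in the preferred charts at `z` and `R z`, the latter being centred. -/
def localExpr (R : M → OnePoint ℂ) (z : M) (ζ : ℂ) : ℂ :=
  localCoord (R z) (R ((chartAt ℂ z).symm ζ))

theorem multiplicityAt_eq (R : M → OnePoint ℂ) (z : M) :
    multiplicityAt R z = analyticOrderAt (localExpr R z) (chartAt ℂ z z) := rfl

theorem localExpr_self (R : M → OnePoint ℂ) (z : M) : localExpr R z (chartAt ℂ z z) = 0 := by
  rw [localExpr, OpenPartialHomeomorph.left_inv _ (mem_chart_source ℂ z), localCoord_self]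

variable {R : M → OnePoint ℂ} {z : M}

theorem eventually_mem_source_of_continuousAt (hR : ContinuousAt R z) :
    ∀ᶠ y in 𝓝 z, y ∈ (chartAt ℂ z).source ∧ R y ∈ (chartAt ℂ (R z)).source :=
  ((chartAt ℂ z).open_source.eventually_mem (mem_chart_source ℂ z)).and
    (hR.eventually ((chartAt ℂ (R z)).open_source.eventually_mem (mem_chart_source ℂ (R z))))

theorem tendsto_chartAt_symm (z : M) : Tendsto (chartAt ℂ z).symm (𝓝 (chartAt ℂ z z)) (𝓝 z) := by
  have h := (chartAt ℂ z).continuousAt_symm (mem_chart_target ℂ z)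
  rwa [ContinuousAt, OpenPartialHomeomorph.left_inv _ (mem_chart_source ℂ z)] at h

theorem eventually_chartAt_symm {p : M → Prop} (h : ∀ᶠ y in 𝓝 z, p y) :
    ∀ᶠ ζ in 𝓝 (chartAt ℂ z z), ζ ∈ (chartAt ℂ z).target ∧ p ((chartAt ℂ z).symm ζ) :=
  ((chartAt ℂ z).open_target.eventually_mem (mem_chart_target ℂ z)).and
    ((tendsto_chartAt_symm z).eventually h)

theorem eventually_chartAt_symm_ne {p : M → Prop} (h : ∀ᶠ y in 𝓝[≠] z, p y) :
    ∀ᶠ ζ in 𝓝[≠] (chartAt ℂ z z), ζ ∈ (chartAt ℂ z).target ∧ p ((chartAt ℂ z).symm ζ) := by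
  rw [eventually_nhdsWithin_iff] at h ⊢
  filter_upwards [eventually_chartAt_symm h] with ζ hζ hne
  refine ⟨hζ.1, hζ.2 fun h => hne ?_⟩
  rw [mem_singleton_iff] at h
  rw [mem_singleton_iff, ← OpenPartialHomeomorph.right_inv _ hζ.1, h]

theorem eq_localParam_localExpr {y : M} (hy : y ∈ (chartAt ℂ z).source)
    (hs : R y ∈ (chartAt ℂ (R z)).source) :
    R y = localParam (R z) (localExpr R z (chartAt ℂ z y)) := by
  rw [localExpr, OpenPartialHomeomorph.left_inv _ hy, localParam_localCoord hs]

theorem continuousAt_localExpr {ζ : ℂ} (hζ : ζ ∈ (chartAt ℂ z).target)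
    (hs : R ((chartAt ℂ z).symm ζ) ∈ (chartAt ℂ (R z)).source)
    (hR : ContinuousAt R ((chartAt ℂ z).symm ζ)) : ContinuousAt (localExpr R z) ζ := by
  have h1 : ContinuousAt (fun x => R ((chartAt ℂ z).symm x)) ζ :=
    ContinuousAt.comp (g := R) hR ((chartAt ℂ z).continuousAt_symm hζ)
  exact ContinuousAt.comp (g := localCoord (R z)) (mdifferentiableAt_localCoord hs).continuousAt h1

variable [IsManifold 𝓘(ℂ) ω M]

theorem MDifferentiableAt.differentiableAt_localExpr {ζ : ℂ} (hζ : ζ ∈ (chartAt ℂ z).target)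
    (hs : R ((chartAt ℂ z).symm ζ) ∈ (chartAt ℂ (R z)).source)
    (hR : MDifferentiableAt 𝓘(ℂ) 𝓘(ℂ) R ((chartAt ℂ z).symm ζ)) :
    DifferentiableAt ℂ (localExpr R z) ζ := by
  refine mdifferentiableAt_iff_differentiableAt.1 ?_
  exact (mdifferentiableAt_localCoord hs).comp ζ
    (hR.comp ζ (mdifferentiableAt_atlas_symm (chart_mem_atlas ℂ z) hζ))

theorem mdifferentiableAt_of_localExpr (hR : ContinuousAt R z)
    (hd : DifferentiableAt ℂ (localExpr R z) (chartAt ℂ z z)) :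
    MDifferentiableAt 𝓘(ℂ) 𝓘(ℂ) R z := by
  have h1 : MDifferentiableAt 𝓘(ℂ) 𝓘(ℂ)
      (fun y => localParam (R z) (localExpr R z (chartAt ℂ z y))) z :=
    (mdifferentiable_localParam _ _).comp z (hd.mdifferentiableAt.comp z
      (mdifferentiableAt_atlas (chart_mem_atlas ℂ z) (mem_chart_source ℂ z)))
  refine h1.congr_of_eventuallyEq ?_
  filter_upwards [eventually_mem_source_of_continuousAt hR] with y hy
  exact eq_localParam_localExpr hy.1 hy.2

theorem analyticAt_localExpr (hR : ContinuousAt R z)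
    (hd : ∀ᶠ y in 𝓝 z, MDifferentiableAt 𝓘(ℂ) 𝓘(ℂ) R y) :
    AnalyticAt ℂ (localExpr R z) (chartAt ℂ z z) := by
  rw [Complex.analyticAt_iff_eventually_differentiableAt]
  filter_upwards [eventually_chartAt_symm (hd.and (eventually_mem_source_of_continuousAt hR))]
    with ζ hζ
  exact hζ.2.1.differentiableAt_localExpr hζ.1 hζ.2.2.2

/-- Isolated singularities at which the map is continuous are removable. -/
theorem mdifferentiableAt_of_punctured (hR : ContinuousAt R z)
    (hd : ∀ᶠ y in 𝓝[≠] z, MDifferentiableAt 𝓘(ℂ) 𝓘(ℂ) R y) :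
    MDifferentiableAt 𝓘(ℂ) 𝓘(ℂ) R z := by
  refine mdifferentiableAt_of_localExpr hR ?_
  refine (Complex.analyticAt_of_differentiable_on_punctured_nhds_of_continuousAt ?_ ?_).differentiableAt
  · filter_upwards [eventually_chartAt_symm_ne
      (hd.and (nhdsWithin_le_nhds (eventually_mem_source_of_continuousAt hR)))] with ζ hζ
    exact hζ.2.1.differentiableAt_localExpr hζ.1 hζ.2.2.2
  · refine continuousAt_localExpr (mem_chart_target ℂ z) ?_ ?_ <;>
    rw [OpenPartialHomeomorph.left_inv _ (mem_chart_source ℂ z)]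
    · exact mem_chart_source ℂ (R z)
    · exact hR

end LocalExpr

namespace EuclideanPolygon

variable {q n : ℕ}

/-- If the multiplicity at each point of a fiber counts a family of `n` points of that fiber, then
the multiplicities add up to `n`. -/
theorem finsum_eq_of_family {M : Type*} {S : Set M} (hS : S.Finite) {μ : M → ℕ∞} (f : Fin n → M)
    (hfS : ∀ α, f α ∈ S) (hμ : ∀ z ∈ S, μ z = ({α | f α = z}.ncard : ℕ)) :
    ∑ᶠ z ∈ S, μ z = n := by
  classical
  rw [finsum_mem_eq_finite_toFinset_sum _ hS]
  have h1 := Finset.card_eq_sum_card_fiberwise (s := Finset.univ) (t := hS.toFinset) (f := f)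
    (fun α _ => by simpa using hfS α)
  rw [Finset.card_univ, Fintype.card_fin] at h1
  rw [h1, Nat.cast_sum]
  refine Finset.sum_congr rfl fun z hz => ?_
  rw [hμ z (by simpa using hz), ← ncard_coe_finset]
  congr 2
  ext α
  simp

variable [NeZero q] {P : EuclideanPolygon q} {σ : ZMod q → Equiv.Perm (Fin n)}

/-! ### Points over the vertices and cone angles. -/

theorem finite_develop_preimage_vertex : (P.develop σ ⁻¹' range P.vertex).Finite := by
  rw [← iUnion_singleton_eq_range, preimage_iUnion]
  exact finite_iUnion fun j => P.finite_fiber σ _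

theorem eventually_develop_notMem_vertex (z : P.GluedSurface σ) :
    ∀ᶠ y in 𝓝[≠] z, P.develop σ y ∉ range P.vertex := by
  rw [eventually_nhdsWithin_iff]
  filter_upwards [((finite_develop_preimage_vertex.subset (sdiff_subset (t := {z}))).isClosed.isOpen_compl).mem_nhds
    (fun h => h.2 rfl)] with y hy hyz hv
  exact hy ⟨hv, hyz⟩

/-- All corners at z are copies of corner j. The blue tile α is at z exactly when its gray neighbour
across edge j is, and such a pair contributes 2π for every radius. So the sum is constant in r, and
no limit of a single angle is needed. -/
theorem hasConeAngle {z : P.GluedSurface σ} {j : ZMod q} (hz : P.develop σ z = P.vertex j) :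
    P.HasConeAngle σ z (2 * Real.pi * ({α | Sum.inl α ∈ P.tilesAt σ z}.ncard : ℕ)) := by
  classical
  have hcorner : ∀ τ k, P.IsCorner σ z τ k ↔ k = j ∧ τ ∈ P.tilesAt σ z := by
    intro τ k
    constructor
    · rintro ⟨h, rfl⟩
      exact ⟨P.vertex_injective hz, h, rfl⟩
    · rintro ⟨rfl, h, hτ⟩
      have h' := h
      rw [hz] at h'
      refine ⟨h', ?_⟩
      rw [← hτ]
      congr 1
      exact hz.symm
  have hadj : ∀ α, Sum.inr (σ j α) ∈ P.tilesAt σ z ↔ Sum.inl α ∈ P.tilesAt σ z := by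
    intro α
    have hj : P.develop σ z ∈ P.edge j := hz ▸ P.vertex_mem_edge_left j
    have hfr := P.edge_subset_frontier j hj
    have h1 := P.point_inl_eq_inr σ (α := α) hj (P.mem_closure_of_mem_frontier hfr _)
      (P.mem_closure_of_mem_frontier hfr _)
    exact ⟨fun ⟨_, h⟩ => ⟨_, h1.trans h⟩, fun ⟨_, h⟩ => ⟨_, h1.symm.trans h⟩⟩
  refine tendsto_const_nhds.congr' ?_
  filter_upwards [self_mem_nhdsWithin] with r hr
  have h2 := angularSize_add P.isOpen_region (P.vertex j)
    (P.finite_circlePoint_frontier (P.vertex j) hr)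
  have h3 : ∀ τ, (∑ k : ZMod q, if P.IsCorner σ z τ k then
      angularSize (P.openTile τ) (P.vertex k) r else 0) =
      if τ ∈ P.tilesAt σ z then angularSize (P.openTile τ) (P.vertex j) r else 0 := by
    intro τ
    rw [Finset.sum_eq_single j]
    · simp [hcorner]
    · intro k _ hk
      rw [if_neg]
      rw [hcorner]
      exact fun h => hk h.1
    · simp
  rw [Finset.sum_congr rfl fun τ _ => h3 τ, Fintype.sum_sum_type,
    ← Equiv.sum_comp (σ j) (fun β => if Sum.inr β ∈ P.tilesAt σ z then _ else _),
    ← Finset.sum_add_distrib]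
  have h4 : ∀ α : Fin n, ((if (Sum.inl α : Fin n ⊕ Fin n) ∈ P.tilesAt σ z then
      angularSize (P.openTile (Sum.inl α : Fin n ⊕ Fin n)) (P.vertex j) r else 0) +
      if (Sum.inr (σ j α) : Fin n ⊕ Fin n) ∈ P.tilesAt σ z then
      angularSize (P.openTile (Sum.inr (σ j α) : Fin n ⊕ Fin n)) (P.vertex j) r else 0) =
      if (Sum.inl α : Fin n ⊕ Fin n) ∈ P.tilesAt σ z then 2 * Real.pi else 0 := by
    intro α
    by_cases h : (Sum.inl α : Fin n ⊕ Fin n) ∈ P.tilesAt σ z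
    · rw [if_pos h, if_pos ((hadj α).2 h), if_pos h]
      exact h2
    · rw [if_neg h, if_neg (fun h' => h ((hadj α).1 h')), if_neg h, add_zero]
  rw [Finset.sum_congr rfl fun α _ => h4 α, ← Finset.sum_filter, Finset.sum_const, nsmul_eq_mul,
    mul_comm, ← ncard_coe_finset]
  congr 3
  ext α
  simp

variable [ChartedSpace ℂ (P.GluedSurface σ)] [IsManifold 𝓘(ℂ) ω (P.GluedSurface σ)]

/-! ## The developing map is a rational function -/

/-- Off the vertices, the developing map is locally the inverse of a holomorphic sheet. -/
theorem IsFlatStructure.exists_inverse (hf : P.IsFlatStructure σ) {z : P.GluedSurface σ}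
    (hz : P.develop σ z ∉ range P.vertex) :
    DifferentiableAt ℂ (localExpr (P.develop σ) z) (chartAt ℂ z z) ∧
      deriv (localExpr (P.develop σ) z) (chartAt ℂ z z) ≠ 0 := by
  obtain ⟨j, hj⟩ := P.exists_mem_sheetDomain hz
  obtain ⟨α, hα⟩ := P.exists_sheet_eq σ hj
  set w := P.develop σ z with hw
  set g := localExpr (P.develop σ) z with hg
  -- The sheet in coordinates, holomorphic by flatness. It satisfies f (g x) = x, so
  -- `differentiableAt_of_rightInverse` applies to g, and the chain rule then forbids g' = 0.
  let f : ℂ → ℂ := fun ζ => chartAt ℂ z (P.sheet σ α j (localParam w ζ))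
  have hgz : g (chartAt ℂ z z) = 0 := localExpr_self _ z
  have hcR := P.continuous_develop σ
  have hf0 : AnalyticAt ℂ f (g (chartAt ℂ z z)) := by
    rw [hgz, Complex.analyticAt_iff_eventually_differentiableAt]
    have h1 := (continuous_localParam w).tendsto 0
    rw [localParam_zero] at h1
    have h2 : ContinuousAt (P.sheet σ α j) w :=
      (P.continuousOn_sheet σ α j).continuousAt ((P.isOpen_sheetDomain j).mem_nhds hj)
    rw [ContinuousAt, hα] at h2
    filter_upwards [h1.eventually ((P.isOpen_sheetDomain j).eventually_mem hj),
      h1.eventually (h2.eventually ((chartAt ℂ z).open_source.eventually_mem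
        (mem_chart_source ℂ z)))] with ζ h3 h4
    refine mdifferentiableAt_iff_differentiableAt.1 ?_
    have h5 : MDifferentiableAt 𝓘(ℂ) 𝓘(ℂ) (P.sheet σ α j) (localParam w ζ) :=
      (hf α j).mdifferentiableAt ((P.isOpen_sheetDomain j).mem_nhds h3)
    exact (mdifferentiableAt_atlas (chart_mem_atlas ℂ z) h4).comp ζ
      (h5.comp ζ (mdifferentiable_localParam w ζ))
  have hfg : ∀ᶠ x in 𝓝 (chartAt ℂ z z), f (g x) = x := by
    have h1 : ∀ᶠ y in 𝓝 z, y ∈ P.sheet σ α j '' P.sheetDomain j :=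
      (P.isOpen_sheet_image σ α j).eventually_mem ⟨w, hj, hα⟩
    filter_upwards [eventually_chartAt_symm
      (h1.and (eventually_mem_source_of_continuousAt hcR.continuousAt))] with x hx
    obtain ⟨w', hw', hx'⟩ := hx.2.1
    change chartAt ℂ z (P.sheet σ α j (localParam w (localCoord w _))) = x
    rw [localParam_localCoord hx.2.2.2, ← hx', develop_sheet, hx',
      OpenPartialHomeomorph.right_inv _ hx.1]
  have hgc : ∀ᶠ x in 𝓝 (chartAt ℂ z z), ContinuousAt g x := by
    filter_upwards [eventually_chartAt_symm
      (eventually_mem_source_of_continuousAt hcR.continuousAt)] with x hx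
    exact continuousAt_localExpr hx.1 hx.2.2 hcR.continuousAt
  have hgd := differentiableAt_of_rightInverse hf0 hgc hfg
  refine ⟨hgd, fun h0 => ?_⟩
  have h1 : HasDerivAt (f ∘ g) (deriv f (g (chartAt ℂ z z)) * 0) (chartAt ℂ z z) := by
    rw [← h0]
    exact hf0.differentiableAt.hasDerivAt.comp _ hgd.hasDerivAt
  have h2 : HasDerivAt (f ∘ g) 1 (chartAt ℂ z z) :=
    (hasDerivAt_id _).congr_of_eventuallyEq hfg
  have h3 := h2.unique h1
  rw [mul_zero] at h3
  exact one_ne_zero h3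

/-- Only finitely many points lie over vertices, and at those the continuous map has removable
singularities. -/
theorem IsFlatStructure.mdifferentiable_develop (hf : P.IsFlatStructure σ) :
    MDifferentiable 𝓘(ℂ) 𝓘(ℂ) (P.develop σ) := fun z =>
  mdifferentiableAt_of_punctured (P.continuous_develop σ).continuousAt
    ((eventually_develop_notMem_vertex z).mono fun _ hy =>
      mdifferentiableAt_of_localExpr (P.continuous_develop σ).continuousAt (hf.exists_inverse hy).1)

theorem IsFlatStructure.analyticAt_localExpr (hf : P.IsFlatStructure σ) (z : P.GluedSurface σ) :
    AnalyticAt ℂ (localExpr (P.develop σ) z) (chartAt ℂ z z) :=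
  _root_.analyticAt_localExpr (P.continuous_develop σ).continuousAt
    (Eventually.of_forall hf.mdifferentiable_develop)

theorem IsFlatStructure.multiplicityAt_eq_one (hf : P.IsFlatStructure σ) {z : P.GluedSurface σ}
    (hz : P.develop σ z ∉ range P.vertex) : multiplicityAt (P.develop σ) z = 1 := by
  rw [multiplicityAt_eq]
  exact (hf.analyticAt_localExpr z).analyticOrderAt_eq_one_of_zero_deriv_ne_zero
    (localExpr_self _ z) (hf.exists_inverse hz).2

/-- Finite fibers exclude local constancy, so the order of vanishing is finite; it is positive
because the centred local expression vanishes at z. -/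
theorem IsFlatStructure.exists_multiplicityAt_eq (hf : P.IsFlatStructure σ)
    (z : P.GluedSurface σ) : ∃ m : ℕ, m ≠ 0 ∧ multiplicityAt (P.develop σ) z = m := by
  have ha := hf.analyticAt_localExpr z
  have h1 : multiplicityAt (P.develop σ) z ≠ ⊤ := by
    rw [multiplicityAt_eq, Ne, analyticOrderAt_eq_top]
    intro h
    have h2 : ∀ᶠ ζ in 𝓝[≠] (chartAt ℂ z z), False := by
      have h3 : ∀ᶠ y in 𝓝[≠] z, P.develop σ y ≠ P.develop σ z := by
        rw [eventually_nhdsWithin_iff]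
        filter_upwards [(((P.finite_fiber σ (P.develop σ z)).subset
          (sdiff_subset (t := {z}))).isClosed.isOpen_compl).mem_nhds
          (fun h => h.2 rfl)] with y hy hyz hv
        exact hy ⟨hv, hyz⟩
      filter_upwards [eventually_chartAt_symm_ne (h3.and (nhdsWithin_le_nhds
        (eventually_mem_source_of_continuousAt (P.continuous_develop σ).continuousAt))),
        nhdsWithin_le_nhds h] with ζ h4 h5
      refine h4.2.1 ?_
      rw [eq_localParam_localExpr h4.2.2.1 h4.2.2.2, OpenPartialHomeomorph.right_inv _ h4.1, h5,
        localParam_zero]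
    exact h2.exists.elim fun _ => id
  obtain ⟨m, hm⟩ := ENat.ne_top_iff_exists.1 h1
  refine ⟨m, ?_, hm.symm⟩
  rintro rfl
  rw [multiplicityAt_eq] at hm
  exact (ha.analyticOrderAt_ne_zero.2 (localExpr_self _ z)) hm.symm

/-- At a boundary point, the multiplicity of the developing map is the number of blue tiles. -/
theorem IsFlatStructure.multiplicityAt_eq_ncard (hf : P.IsFlatStructure σ) {z : P.GluedSurface σ}
    (hz : P.develop σ z ∈ frontier P.region) :
    multiplicityAt (P.develop σ) z = ({α | Sum.inl α ∈ P.tilesAt σ z}.ncard : ℕ) := by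
  obtain ⟨m, hm, hmul⟩ := hf.exists_multiplicityAt_eq z
  rw [hmul]
  congr 1
  set p := P.develop σ z with hp
  have hcR := P.continuous_develop σ
  have hO : ∀ᶠ ζ in 𝓝 (chartAt ℂ z z), ζ ∈ (chartAt ℂ z).target ∧
      ((chartAt ℂ z).symm ζ ∈ P.star σ z ∧ ((chartAt ℂ z).symm ζ ∈ (chartAt ℂ z).source ∧
        P.develop σ ((chartAt ℂ z).symm ζ) ∈ (chartAt ℂ p).source)) :=
    eventually_chartAt_symm (((P.isOpen_star σ z).eventually_mem (P.mem_star_self σ z)).and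
      (eventually_mem_source_of_continuousAt hcR.continuousAt))
  obtain ⟨O', hO', hOO, hcount⟩ := (hf.analyticAt_localExpr z).exists_ncard_fiber_eq hm hmul hO
  have hN : (chartAt ℂ z).source ∩ chartAt ℂ z ⁻¹' O' ∈ 𝓝 z :=
    inter_mem ((chartAt ℂ z).open_source.mem_nhds (mem_chart_source ℂ z))
      (((chartAt ℂ z).continuousAt (mem_chart_source ℂ z)).preimage_mem_nhds hO')
  have h1 : Tendsto (localCoord p) (𝓝[≠] p) (𝓝[≠] 0) := by
    refine tendsto_nhdsWithin_iff.2 ⟨?_, ?_⟩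
    · have := (mdifferentiableAt_localCoord (mem_chart_source ℂ p)).continuousAt.tendsto
      rw [localCoord_self] at this
      exact this.mono_left nhdsWithin_le_nhds
    · filter_upwards [self_mem_nhdsWithin, nhdsWithin_le_nhds
        ((chartAt ℂ p).open_source.mem_nhds (mem_chart_source ℂ p))] with w hw hw' h0
      refine hw ?_
      rw [mem_singleton_iff] at h0 ⊢
      rw [← localParam_localCoord hw', h0, localParam_zero]
  have h2 : ∃ᶠ w in 𝓝[≠] p, w ∈ P.region := by
    rw [frequently_nhdsWithin_iff]
    refine (mem_closure_iff_frequently.1 (frontier_subset_closure hz)).mono fun w hw => ⟨hw, ?_⟩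
    rintro rfl
    rw [P.isOpen_region.frontier_eq] at hz
    exact hz.2 hw
  have hnear := (P.eventually_star_subset σ z hN).and
    (((P.isOpen_starBase σ z).eventually_mem (P.develop_mem_starBase σ z)).and
      ((chartAt ℂ p).open_source.eventually_mem (mem_chart_source ℂ p)))
  -- For w in the region and close to p, the points of the star over w are counted twice:
  -- analytically there are m (`h3`), combinatorially there is one in each blue tile at z (`h4`).
  obtain ⟨w, hwU, hw1, hw2, hw3, hw4⟩ := (h2.and_eventually ((h1.eventually hcount).and
    (hnear.filter_mono nhdsWithin_le_nhds))).exists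
  have h3 : {y ∈ P.star σ z | P.develop σ y = w} =
      (chartAt ℂ z).symm '' {ζ ∈ O' | localExpr (P.develop σ) z ζ = localCoord p w} := by
    ext y
    constructor
    · rintro ⟨hy, hyw⟩
      have h4 := hw2 y hy hyw
      refine ⟨chartAt ℂ z y, ⟨h4.2, ?_⟩, OpenPartialHomeomorph.left_inv _ h4.1⟩
      rw [localExpr, OpenPartialHomeomorph.left_inv _ h4.1, hyw]
    · rintro ⟨ζ, ⟨hζ, hζw⟩, rfl⟩
      have h4 := hOO hζ
      refine ⟨h4.2.1, ?_⟩
      have h5 := eq_localParam_localExpr (R := P.develop σ) h4.2.2.1 h4.2.2.2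
      rw [OpenPartialHomeomorph.right_inv _ h4.1, hζw, localParam_localCoord hw4] at h5
      exact h5
  have h4 : {y ∈ P.star σ z | P.develop σ y = w} =
      (fun α => P.point σ (Sum.inl α) w (subset_closure hwU)) ''
        {α | Sum.inl α ∈ P.tilesAt σ z} := by
    ext y
    constructor
    · rintro ⟨hy, rfl⟩
      obtain ⟨τ, hτ, h, hτy⟩ := exists_point_of_mem_star hy
      cases τ with
      | inl α => exact ⟨α, hτ, hτy⟩
      | inr β =>
        have h5 : P.develop σ y ∈ closure (closure P.region)ᶜ := h
        rw [P.closure_compl_closure] at h5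
        exact absurd hwU h5
    · rintro ⟨α, hα, rfl⟩
      exact ⟨point_mem_star hα hw3 _, rfl⟩
  rw [← hw1, ← InjOn.ncard_image (f := (chartAt ℂ z).symm)
    ((chartAt ℂ z).symm.injOn.mono fun ζ hζ => (hOO hζ.1).1), ← h3, h4, InjOn.ncard_image]
  intro α _ β _ hαβ
  exact Sum.inl_injective (eq_of_point_eq hαβ (P.openTile_disjoint_frontier (Sum.inl α) hwU))

theorem IsFlatStructure.criticalValues_subset (hf : P.IsFlatStructure σ) :
    criticalValues (P.develop σ) ⊆ range P.vertex := by
  rintro _ ⟨z, hz, rfl⟩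
  by_contra h
  have h1 : 1 < multiplicityAt (P.develop σ) z := hz
  rw [hf.multiplicityAt_eq_one h] at h1
  exact lt_irrefl _ h1

/-- Over a vertex, the n blue tiles list the fiber with each point repeated according to its
multiplicity. Elsewhere the n sheets list it without repetition, and all multiplicities are 1. -/
theorem IsFlatStructure.isRationalOfDegree (hf : P.IsFlatStructure σ) :
    IsRationalOfDegree n (P.develop σ) := by
  refine ⟨hf.mdifferentiable_develop, fun w => ⟨P.finite_fiber σ w, ?_⟩⟩
  by_cases hv : w ∈ range P.vertex
  · have hw : w ∈ frontier P.region := by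
      obtain ⟨j, rfl⟩ := hv
      exact P.vertex_mem_frontier j
    refine finsum_eq_of_family (P.finite_fiber σ w)
      (fun α => P.point σ (Sum.inl α) w (P.mem_closure_of_mem_frontier hw _)) (fun α => rfl) ?_
    rintro z rfl
    rw [hf.multiplicityAt_eq_ncard hw]
    congr 2
    ext α
    exact ⟨fun ⟨_, h⟩ => h, fun h => ⟨_, h⟩⟩
  · obtain ⟨j, hj⟩ := P.exists_mem_sheetDomain hv
    refine finsum_eq_of_family (P.finite_fiber σ w) (fun α => P.sheet σ α j w)
      (fun α => P.develop_sheet σ α j w) ?_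
    rintro z rfl
    obtain ⟨α, hα⟩ := P.exists_sheet_eq σ hj
    have h1 : {β | P.sheet σ β j (P.develop σ z) = z} = {α} := by
      ext β
      rw [mem_ofPred_eq, mem_singleton_iff]
      constructor
      · intro h
        exact P.sheet_injective σ hj (h.trans hα.symm)
      · rintro rfl
        exact hα
    rw [hf.multiplicityAt_eq_one hv, h1, ncard_singleton, Nat.cast_one]

end EuclideanPolygon

/-! ## The pullback of `∂/∂w` -/

namespace RiemannSphere

/-- The coordinate expression of `∂/∂w` in the centred chart at `p`. -/
def ddwCoeff (p : OnePoint ℂ) (s : ℂ) : ℂ := p.elim (-s ^ 2) (fun _ => 1)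

theorem differentiable_ddwCoeff (p : OnePoint ℂ) : Differentiable ℂ (ddwCoeff p) := by
  induction p using OnePoint.rec with
  | infty => exact (differentiable_id.pow 2).neg
  | coe w => exact differentiable_const (1 : ℂ)

theorem mdifferentiable_coe : MDifferentiable 𝓘(ℂ) 𝓘(ℂ) ((↑) : ℂ → OnePoint ℂ) := by
  have h : ((↑) : ℂ → OnePoint ℂ) = localParam ((0 : ℂ) : OnePoint ℂ) := by
    ext w
    rw [localParam_coe, zero_add]
  rw [h]
  exact mdifferentiable_localParam _

/-- For w = 1/s one has dw/ds = -1/s², so ∂/∂w has coefficient -s² in the coordinate s; at s = 0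
both sides vanish. -/
theorem ddw_localParam (p : OnePoint ℂ) (s : ℂ) :
    (ddw (localParam p s) : ℂ) = mfderiv 𝓘(ℂ) 𝓘(ℂ) (localParam p) s (ddwCoeff p s) := by
  have key : ∀ (φ : ℂ → ℂ) (φ' : ℂ), HasDerivAt φ φ' s →
      localParam p =ᶠ[𝓝 s] (fun ζ => (φ ζ : OnePoint ℂ)) → φ' * ddwCoeff p s = 1 →
      (ddw (localParam p s) : ℂ) = mfderiv 𝓘(ℂ) 𝓘(ℂ) (localParam p) s (ddwCoeff p s) := by
    intro φ φ' hφ h hv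
    have h1 := ((mdifferentiable_coe (φ s)).hasMFDerivAt.comp s hφ.hasFDerivAt.hasMFDerivAt)
    have h2 := (h1.congr_of_eventuallyEq h).mfderiv
    have h3 : ((mfderiv 𝓘(ℂ) 𝓘(ℂ) (localParam p) s (ddwCoeff p s) : ℂ)) =
        mfderiv 𝓘(ℂ) 𝓘(ℂ) ((↑) : ℂ → OnePoint ℂ) (φ s) (1 : ℂ) := by
      rw [h2]
      change mfderiv 𝓘(ℂ) 𝓘(ℂ) ((↑) : ℂ → OnePoint ℂ) (φ s) (ddwCoeff p s * φ') = _
      rw [mul_comm, hv]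
    rw [h3, h.self_of_nhds]
    rfl
  induction p using OnePoint.rec with
  | infty =>
    by_cases hs : s = 0
    · subst hs
      have h0 : ddwCoeff OnePoint.infty 0 = 0 := by
        change -(0 : ℂ) ^ 2 = 0
        simp
      rw [h0, localParam_zero]
      exact (map_zero (mfderiv 𝓘(ℂ) 𝓘(ℂ) (localParam OnePoint.infty) 0)).symm
    · refine key (fun ζ => ζ⁻¹) _ (hasDerivAt_inv hs) ?_ ?_
      · filter_upwards [isOpen_compl_singleton.mem_nhds hs] with ζ hζ
        rw [localParam_infty, invMap_coe hζ]
      · change -(s ^ 2)⁻¹ * (-s ^ 2) = 1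
        field_simp
  | coe w =>
    refine key (fun ζ => w + ζ) 1 ((hasDerivAt_id s).const_add w) ?_ (one_mul 1)
    exact Eventually.of_forall fun ζ => localParam_coe w ζ

/-- The differential of the centred parametrization, as an isomorphism. -/
theorem exists_equiv_mfderiv_localParam (p : OnePoint ℂ) (s : ℂ) :
    ∃ S : ℂ ≃L[ℂ] TangentSpace 𝓘(ℂ) (localParam p s),
      (S : ℂ →L[ℂ] TangentSpace 𝓘(ℂ) (localParam p s)) =
        mfderiv 𝓘(ℂ) 𝓘(ℂ) (localParam p) s := by
  have hs := localParam_mem_source p s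
  have h1 := (mdifferentiable_localParam p s).hasMFDerivAt
  have h2 := (mdifferentiableAt_localCoord hs).hasMFDerivAt
  refine ⟨ContinuousLinearEquiv.equivOfInverse' (mfderiv 𝓘(ℂ) 𝓘(ℂ) (localParam p) s)
    (mfderiv 𝓘(ℂ) 𝓘(ℂ) (localCoord p) (localParam p s)) ?_ ?_, rfl⟩
  · have h1' := h1
    rw [← localCoord_localParam p s] at h1'
    have h3 := HasMFDerivAt.comp (localParam p s) h1' h2
    have h4 : HasMFDerivAt 𝓘(ℂ) 𝓘(ℂ) (localParam p ∘ localCoord p) (localParam p s)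
        (ContinuousLinearMap.id ℂ _) := by
      refine (hasMFDerivAt_id (localParam p s)).congr_of_eventuallyEq ?_
      filter_upwards [(chartAt ℂ p).open_source.mem_nhds hs] with y hy
      exact localParam_localCoord hy
    have h5 := hasMFDerivAt_unique h3 h4
    rw [localCoord_localParam] at h5
    exact h5
  · refine hasMFDerivAt_unique (h2.comp s h1) ((hasMFDerivAt_id s).congr_of_eventuallyEq ?_)
    exact Eventually.of_forall fun ζ => localCoord_localParam p ζ

end RiemannSphere

/-- The inverse of a linear map between lines, in coordinates. -/
theorem ContinuousLinearMap.inverse_apply_of_coord {E F : Type*} [AddCommGroup E] [Module ℂ E]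
    [TopologicalSpace E] [AddCommGroup F] [Module ℂ F] [TopologicalSpace F]
    (e : E ≃L[ℂ] ℂ) (S : ℂ ≃L[ℂ] F) {D : E →L[ℂ] F} {c : ℂ} (hD : ∀ x, D x = S (c * e x)) {f : F} {v : ℂ}
    (hf : f = S v) : e (D.inverse f) = c⁻¹ * v ∧ (c ≠ 0 → D (D.inverse f) = f) := by
  subst hf
  -- At a critical point D is not invertible, so `inverse` is zero by convention; as 0⁻¹ = 0, the
  -- formula holds there too.
  by_cases hc : c = 0
  · subst hc
    refine ⟨?_, fun h => absurd rfl h⟩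
    rw [inverse_of_not_isInvertible, zero_apply, map_zero, inv_zero, zero_mul]
    rintro ⟨N, rfl⟩
    have h : N (e.symm 1) = 0 := by simpa using hD (e.symm 1)
    simp at h
  · let N : E ≃L[ℂ] F := (e.trans (ContinuousLinearEquiv.unitsEquivAut ℂ (Units.mk0 c hc))).trans S
    have h : D = N := by
      ext x
      rw [hD x, mul_comm]
      rfl
    have h1 : N (e.symm (c⁻¹ * v)) = S v := by
      have h2 := hD (e.symm (c⁻¹ * v))
      rw [ContinuousLinearEquiv.apply_symm_apply, mul_inv_cancel_left₀ hc, h] at h2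
      exact h2
    rw [h, inverse_equiv, ← h1]
    simp

section Pullback

variable {M : Type*} [TopologicalSpace M] [ChartedSpace ℂ M] [IsManifold 𝓘(ℂ) ω M]
  {R : M → OnePoint ℂ}

/-- The local expression of the pullback of `∂/∂w`. -/
theorem mfderiv_chartAt_mpullback_ddw (hR : MDifferentiable 𝓘(ℂ) 𝓘(ℂ) R) {z x : M}
    (hx : x ∈ (chartAt ℂ z).source) (hs : R x ∈ (chartAt ℂ (R z)).source) :
    (mfderiv 𝓘(ℂ) 𝓘(ℂ) (chartAt ℂ z) x (VectorField.mpullback 𝓘(ℂ) 𝓘(ℂ) R ddw x) : ℂ) =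
      (deriv (localExpr R z) (chartAt ℂ z x))⁻¹ *
        ddwCoeff (R z) (localExpr R z (chartAt ℂ z x)) ∧
    (deriv (localExpr R z) (chartAt ℂ z x) ≠ 0 →
      mfderiv 𝓘(ℂ) 𝓘(ℂ) R x (VectorField.mpullback 𝓘(ℂ) 𝓘(ℂ) R ddw x) = ddw (R x)) := by
  set p := R z with hp
  set c := deriv (localExpr R z) (chartAt ℂ z x) with hc
  set s := localExpr R z (chartAt ℂ z x) with hsdef
  have hxs : R x = localParam p s := eq_localParam_localExpr hx hs
  have hd : HasDerivAt (localExpr R z) c (chartAt ℂ z x) := by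
    refine DifferentiableAt.hasDerivAt (MDifferentiableAt.differentiableAt_localExpr
      ((chartAt ℂ z).map_source hx) ?_ (hR _))
    rwa [OpenPartialHomeomorph.left_inv _ hx]
  obtain ⟨S, hS⟩ := exists_equiv_mfderiv_localParam p s
  let e : TangentSpace 𝓘(ℂ) x ≃L[ℂ] ℂ := (mdifferentiable_chart (I := 𝓘(ℂ)) z).mfderiv hx
  have he : (e : TangentSpace 𝓘(ℂ) x →L[ℂ] ℂ) = mfderiv 𝓘(ℂ) 𝓘(ℂ) (chartAt ℂ z) x := rfl
  have hD : ∀ u, mfderiv 𝓘(ℂ) 𝓘(ℂ) R x u = S (c * e u) := by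
    have h1 := (mdifferentiableAt_atlas (I := 𝓘(ℂ)) (chart_mem_atlas ℂ z) hx).hasMFDerivAt
    have h2 := hd.hasFDerivAt.hasMFDerivAt.comp x h1
    have h3 := ((mdifferentiable_localParam p s).hasMFDerivAt).comp x h2
    have h4 := (h3.congr_of_eventuallyEq (f₁ := R) ?_).mfderiv
    · intro u
      rw [h4, ← hS]
      change S (e u * c) = _
      rw [mul_comm]
    · filter_upwards [(chartAt ℂ z).open_source.mem_nhds hx,
        (hR x).continuousAt.preimage_mem_nhds ((chartAt ℂ p).open_source.mem_nhds hs)] with y hy hy'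
      exact eq_localParam_localExpr hy hy'
  have hV : (ddw (R x) : ℂ) = S (ddwCoeff p s) := by
    rw [hxs, ddw_localParam, ← hS]
    rfl
  exact ContinuousLinearMap.inverse_apply_of_coord (F := TangentSpace 𝓘(ℂ) (R x)) e S hD hV

/-- In coordinates the pullback is the inverse of the derivative of the local expression times an
analytic coefficient, so its only possible singularities are poles. -/
theorem isRationalVectorField_mpullback_ddw (hR : MDifferentiable 𝓘(ℂ) 𝓘(ℂ) R) :
    IsRationalVectorField (VectorField.mpullback 𝓘(ℂ) 𝓘(ℂ) R ddw) := by
  intro z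
  have ha : AnalyticAt ℂ (localExpr R z) (chartAt ℂ z z) :=
    analyticAt_localExpr (hR z).continuousAt (Eventually.of_forall hR)
  have h1 : MeromorphicAt (fun ζ => (deriv (localExpr R z) ζ)⁻¹ *
      ddwCoeff (R z) (localExpr R z ζ)) (chartAt ℂ z z) :=
    ha.deriv.meromorphicAt.inv.mul
      (((differentiable_ddwCoeff (R z)).analyticAt _).comp ha).meromorphicAt
  refine h1.congr (Eventually.filter_mono nhdsWithin_le_nhds ?_)
  filter_upwards [eventually_chartAt_symm
    (eventually_mem_source_of_continuousAt (hR z).continuousAt)] with ζ hζ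
  have h2 := (mfderiv_chartAt_mpullback_ddw hR hζ.2.1 hζ.2.2).1
  rw [OpenPartialHomeomorph.right_inv _ hζ.1] at h2
  exact h2.symm

theorem mfderiv_mpullback_ddw (hR : MDifferentiable 𝓘(ℂ) 𝓘(ℂ) R) {z : M}
    (hz : multiplicityAt R z = 1) :
    mfderiv 𝓘(ℂ) 𝓘(ℂ) R z (VectorField.mpullback 𝓘(ℂ) 𝓘(ℂ) R ddw z) = ddw (R z) := by
  refine (mfderiv_chartAt_mpullback_ddw hR (mem_chart_source ℂ z) (mem_chart_source ℂ (R z))).2 ?_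
  have ha : AnalyticAt ℂ (localExpr R z) (chartAt ℂ z z) :=
    analyticAt_localExpr (hR z).continuousAt (Eventually.of_forall hR)
  rw [multiplicityAt_eq] at hz
  -- Order 1 for the local expression means order 0 for its derivative, which therefore does not
  -- vanish.
  have h1 := (analyticOrderAt_deriv_eq_iff ha (localExpr_self R z) (n := 0)).1
    (by rw [hz, Nat.cast_zero, zero_add])
  exact ha.deriv.analyticOrderAt_eq_zero.1 h1

end Pullback

/-! ## The tessellation -/

namespace EuclideanPolygon

variable {q n : ℕ} {P : EuclideanPolygon q} {σ : ZMod q → Equiv.Perm (Fin n)}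

theorem mem_tile_iff {τ τ' : Fin n ⊕ Fin n} {w : OnePoint ℂ} {h : w ∈ closure (P.openTile τ')} :
    P.point σ τ' w h ∈ P.tile σ τ ↔ τ' = τ ∧ w ∈ P.openTile τ := by
  constructor
  · rintro ⟨w', hw', h'⟩
    have h1 : w' = w := congrArg (P.develop σ) h'
    subst h1
    exact ⟨(eq_of_point_eq h' (P.openTile_disjoint_frontier τ hw')).symm, hw'⟩
  · rintro ⟨rfl, hw⟩
    exact ⟨w, hw, rfl⟩

theorem disjoint_tile {τ τ' : Fin n ⊕ Fin n} (h : τ ≠ τ') :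
    Disjoint (P.tile σ τ) (P.tile σ τ') := by
  rw [Set.disjoint_left]
  rintro _ ⟨w, hw, rfl⟩ h'
  exact h (mem_tile_iff.1 h').1

theorem develop_mem_openTile {τ : Fin n ⊕ Fin n} {z : P.GluedSurface σ} (hz : z ∈ P.tile σ τ) :
    P.develop σ z ∈ P.openTile τ := by
  obtain ⟨w, hw, rfl⟩ := hz
  exact hw

theorem iUnion_tile : ⋃ τ, P.tile σ τ = (P.develop σ ⁻¹' frontier P.region)ᶜ := by
  ext z
  rw [mem_iUnion]
  constructor
  · rintro ⟨τ, hz⟩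
    exact P.openTile_disjoint_frontier τ (develop_mem_openTile hz)
  · intro hz
    obtain ⟨τ, h, hτ⟩ := P.exists_point_develop σ z
    have h' := h
    rw [P.closure_openTile] at h'
    refine ⟨τ, ?_⟩
    rw [← hτ]
    exact mem_tile_iff.2 ⟨rfl, h'.resolve_right hz⟩

theorem tile_nonempty (τ : Fin n ⊕ Fin n) : (P.tile σ τ).Nonempty := by
  obtain ⟨-, e, -, -, he⟩ := P.isJordanDomain_openTile τ
  have h : e 0 ∈ P.openTile τ := he ▸ mem_image_of_mem e (Metric.mem_ball_self one_pos)
  exact ⟨_, e 0, h, rfl⟩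

/-- The image of edge `j` in the tile `τ`. -/
def edgeIn (P : EuclideanPolygon q) (σ : ZMod q → Equiv.Perm (Fin n)) (τ : Fin n ⊕ Fin n)
    (j : ZMod q) : Set (P.GluedSurface σ) :=
  {z | ∃ w ∈ P.edge j, ∃ h, P.point σ τ w h = z}

theorem isSimplePath_edgeIn (τ : Fin n ⊕ Fin n) (j : ZMod q) : IsSimplePath (P.edgeIn σ τ j) := by
  obtain ⟨f, hf, hfi, hfr, -, -⟩ := (P.edge_segment j).exists_path
  have hmem : ∀ t, f t ∈ P.edge j := fun t => hfr ▸ mem_range_self t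
  have hmem' : ∀ t, f t ∈ closure (P.openTile τ) := fun t =>
    P.mem_closure_of_mem_frontier (P.edge_subset_frontier j (hmem t)) τ
  refine ⟨fun t => P.point σ τ (f t) (hmem' t),
    (P.continuous_point σ τ).comp (hf.subtype_mk hmem'),
    fun s t h => hfi (congrArg (P.develop σ) h), ?_⟩
  ext z
  constructor
  · rintro ⟨t, rfl⟩
    exact ⟨f t, hmem t, hmem' t, rfl⟩
  · rintro ⟨w, hw, h, rfl⟩
    rw [← hfr] at hw
    obtain ⟨t, rfl⟩ := hw
    exact ⟨t, rfl⟩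

variable [NeZero q]

/-- No interior point of a tile is glued to another point, so the complement of the tile is the
image of a closed set under the closed map `glue`. -/
theorem isOpen_tile (τ : Fin n ⊕ Fin n) : IsOpen (P.tile σ τ) := by
  have h1 : IsOpen {x : P.TileUnion n | x.1.1 = τ ∧ x.1.2 ∈ P.openTile τ} :=
    ((isOpen_discrete {τ}).preimage (continuous_fst.comp continuous_subtype_val)).inter
      ((P.isOpen_openTile τ).preimage (continuous_snd.comp continuous_subtype_val))
  have h2 : (P.tile σ τ)ᶜ = P.glue σ '' {x | x.1.1 = τ ∧ x.1.2 ∈ P.openTile τ}ᶜ := by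
    ext z
    constructor
    · intro hz
      obtain ⟨τ', w, hw, rfl⟩ := P.exists_point σ z
      exact ⟨⟨(τ', w), hw⟩, fun h => hz (mem_tile_iff.2 h), rfl⟩
    · rintro ⟨⟨⟨τ', w⟩, hw⟩, hx, rfl⟩ hz
      exact hx (mem_tile_iff.1 hz)
  rw [← isClosed_compl_iff, h2]
  exact P.isClosedMap_glue σ _ h1.isClosed_compl

theorem closure_tile (τ : Fin n ⊕ Fin n) : closure (P.tile σ τ) = P.closedTile σ τ := by
  refine Subset.antisymm (closure_minimal ?_ (P.isClosed_closedTile σ τ)) ?_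
  · rintro _ ⟨w, hw, rfl⟩
    exact ⟨⟨w, subset_closure hw⟩, rfl⟩
  · rintro _ ⟨x, rfl⟩
    have h1 : x ∈ closure (Subtype.val ⁻¹' P.openTile τ) := by
      rw [closure_subtype, Subtype.image_preimage_coe, inter_eq_right.2 subset_closure]
      exact x.2
    refine closure_mono ?_ (image_closure_subset_closure_image (P.continuous_point σ τ)
      (mem_image_of_mem _ h1))
    rintro _ ⟨y, hy, rfl⟩
    exact ⟨y.1, hy, rfl⟩

theorem isJordanDomain_tile (τ : Fin n ⊕ Fin n) : IsJordanDomain (P.tile σ τ) := by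
  classical
  obtain ⟨-, e, hec, hei, he⟩ := P.isJordanDomain_openTile τ
  have hcl := IsJordanDomain.closure_eq hec he
  have hmem : ∀ ζ ∈ Metric.closedBall (0 : ℂ) 1, e ζ ∈ closure (P.openTile τ) := fun ζ hζ =>
    hcl ▸ mem_image_of_mem e hζ
  have hmem' : ∀ ζ ∈ Metric.ball (0 : ℂ) 1, e ζ ∈ P.openTile τ := fun ζ hζ =>
    he ▸ mem_image_of_mem e hζ
  -- The default value concerns only parameters outside the closed disc.
  let E : ℂ → P.GluedSurface σ := fun ζ => if h : e ζ ∈ closure (P.openTile τ) then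
    P.point σ τ (e ζ) h else (tile_nonempty τ).some
  have hE : ∀ ζ (hζ : ζ ∈ Metric.closedBall (0 : ℂ) 1),
      E ζ = P.point σ τ (e ζ) (hmem ζ hζ) := fun ζ hζ => dif_pos (hmem ζ hζ)
  refine ⟨isOpen_tile τ, E, ?_, ?_, ?_⟩
  · rw [continuousOn_iff_continuous_domRestrict] at hec ⊢
    have h1 : (Metric.closedBall (0 : ℂ) 1).domRestrict E =
        fun x => P.point σ τ (e x.1) (hmem x.1 x.2) := funext fun x => hE x.1 x.2
    rw [h1]
    exact (P.continuous_point σ τ).comp (hec.subtype_mk fun x => hmem x.1 x.2)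
  · intro x hx y hy hxy
    rw [hE x hx, hE y hy] at hxy
    exact hei hx hy (congrArg (P.develop σ) hxy)
  · ext z
    constructor
    · rintro ⟨ζ, hζ, rfl⟩
      rw [hE ζ (Metric.ball_subset_closedBall hζ)]
      exact mem_tile_iff.2 ⟨rfl, hmem' ζ hζ⟩
    · rintro ⟨w, hw, rfl⟩
      rw [← he] at hw
      obtain ⟨ζ, hζ, rfl⟩ := hw
      exact ⟨ζ, hζ, hE ζ (Metric.ball_subset_closedBall hζ)⟩

theorem closedTile_inter {τ τ' : Fin n ⊕ Fin n} (h : τ ≠ τ') :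
    P.closedTile σ τ ∩ P.closedTile σ τ' =
      ⋃₀ (P.edgeIn σ τ '' {j | Adjacent σ j τ τ'}) ∪
        (P.closedTile σ τ ∩ P.closedTile σ τ' ∩ P.develop σ ⁻¹' range P.vertex) := by
  ext z
  rw [sUnion_image]
  constructor
  · rintro ⟨⟨⟨w, hw⟩, rfl⟩, ⟨⟨w', hw'⟩, hy⟩⟩
    obtain rfl : w' = w := congrArg (P.develop σ) hy
    by_cases hv : w' ∈ range P.vertex
    · exact Or.inr ⟨⟨⟨⟨w', hw⟩, rfl⟩, ⟨⟨w', hw'⟩, hy⟩⟩, hv⟩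
    · obtain ⟨j, hjw, hj⟩ := (eq_or_adjacent_of_point_eq hy.symm hv).resolve_left h
      exact Or.inl (mem_iUnion₂.2 ⟨j, hj, w', hjw, hw, rfl⟩)
  · rintro (hz | hz)
    · obtain ⟨j, hj, w, hw, hwτ, rfl⟩ := mem_iUnion₂.1 hz
      have h' := P.mem_closure_of_mem_frontier (P.edge_subset_frontier j hw) τ'
      exact ⟨⟨⟨w, hwτ⟩, rfl⟩, ⟨⟨w, h'⟩, (point_eq_of_adjacent hj hw _ _).symm⟩⟩
    · exact hz.1

theorem isTessellation_tile : IsTessellation (P.tile σ) where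
  jordan := isJordanDomain_tile
  disjoint _ _ := disjoint_tile
  cover := by
    refine eq_univ_of_forall fun z => ?_
    obtain ⟨τ, w, hw, rfl⟩ := P.exists_point σ z
    refine mem_iUnion.2 ⟨τ, ?_⟩
    rw [closure_tile]
    exact ⟨⟨w, hw⟩, rfl⟩
  meet τ τ' h := by
    refine ⟨_, P.closedTile σ τ ∩ P.closedTile σ τ' ∩ P.develop σ ⁻¹' range P.vertex,
      (toFinite {j | Adjacent σ j τ τ'}).image (P.edgeIn σ τ),
      finite_develop_preimage_vertex.subset inter_subset_right, ?_, ?_⟩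
    · rintro _ ⟨j, -, rfl⟩
      exact isSimplePath_edgeIn τ j
    · rw [closure_tile, closure_tile]
      exact closedTile_inter h
  alternating τ τ' h hc := by
    -- Gluing along edges joins only tiles of opposite colors, so tiles of the same color share
    -- vertices at most.
    have h1 : {j | Adjacent σ j τ τ'} = ∅ := by
      refine eq_empty_of_forall_notMem ?_
      rintro j ⟨α, ⟨rfl, rfl⟩ | ⟨rfl, rfl⟩⟩ <;> simp at hc
    rw [closure_tile, closure_tile, closedTile_inter h, h1, image_empty, sUnion_empty, empty_union]
    exact finite_develop_preimage_vertex.subset inter_subset_right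

/-- The tiles are connected, open and disjoint, so each is clopen in their union. -/
theorem connectedComponentIn_eq_tile {τ : Fin n ⊕ Fin n} {z : P.GluedSurface σ}
    (hz : z ∈ P.tile σ τ) :
    connectedComponentIn (P.develop σ ⁻¹' frontier P.region)ᶜ z = P.tile σ τ := by
  rw [← iUnion_tile]
  have hz' : z ∈ ⋃ τ, P.tile σ τ := mem_iUnion.2 ⟨τ, hz⟩
  refine Subset.antisymm ?_ ((isJordanDomain_tile τ).isPreconnected.subset_connectedComponentIn hz
    (subset_iUnion (P.tile σ) τ))
  refine IsPreconnected.subset_left_of_subset_union (v := ⋃ τ' ∈ ({τ}ᶜ : Set (Fin n ⊕ Fin n)), P.tile σ τ')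
    (isOpen_tile τ)
    (isOpen_biUnion fun τ' _ => isOpen_tile τ') ?_ ?_ ⟨z, mem_connectedComponentIn hz', hz⟩
    isPreconnected_connectedComponentIn
  · refine disjoint_iUnion₂_right.2 fun τ' h => disjoint_tile ?_
    exact fun h' => h h'.symm
  · refine (connectedComponentIn_subset _ _).trans fun y hy => ?_
    obtain ⟨τ', hτ'⟩ := mem_iUnion.1 hy
    by_cases h : τ' = τ
    · exact Or.inl (h ▸ hτ')
    · exact Or.inr (mem_iUnion₂.2 ⟨τ', h, hτ'⟩)

theorem tilesOver_region : tilesOver (P.develop σ) (frontier P.region) P.region =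
    range (fun α => P.tile σ (Sum.inl α)) := by
  ext C
  constructor
  · rintro ⟨z, hz, rfl⟩
    have hz' : z ∈ ⋃ τ, P.tile σ τ := by
      rw [iUnion_tile]
      -- An open tile depends only on its color, so an index in `Fin 1` serves when no tile of M is
      -- at hand.
      exact P.openTile_disjoint_frontier (n := 1) (Sum.inl 0) hz
    obtain ⟨τ | τ, hτ⟩ := mem_iUnion.1 hz'
    · exact ⟨τ, (connectedComponentIn_eq_tile hτ).symm⟩
    · exact absurd (subset_closure hz) (develop_mem_openTile hτ)
  · rintro ⟨α, rfl⟩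
    obtain ⟨z, hz⟩ := tile_nonempty (P := P) (σ := σ) (Sum.inl α)
    exact ⟨z, develop_mem_openTile hz, (connectedComponentIn_eq_tile hz).symm⟩

theorem tilesOver_compl : tilesOver (P.develop σ) (frontier P.region) (closure P.region)ᶜ =
    range (fun α => P.tile σ (Sum.inr α)) := by
  ext C
  constructor
  · rintro ⟨z, hz, rfl⟩
    have hz' : z ∈ ⋃ τ, P.tile σ τ := by
      rw [iUnion_tile]
      exact P.openTile_disjoint_frontier (n := 1) (Sum.inr 0) hz
    obtain ⟨τ | τ, hτ⟩ := mem_iUnion.1 hz'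
    · exact absurd (subset_closure (develop_mem_openTile hτ)) hz
    · exact ⟨τ, (connectedComponentIn_eq_tile hτ).symm⟩
  · rintro ⟨α, rfl⟩
    obtain ⟨z, hz⟩ := tile_nonempty (P := P) (σ := σ) (Sum.inr α)
    exact ⟨z, develop_mem_openTile hz, (connectedComponentIn_eq_tile hz).symm⟩

end EuclideanPolygon

end

/-! ### The main theorem. -/

theorem mainTheorem3 {q n : ℕ} [NeZero q] (hq : 2 ≤ q) (hn : 2 ≤ n) (P : EuclideanPolygon q)
    (σ : ZMod q → Equiv.Perm (Fin n)) (hM : ConnectedSpace (P.GluedSurface σ)) :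
    -- the glued space is a compact Riemann surface
    (CompactSpace (P.GluedSurface σ) ∧ T2Space (P.GluedSurface σ) ∧
      ∃ _ : ChartedSpace ℂ (P.GluedSurface σ),
        IsManifold 𝓘(ℂ) ω (P.GluedSurface σ) ∧ P.IsFlatStructure σ) ∧
    -- and as such it determines a rational function `R`
    ∀ [ChartedSpace ℂ (P.GluedSurface σ)] [IsManifold 𝓘(ℂ) ω (P.GluedSurface σ)],
      P.IsFlatStructure σ →
      ∃! R : P.GluedSurface σ → OnePoint ℂ,
        -- `R` is of degree `n` and is the identity on each closed tile
        IsRationalOfDegree n R ∧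
        (∀ τ w hw, R (P.point σ τ w hw) = w) ∧
        -- the tessellation of `R` and `γ = ∂P` is the glued one
        criticalValues R ⊆ range P.vertex ∧
        IsTessellation (P.tile σ) ∧
        tilesOver R (frontier P.region) P.region = range (fun α => P.tile σ (Sum.inl α)) ∧
        tilesOver R (frontier P.region) (closure P.region)ᶜ =
          range (fun α => P.tile σ (Sum.inr α)) ∧
        -- each vertex has cone angle `2πν`, where `ν` is the multiplicity of `R` there
        (∀ z ∈ P.vertexSet σ, ∃ ν : ℕ, 1 ≤ ν ∧ multiplicityAt R z = ν ∧
          P.HasConeAngle σ z (2 * Real.pi * ν)) ∧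
        -- the pullback `X = R^* ∂/∂w` is a rational vector field
        IsRationalVectorField (VectorField.mpullback 𝓘(ℂ) 𝓘(ℂ) R RiemannSphere.ddw) ∧
        (∀ z, multiplicityAt R z = 1 →
          mfderiv 𝓘(ℂ) 𝓘(ℂ) R z (VectorField.mpullback 𝓘(ℂ) 𝓘(ℂ) R RiemannSphere.ddw z) = RiemannSphere.ddw (R z)) := by
  refine ⟨⟨inferInstance, inferInstance, P.exists_isFlatStructure σ⟩, ?_⟩
  intro _ _ hf
  refine ⟨P.develop σ, ⟨hf.isRationalOfDegree, fun _ _ _ => rfl, hf.criticalValues_subset,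
    EuclideanPolygon.isTessellation_tile, EuclideanPolygon.tilesOver_region,
    EuclideanPolygon.tilesOver_compl, ?_,
    isRationalVectorField_mpullback_ddw hf.mdifferentiable_develop,
    fun z hz => mfderiv_mpullback_ddw hf.mdifferentiable_develop hz⟩, ?_⟩
  · rintro z ⟨τ, j, h, rfl⟩
    obtain ⟨ν, hν, hmul⟩ := hf.exists_multiplicityAt_eq (P.point σ τ (P.vertex j) h)
    refine ⟨ν, Nat.one_le_iff_ne_zero.2 hν, hmul, ?_⟩
    have h1 := hf.multiplicityAt_eq_ncard (z := P.point σ τ (P.vertex j) h)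
      (P.vertex_mem_frontier j)
    rw [hmul, Nat.cast_inj] at h1
    rw [h1]
    exact EuclideanPolygon.hasConeAngle rfl
  -- The closed tiles cover M, so being the identity on each of them determines R.
  · rintro R ⟨-, hR, -⟩
    ext z
    obtain ⟨τ, w, hw, rfl⟩ := P.exists_point σ z
    exact hR τ w hw
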